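/- Let $H=(H,\cdot,1,\Delta,\varepsilon,S,R)$ be a quasitriangular Hopf algebra over a field $\Bbbk$, with $R=R_{[1]}\otimes R_{[2]}$ (summation understood; $R^1,R^2,\dots$ denote copies of $R$, and $\Delta(h)=h_{(1)}\otimes h_{(2)}$). Let $H^\circ\subset H^*$ be the restricted dual, spanned by the matrix coefficients of finite-dimensional left $H$-modules, with $(h\triangleright\varphi)(x)=\varphi(xh)$, $(\varphi\triangleleft h)(x)=\varphi(hx)$, $(\varphi\star\psi)(x)=\varphi(x_{(1)})\psi(x_{(2)})$, right coadjoint action $\mathrm{coad}^r(h)(\varphi)=\varphi(h_{(1)}\,?\,S(h_{(2)}))$, and $\Phi(\varphi)=(\varphi\otimes\mathrm{id})(RR')\in H$, where $R'=R_{[2]}\otimes R_{[1]}$. Right $H$-modules (action written $v\mathbin{\blacksquare}h$) form a category $\mathrm{Mod}\text{-}H$, braided by $c(v\otimes w)=(w\mathbin{\blacksquare}R_{[1]})\otimes(v\mathbin{\blacksquare}R_{[2]})$. A right $H$-module-algebra $A$ is an algebra object of $\mathrm{Mod}\text{-}H$, and an $H$-equivariant $A$-module is a left $A$-module $M$ that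 is a right $H$-module with $(a\cdot v)\mathbin{\blacksquare}h=(a\mathbin{\blacksquare}h_{(1)})\cdot(v\mathbin{\blacksquare}h_{(2)})$. The braided tensor product of $A_1,A_2$ has product $(a_1\otimes a_2)(a_1'\otimes a_2')=a_1(a_1'\mathbin{\blacksquare}R_{[1]})\otimes(a_2\mathbin{\blacksquare}R_{[2]})a_2'$, and the braided external product of an $A_1$-module and an $A_2$-module has action $(a_1\otimes a_2)\cdot(v_1\otimes v_2)=a_1\cdot(v_1\mathbin{\blacksquare}R_{[1]})\otimes(a_2\mathbin{\blacksquare}R_{[2]})\cdot v_2$; in both cases $H$ acts diagonally through $\Delta$. Let $\mathcal L_{0,1}(H)$ be $H^\circ$ with the action $\mathrm{coad}^r$, unit $\varepsilon$ and product $\varphi\psi=(R^2_{[2]}S(R^1_{[2]})\triangleright\varphi)\star(R^2_{[1]}\triangleright\psi\triangleleft R^1_{[1]})$. Let $\mathcal L_{1,0}(H)$ be $H^\circ\otimes H^\circ$ with the diagonal coadjoint action and the product such that $\mathfrak i_b(\varphi)=\varphi\otimes\varepsilon$ and $\mathfrak i_a(\varphi)=\varepsilon\otimes\varphi$ are algebra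 morphisms from $\mathcal L_{0,1}(H)$, $\mathfrak i_b(\beta)\mathfrak i_a(\alpha)=\beta\otimes\alpha$, and $$\mathfrak i_a(\alpha)\mathfrak i_b(\beta)=\mathfrak i_b\bigl(R^4_{[2]}R^3_{[1]}\triangleright\beta\triangleleft R^1_{[1]}R^2_{[1]}\bigr)\,\mathfrak i_a\bigl(R^3_{[2]}S(R^1_{[2]})\triangleright\alpha\triangleleft R^2_{[2]}R^4_{[1]}\bigr).$$ For $g,n\ge 0$ let $\mathcal L_{g,n}(H)$ be the braided tensor product of $g$ copies of $\mathcal L_{1,0}(H)$ followed by $n$ copies of $\mathcal L_{0,1}(H)$. A left $H$-module $X_j$ carries $\varphi\cdot x=\Phi(\varphi)x$ (for $\varphi\in\mathcal L_{0,1}(H)$) and $x\mathbin{\blacksquare}h=S(h)x$. The space $H^\circ$ carries the action of $\mathcal L_{1,0}(H)$ given by $\mathfrak i_b(\varphi)\cdot\psi=\varphi\psi$ (product of $\mathcal L_{0,1}(H)$), $\mathfrak i_a(\varphi)\cdot\psi=\Phi\bigl(\mathrm{coad}^r(R_{[2]})(\varphi)\bigr)\triangleright\psi\triangleleft R_{[1]}$,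 and $\psi\mathbin{\blacksquare}h=\mathrm{coad}^r(h)(\psi)$. Let $X_1,\dots,X_n$ be left $H$-modules and let $M=(H^\circ)^{\otimes g}\otimes X_1\otimes\dots\otimes X_n$ be the braided external product of these. Theorem. $\mathcal L_{g,n}(H)$ is a right $H$-module-algebra and $M$ is an $H$-equivariant $\mathcal L_{g,n}(H)$-module. Let $\mathcal L_{g,n}^{\mathrm{inv}}(H)=\{a\in\mathcal L_{g,n}(H) : a\mathbin{\blacksquare}h=\varepsilon(h)a\ \text{for all } h\in H\}$, a subalgebra. For every right $H$-module $X$ (for instance a left $H$-module with $x\mathbin{\blacksquare}h=S(h)x$) and every $m\ge 0$ there is a unique representation ($\Bbbk$-algebra morphism) $\mathcal L_{g,n}^{\mathrm{inv}}(H)\to\mathrm{End}_\Bbbk\bigl(\mathrm{Ext}^m_H(X,M)\bigr)$ such that, for every projective resolution $P_\bullet\to X$ in $\mathrm{Mod}\text{-}H$, every cocycle $f\in\mathrm{Hom}_H(P_m,M)$ and every $a\in\mathcal L_{g,n}^{\mathrm{inv}}(H)$, $$a\cdot[f]=[a\cdot f],\qquad (a\cdot f)(x)=a\cdot f(x).$$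 -/

import Mathlib

open TensorProduct CategoryTheory CategoryTheory.Abelian
open scoped ModuleCat

universe u

noncomputable section

/-- A quasitriangular structure on a Hopf algebra `H` over `k`: an invertible element
`R = R₁ ⊗ R₂` of `H ⊗ H` with `R Δ(h) = Δᵒᵖ(h) R`, `(Δ ⊗ id)(R) = R₁₃ R₂₃` and
`(id ⊗ Δ)(R) = R₁₃ R₁₂`. Here `H ⊗ (H ⊗ H)` is used for the triple tensor product. -/
structure QuasitriangularStructure (k H : Type u) [Field k] [Ring H] [HopfAlgebra k H] where
  R : H ⊗[k] H
  isUnit : IsUnit R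
  quasi_cocomm : ∀ h : H,
    R * Coalgebra.comul h = TensorProduct.comm k H H (Coalgebra.comul h) * R
  comul_fst :
    TensorProduct.assoc k H H H ((Coalgebra.comul (R := k)).rTensor H R) =
      TensorProduct.leftComm k H H H ((1 : H) ⊗ₜ[k] R) * ((1 : H) ⊗ₜ[k] R)
  comul_snd :
    (Coalgebra.comul (R := k)).lTensor H R =
      TensorProduct.leftComm k H H H ((1 : H) ⊗ₜ[k] R) *
        TensorProduct.assoc k H H H (R ⊗ₜ[k] (1 : H))

/-- The flipped element `R₂ ⊗ R₁`. -/
def QuasitriangularStructure.flip {k H : Type u} [Field k] [Ring H] [HopfAlgebra k H]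
    (Q : QuasitriangularStructure k H) : H ⊗[k] H :=
  TensorProduct.comm k H H Q.R

/-! ### Right modules over a Hopf algebra -/

/-- A right `H`-module, given as a `k`-vector space with the right action `act h v = v ◁ h`. -/
structure HopfRightModule (k H : Type u) [Field k] [Ring H] [HopfAlgebra k H] where
  carrier : Type u
  [addCommGroup : AddCommGroup carrier]
  [module : Module k carrier]
  act : H →ₗ[k] Module.End k carrier
  act_one : act 1 = 1
  act_mul : ∀ g h : H, act (g * h) = act h * act g

attribute [instance] HopfRightModule.addCommGroup HopfRightModule.module

namespace HopfRightModule

variable {k H : Type u} [Field k] [Ring H] [HopfAlgebra k H]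

/-- Right `H`-modules are modules over the opposite algebra. -/
instance (V : HopfRightModule k H) : Module Hᵐᵒᵖ V.carrier where
  smul h v := V.act h.unop v
  one_smul v := by change V.act 1 v = v; rw [V.act_one]; rfl
  mul_smul g h v := by
    change V.act (h.unop * g.unop) v = V.act g.unop (V.act h.unop v)
    rw [V.act_mul]; rfl
  smul_zero h := map_zero (V.act h.unop)
  smul_add h v w := map_add (V.act h.unop) v w
  add_smul g h v := by
    change V.act (g.unop + h.unop) v = V.act g.unop v + V.act h.unop v
    rw [map_add]; rfl
  zero_smul v := by change V.act 0 v = 0; rw [map_zero]; rfl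

/-- The corresponding object of the category `Mod-H`. -/
def toModuleCat (V : HopfRightModule k H) : ModuleCat.{u} Hᵐᵒᵖ :=
  ModuleCat.of Hᵐᵒᵖ V.carrier

/-- A left `H`-module `X` seen as a right module by `x ◁ h = S(h) • x`. -/
def ofLeft (X : ModuleCat.{u} H) : HopfRightModule k H where
  carrier := X
  module := ModuleCat.moduleOfAlgebraModule X
  act := (Algebra.lsmul k k X).toLinearMap ∘ₗ HopfAlgebra.antipode k
  act_one := by simp
  act_mul g h := by simp [HopfAlgebra.antipode_mul_antidistrib]

variable (k H) in
/-- The trivial module `k`, with `h` acting by `ε(h)`. -/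
def trivial : HopfRightModule k H where
  carrier := k
  act := (Algebra.lsmul k k k).toLinearMap ∘ₗ Coalgebra.counit
  act_one := by simp
  act_mul g h := by
    ext
    simp [mul_comm]

/-- The tensor product, with `(v ⊗ w) ◁ h = (v ◁ h₁) ⊗ (w ◁ h₂)`. -/
def tensor (V W : HopfRightModule k H) : HopfRightModule k H where
  carrier := V.carrier ⊗[k] W.carrier
  act := TensorProduct.map₂ V.act W.act ∘ₗ Coalgebra.comul
  act_one := by
    simp [Algebra.TensorProduct.one_def, V.act_one, W.act_one, Module.End.one_eq_id]
  act_mul g h := by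
    have key : ∀ x y : H ⊗[k] H, TensorProduct.map₂ V.act W.act (x * y) =
        TensorProduct.map₂ V.act W.act y * TensorProduct.map₂ V.act W.act x := by
      intro x y
      induction x using TensorProduct.induction_on with
      | zero => simp
      | add x₁ x₂ h₁ h₂ => rw [add_mul, map_add, map_add, mul_add, h₁, h₂]
      | tmul a b =>
        induction y using TensorProduct.induction_on with
        | zero => simp
        | add y₁ y₂ h₁ h₂ => rw [mul_add, map_add, map_add, add_mul, h₁, h₂]
        | tmul c d =>
          simp only [Algebra.TensorProduct.tmul_mul_tmul, TensorProduct.map₂_apply_tmul,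
            V.act_mul, W.act_mul]
          exact TensorProduct.map_mul _ _ _ _
    simp [key]

/-- The braiding of `Mod-H`: `v ⊗ w ↦ (w ◁ R₁) ⊗ (v ◁ R₂)`. -/
def braiding (Q : QuasitriangularStructure k H) (V W : HopfRightModule k H) :
    V.carrier ⊗[k] W.carrier →ₗ[k] W.carrier ⊗[k] V.carrier :=
  TensorProduct.map₂ W.act V.act Q.R ∘ₗ (TensorProduct.comm k V.carrier W.carrier).toLinearMap

/-- The map `id ⊗ c ⊗ id : (A ⊗ B) ⊗ (M ⊗ N) → (A ⊗ M) ⊗ (B ⊗ N)`, where `c` is the braiding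
of `B` and `M`. -/
def braidMiddle (Q : QuasitriangularStructure k H) (A B M N : HopfRightModule k H) :
    (A.carrier ⊗[k] B.carrier) ⊗[k] (M.carrier ⊗[k] N.carrier) →ₗ[k]
      (A.carrier ⊗[k] M.carrier) ⊗[k] (B.carrier ⊗[k] N.carrier) :=
  (TensorProduct.assoc k A.carrier M.carrier (B.carrier ⊗[k] N.carrier)).symm.toLinearMap ∘ₗ
    ((TensorProduct.assoc k M.carrier B.carrier N.carrier).toLinearMap ∘ₗ
      (braiding Q B M).rTensor N.carrier ∘ₗ
      (TensorProduct.assoc k B.carrier M.carrier N.carrier).symm.toLinearMap).lTensor A.carrier ∘ₗ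
    (TensorProduct.assoc k A.carrier B.carrier (M.carrier ⊗[k] N.carrier)).toLinearMap

end HopfRightModule

/-! ### Module-algebras and equivariant modules

The structures `PreModuleAlgebra` and `PreEquivariantModule` only contain the operations; the
axioms are the predicates `IsModuleAlgebra` and `IsEquivariantModule`. -/

/-- A right `H`-module with a product `A ⊗ A → A` and a distinguished element. -/
structure PreModuleAlgebra (k H : Type u) [Field k] [Ring H] [HopfAlgebra k H] extends
    HopfRightModule k H where
  one : carrier
  mul : carrier ⊗[k] carrier →ₗ[k] carrier

/-- A right `H`-module `M` with a linear map `A ⊗ M → M`, `a ⊗ v ↦ a · v`. -/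
structure PreEquivariantModule {k H : Type u} [Field k] [Ring H] [HopfAlgebra k H]
    (A : PreModuleAlgebra k H) extends HopfRightModule k H where
  lact : A.carrier ⊗[k] carrier →ₗ[k] carrier

section Equivariant

variable {k H : Type u} [Field k] [Ring H] [HopfAlgebra k H]

/-- `A` is a right `H`-module-algebra: it is associative and unital,
`(x y) ◁ h = (x ◁ h₁) (y ◁ h₂)` and `1 ◁ h = ε(h) 1`. -/
structure PreModuleAlgebra.IsModuleAlgebra (A : PreModuleAlgebra k H) : Prop where
  mul_assoc : ∀ x y z : A.carrier,
    A.mul (A.mul (x ⊗ₜ[k] y) ⊗ₜ[k] z) = A.mul (x ⊗ₜ[k] A.mul (y ⊗ₜ[k] z))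
  one_mul : ∀ x : A.carrier, A.mul (A.one ⊗ₜ[k] x) = x
  mul_one : ∀ x : A.carrier, A.mul (x ⊗ₜ[k] A.one) = x
  mul_act : ∀ (h : H) (x y : A.carrier),
    A.act h (A.mul (x ⊗ₜ[k] y)) =
      A.mul ((A.toHopfRightModule.tensor A.toHopfRightModule).act h (x ⊗ₜ[k] y))
  one_act : ∀ h : H, A.act h A.one = Coalgebra.counit (R := k) h • A.one

/-- `M` is an `H`-equivariant `A`-module: it is a left `A`-module and
`(a · v) ◁ h = (a ◁ h₁) · (v ◁ h₂)`. -/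
structure PreEquivariantModule.IsEquivariantModule {A : PreModuleAlgebra k H}
    (M : PreEquivariantModule A) : Prop where
  one_lact : ∀ v : M.carrier, M.lact (A.one ⊗ₜ[k] v) = v
  mul_lact : ∀ (a b : A.carrier) (v : M.carrier),
    M.lact (A.mul (a ⊗ₜ[k] b) ⊗ₜ[k] v) = M.lact (a ⊗ₜ[k] M.lact (b ⊗ₜ[k] v))
  lact_act : ∀ (h : H) (a : A.carrier) (v : M.carrier),
    M.act h (M.lact (a ⊗ₜ[k] v)) =
      M.lact ((A.toHopfRightModule.tensor M.toHopfRightModule).act h (a ⊗ₜ[k] v))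

namespace PreModuleAlgebra

variable {A : PreModuleAlgebra k H}

/-- The underlying `k`-algebra of an `H`-module-algebra. -/
def IsModuleAlgebra.Alg (_hA : A.IsModuleAlgebra) : Type u := A.carrier

instance (hA : A.IsModuleAlgebra) : AddCommGroup hA.Alg := A.addCommGroup

instance (hA : A.IsModuleAlgebra) : Module k hA.Alg := A.module

instance (hA : A.IsModuleAlgebra) : Ring hA.Alg :=
  { (inferInstance : AddCommGroup hA.Alg) with
    mul := fun x y => TensorProduct.curry A.mul x y
    one := A.one
    mul_assoc := hA.mul_assoc
    one_mul := hA.one_mul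
    mul_one := hA.mul_one
    left_distrib := fun x => map_add (TensorProduct.curry A.mul x)
    right_distrib := LinearMap.map_add₂ (TensorProduct.curry A.mul)
    zero_mul := LinearMap.map_zero₂ (TensorProduct.curry A.mul)
    mul_zero := fun x => map_zero (TensorProduct.curry A.mul x) }

instance (hA : A.IsModuleAlgebra) : Algebra k hA.Alg :=
  Algebra.ofModule (LinearMap.map_smul₂ (TensorProduct.curry A.mul))
    (fun c x => map_smul (TensorProduct.curry A.mul x) c)

/-- The condition `x ◁ h = ε(h) x` for all `h`. -/
def IsInvariant (A : PreModuleAlgebra k H) (x : A.carrier) : Prop :=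
  ∀ h : H, A.act h x = Coalgebra.counit (R := k) h • x

lemma IsInvariant.map₂_tmul {x : A.carrier} (hx : A.IsInvariant x) {W : Type u} [AddCommGroup W]
    [Module k W] (f : H →ₗ[k] Module.End k W) (w : W) (h : H) :
    TensorProduct.map₂ A.act f (Coalgebra.comul h) (x ⊗ₜ[k] w) = x ⊗ₜ[k] f h w := by
  have key : ∀ t : H ⊗[k] H, TensorProduct.map₂ A.act f t (x ⊗ₜ[k] w) =
      x ⊗ₜ[k] f (TensorProduct.lid k H ((Coalgebra.counit (R := k)).rTensor H t)) w := by
    intro t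
    induction t using TensorProduct.induction_on with
    | zero => simp
    | add t₁ t₂ h₁ h₂ => simp only [map_add, LinearMap.add_apply, h₁, h₂, TensorProduct.tmul_add]
    | tmul a b =>
      simp [hx a, TensorProduct.smul_tmul]
  rw [key, Coalgebra.rTensor_counit_comul]
  simp

lemma IsModuleAlgebra.isInvariant_mul (hA : A.IsModuleAlgebra) {x y : A.carrier}
    (hx : A.IsInvariant x) (hy : A.IsInvariant y) : A.IsInvariant (A.mul (x ⊗ₜ[k] y)) := by
  intro h
  have e : (A.toHopfRightModule.tensor A.toHopfRightModule).act h (x ⊗ₜ[k] y) =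
      x ⊗ₜ[k] A.act h y := IsInvariant.map₂_tmul hx A.act y h
  rw [hA.mul_act h x y, e, hy h, TensorProduct.tmul_smul, map_smul]

lemma IsInvariant.add {x y : A.carrier} (hx : A.IsInvariant x) (hy : A.IsInvariant y) :
    A.IsInvariant (x + y) := by
  intro h
  rw [map_add, hx h, hy h, smul_add]

lemma IsModuleAlgebra.isInvariant_smul_one (hA : A.IsModuleAlgebra) (c : k) :
    A.IsInvariant (c • A.one) := by
  intro h
  rw [map_smul, hA.one_act, smul_comm]

/-- The subalgebra of invariant elements of an `H`-module-algebra. -/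
def IsModuleAlgebra.invariants (hA : A.IsModuleAlgebra) : Subalgebra k hA.Alg where
  carrier := {x | A.IsInvariant x}
  mul_mem' hx hy := hA.isInvariant_mul hx hy
  add_mem' hx hy := IsInvariant.add hx hy
  algebraMap_mem' c := by
    rw [Algebra.algebraMap_eq_smul_one]
    exact hA.isInvariant_smul_one c

end PreModuleAlgebra

namespace PreEquivariantModule

variable {A : PreModuleAlgebra k H} {M : PreEquivariantModule A}

lemma IsEquivariantModule.lact_act_of_isInvariant (hM : M.IsEquivariantModule) {a : A.carrier}
    (ha : A.IsInvariant a) (h : H) (v : M.carrier) :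
    M.lact (a ⊗ₜ[k] M.act h v) = M.act h (M.lact (a ⊗ₜ[k] v)) := by
  have e : (A.toHopfRightModule.tensor M.toHopfRightModule).act h (a ⊗ₜ[k] v) =
      a ⊗ₜ[k] M.act h v := PreModuleAlgebra.IsInvariant.map₂_tmul ha M.act v h
  rw [hM.lact_act, e]

/-- The action `v ↦ a · v` of an invariant element `a` of `A` on an `H`-equivariant `A`-module, as
an endomorphism in `Mod-H`. -/
def IsEquivariantModule.lactHom (hM : M.IsEquivariantModule) {hA : A.IsModuleAlgebra}
    (a : hA.invariants) : M.toModuleCat ⟶ M.toModuleCat :=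
  ModuleCat.ofHom
    { toFun := fun v : M.carrier => TensorProduct.curry M.lact a.1 v
      map_add' := map_add (TensorProduct.curry M.lact a.1)
      map_smul' := fun h v => hM.lact_act_of_isInvariant a.2 h.unop v }

end PreEquivariantModule

/-! ### Braided tensor products -/

variable (k H) in
/-- The trivial module-algebra `k`. -/
def PreModuleAlgebra.trivial : PreModuleAlgebra k H where
  toHopfRightModule := HopfRightModule.trivial k H
  one := (1 : k)
  mul := LinearMap.mul' k k

variable (k H) in
/-- The module `k` over the trivial module-algebra `k`. -/
def PreEquivariantModule.trivial : PreEquivariantModule (PreModuleAlgebra.trivial k H) where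
  toHopfRightModule := HopfRightModule.trivial k H
  lact := LinearMap.mul' k k

/-- The braided tensor product of algebras:
`(a ⊗ b) (a' ⊗ b') = a (a' ◁ R₁) ⊗ (b ◁ R₂) b'`. -/
def PreModuleAlgebra.braidedTensor (Q : QuasitriangularStructure k H)
    (A B : PreModuleAlgebra k H) : PreModuleAlgebra k H where
  toHopfRightModule := A.toHopfRightModule.tensor B.toHopfRightModule
  one := A.one ⊗ₜ[k] B.one
  mul := TensorProduct.map A.mul B.mul ∘ₗ
    HopfRightModule.braidMiddle Q A.toHopfRightModule B.toHopfRightModule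
      A.toHopfRightModule B.toHopfRightModule

/-- The braided external product of modules:
`(a ⊗ b) · (v ⊗ w) = a · (v ◁ R₁) ⊗ (b ◁ R₂) · w`. -/
def PreEquivariantModule.braidedExternal (Q : QuasitriangularStructure k H)
    {A B : PreModuleAlgebra k H} (M : PreEquivariantModule A) (N : PreEquivariantModule B) :
    PreEquivariantModule (A.braidedTensor Q B) where
  toHopfRightModule := M.toHopfRightModule.tensor N.toHopfRightModule
  lact := TensorProduct.map M.lact N.lact ∘ₗ
    HopfRightModule.braidMiddle Q A.toHopfRightModule B.toHopfRightModule
      M.toHopfRightModule N.toHopfRightModule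

end Equivariant

/-! ### The restricted dual -/

section RestrictedDual

variable (k H : Type u) [Field k] [Ring H] [HopfAlgebra k H]

/-- A linear form on `H` is a matrix coefficient if it is `h ↦ σ(h · x)` for a finite-dimensional
left `H`-module `V`, `x ∈ V` and `σ ∈ V*`. -/
def IsMatrixCoefficient (φ : Module.Dual k H) : Prop :=
  ∃ (V : Type u) (_ : AddCommGroup V) (_ : Module k V) (_ : FiniteDimensional k V)
    (ρ : H →ₐ[k] Module.End k V) (σ : Module.Dual k V) (x : V), ∀ h : H, φ h = σ (ρ h x)

/-- The restricted dual `H°`: the span of the matrix coefficients. -/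
def restrictedDual : Submodule k (Module.Dual k H) :=
  Submodule.span k {φ | IsMatrixCoefficient k H φ}

namespace restrictedDual

variable {k H}

/-- The functional `φ ⋆ ψ : h ↦ φ(h₁) ψ(h₂)`. -/
def starDual : Module.Dual k H →ₗ[k] Module.Dual k H →ₗ[k] Module.Dual k H :=
  LinearMap.mk₂ k
    (fun φ ψ => LinearMap.mul' k k ∘ₗ TensorProduct.map φ ψ ∘ₗ Coalgebra.comul)
    (fun φ₁ φ₂ ψ => by rw [TensorProduct.map_add_left, LinearMap.add_comp, LinearMap.comp_add])
    (fun c φ ψ => by rw [TensorProduct.map_smul_left, LinearMap.smul_comp, LinearMap.comp_smul])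
    (fun φ ψ₁ ψ₂ => by rw [TensorProduct.map_add_right, LinearMap.add_comp, LinearMap.comp_add])
    (fun c φ ψ => by rw [TensorProduct.map_smul_right, LinearMap.smul_comp, LinearMap.comp_smul])

lemma starDual_mem {φ ψ : Module.Dual k H} (hφ : φ ∈ restrictedDual k H)
    (hψ : ψ ∈ restrictedDual k H) : starDual φ ψ ∈ restrictedDual k H := by
  have h := Submodule.apply_mem_map₂ starDual hφ hψ
  rw [restrictedDual, Submodule.map₂_span_span] at h
  refine Submodule.span_mono ?_ h
  rintro _ ⟨φ, ⟨V, _, _, _, ρ, σ, x, hφ⟩, ψ, ⟨W, _, _, _, τ, θ, y, hψ⟩, rfl⟩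
  refine ⟨V ⊗[k] W, inferInstance, inferInstance, inferInstance,
    (Module.endTensorEndAlgHom (R := k) (S := k) (A := k) (M := V) (N := W)).comp
      ((Algebra.TensorProduct.map ρ τ).comp (Bialgebra.comulAlgHom k H)),
    LinearMap.mul' k k ∘ₗ TensorProduct.map σ θ, x ⊗ₜ[k] y, fun h => ?_⟩
  change LinearMap.mul' k k (TensorProduct.map φ ψ (Coalgebra.comul h)) =
    LinearMap.mul' k k (TensorProduct.map σ θ (Module.endTensorEndAlgHom (R := k) (S := k) (A := k)
      (Algebra.TensorProduct.map ρ τ (Coalgebra.comul h)) (x ⊗ₜ[k] y)))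
  generalize (Coalgebra.comul h : H ⊗[k] H) = t
  induction t using TensorProduct.induction_on with
  | zero => simp
  | add t₁ t₂ h₁ h₂ => simp only [map_add, LinearMap.add_apply, h₁, h₂]
  | tmul a b => simp [hφ, hψ, Module.endTensorEndAlgHom_apply]

lemma comp_mulRight_mem (h : H) {φ : Module.Dual k H} (hφ : φ ∈ restrictedDual k H) :
    φ ∘ₗ LinearMap.mulRight k h ∈ restrictedDual k H := by
  have := Submodule.mem_map_of_mem (f := LinearMap.lcomp k k (LinearMap.mulRight k h)) hφ
  rw [restrictedDual, Submodule.map_span] at this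
  refine Submodule.span_mono ?_ this
  rintro _ ⟨φ, ⟨V, _, _, _, ρ, σ, x, hφ⟩, rfl⟩
  exact ⟨V, inferInstance, inferInstance, inferInstance, ρ, σ, ρ h x, fun g => by simp [hφ]⟩

lemma comp_mulLeft_mem (h : H) {φ : Module.Dual k H} (hφ : φ ∈ restrictedDual k H) :
    φ ∘ₗ LinearMap.mulLeft k h ∈ restrictedDual k H := by
  have := Submodule.mem_map_of_mem (f := LinearMap.lcomp k k (LinearMap.mulLeft k h)) hφ
  rw [restrictedDual, Submodule.map_span] at this
  refine Submodule.span_mono ?_ this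
  rintro _ ⟨φ, ⟨V, _, _, _, ρ, σ, x, hφ⟩, rfl⟩
  exact ⟨V, inferInstance, inferInstance, inferInstance, ρ, σ ∘ₗ ρ h, x, fun g => by simp [hφ]⟩

lemma counit_mem : (Coalgebra.counit : Module.Dual k H) ∈ restrictedDual k H :=
  Submodule.subset_span ⟨k, inferInstance, inferInstance, inferInstance,
    (Algebra.lmul k k).comp (Bialgebra.counitAlgHom k H), LinearMap.id, 1, fun h => by simp⟩

variable (k H)

/-- The usual product `⋆` of `H°`, as a linear map `H° ⊗ H° → H°`. -/
def star : restrictedDual k H ⊗[k] restrictedDual k H →ₗ[k] restrictedDual k H :=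
  TensorProduct.lift <| LinearMap.mk₂ k
    (fun φ ψ => ⟨starDual φ.1 ψ.1, starDual_mem φ.2 ψ.2⟩)
    (fun φ₁ φ₂ ψ => Subtype.ext (by simp))
    (fun c φ ψ => Subtype.ext (by simp))
    (fun φ ψ₁ ψ₂ => Subtype.ext (by simp))
    (fun c φ ψ => Subtype.ext (by simp))

/-- The left coregular action: `(h ▷ φ)(x) = φ(x h)`. -/
def coregLeft : H →ₗ[k] Module.End k (restrictedDual k H) :=
  LinearMap.mk₂ k
    (fun h φ => ⟨φ.1 ∘ₗ LinearMap.mulRight k h, comp_mulRight_mem h φ.2⟩)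
    (fun g h φ => Subtype.ext (by ext; simp [mul_add]))
    (fun c h φ => Subtype.ext (by ext; simp))
    (fun h φ ψ => Subtype.ext (by ext; simp))
    (fun c h φ => Subtype.ext (by ext; simp))

/-- The right coregular action: `(φ ◁ h)(x) = φ(h x)`. -/
def coregRight : H →ₗ[k] Module.End k (restrictedDual k H) :=
  LinearMap.mk₂ k
    (fun h φ => ⟨φ.1 ∘ₗ LinearMap.mulLeft k h, comp_mulLeft_mem h φ.2⟩)
    (fun g h φ => Subtype.ext (by ext; simp [add_mul]))
    (fun c h φ => Subtype.ext (by ext; simp))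
    (fun h φ ψ => Subtype.ext (by ext; simp))
    (fun c h φ => Subtype.ext (by ext; simp))

/-- The linear map `x ⊗ y ↦ (φ ↦ S(y) ▷ φ ◁ x)`. -/
def coadAux : H ⊗[k] H →ₗ[k] Module.End k (restrictedDual k H) :=
  TensorProduct.lift <|
    (LinearMap.mul k (Module.End k (restrictedDual k H))).flip.compl₁₂ (coregRight k H)
      (coregLeft k H ∘ₗ HopfAlgebra.antipode k)

lemma coadAux_tmul_apply (x y z : H) (φ : restrictedDual k H) :
    (coadAux k H (x ⊗ₜ[k] y) φ).1 z = φ.1 (x * (z * HopfAlgebra.antipode k y)) := rfl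

/-- The restricted dual with the right coadjoint action `φ ◁ h = φ(h₁ ? S(h₂))`. -/
def coadjoint : HopfRightModule k H where
  carrier := restrictedDual k H
  act := coadAux k H ∘ₗ Coalgebra.comul
  act_one := by
    ext φ z
    simp [Algebra.TensorProduct.one_def, coadAux_tmul_apply]
  act_mul g h := by
    have key : ∀ x y : H ⊗[k] H, coadAux k H (x * y) = coadAux k H y * coadAux k H x := by
      intro x y
      induction x using TensorProduct.induction_on with
      | zero => simp
      | add x₁ x₂ h₁ h₂ => rw [add_mul, map_add, map_add, mul_add, h₁, h₂]
      | tmul a b =>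
        induction y using TensorProduct.induction_on with
        | zero => simp
        | add y₁ y₂ h₁ h₂ => rw [mul_add, map_add, map_add, add_mul, h₁, h₂]
        | tmul c d =>
          ext φ z
          simp [coadAux_tmul_apply, HopfAlgebra.antipode_mul_antidistrib, mul_assoc]
    simp [key]

end restrictedDual

end RestrictedDual

/-! ### The algebras `𝓛_{g,n}(H)` and their modules -/

namespace QuasitriangularStructure

open restrictedDual

variable {k H : Type u} [Field k] [Ring H] [HopfAlgebra k H] (Q : QuasitriangularStructure k H)

/-- `𝓛_{0,1}(H)`: the space `H°` with the right coadjoint action, the unit `ε` and the product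
`φ ψ = (R²₂ S(R¹₂) ▷ φ) ⋆ (R²₁ ▷ ψ ◁ R¹₁)`, where `R¹`, `R²` are two copies of `R`. -/
def L01 : PreModuleAlgebra k H where
  toHopfRightModule := coadjoint k H
  one := (⟨Coalgebra.counit, counit_mem⟩ : restrictedDual k H)
  mul := star k H ∘ₗ
    TensorProduct.map₂ (coregLeft k H) (coregLeft k H) Q.flip ∘ₗ
    TensorProduct.map₂ (coregLeft k H ∘ₗ HopfAlgebra.antipode k) (coregRight k H) Q.flip

/-- The linear map `β ⊗ α ↦ (R⁴₂ R³₁ ▷ β ◁ R¹₁ R²₁) ⊗ (R³₂ S(R¹₂) ▷ α ◁ R²₂ R⁴₁)`, where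
`R¹, …, R⁴` are four copies of `R`; the four factors are applied in the order `R¹, R², R³, R⁴`. -/
def exchange : restrictedDual k H ⊗[k] restrictedDual k H →ₗ[k]
    restrictedDual k H ⊗[k] restrictedDual k H :=
  TensorProduct.map₂ (coregLeft k H) (coregRight k H) Q.flip ∘ₗ
    TensorProduct.map₂ (coregLeft k H) (coregLeft k H) Q.R ∘ₗ
    TensorProduct.map₂ (coregRight k H) (coregRight k H) Q.R ∘ₗ
    TensorProduct.map₂ (coregRight k H) (coregLeft k H ∘ₗ HopfAlgebra.antipode k) Q.R

/-- `𝓛_{1,0}(H)`: the space `H° ⊗ H°` with the diagonal coadjoint action. With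
`i_b(β) = β ⊗ ε` and `i_a(α) = ε ⊗ α`, the product is determined by the facts that `i_b`, `i_a` are
morphisms from `𝓛_{0,1}(H)`, that `i_b(β) i_a(α) = β ⊗ α`, and that `i_a(α) i_b(β)` is
`exchange (β ⊗ α)`. Explicitly, `(β ⊗ α) (β' ⊗ α') = ∑ β β'' ⊗ α'' α'` with
`exchange (β' ⊗ α) = ∑ β'' ⊗ α''`. -/
def L10 : PreModuleAlgebra k H where
  toHopfRightModule := (coadjoint k H).tensor (coadjoint k H)
  one := Q.L01.one ⊗ₜ[k] Q.L01.one
  mul :=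
    TensorProduct.map Q.L01.mul Q.L01.mul ∘ₗ
      (TensorProduct.assoc k (restrictedDual k H) (restrictedDual k H)
        (restrictedDual k H ⊗[k] restrictedDual k H)).symm.toLinearMap ∘ₗ
      ((TensorProduct.assoc k (restrictedDual k H) (restrictedDual k H)
          (restrictedDual k H)).toLinearMap ∘ₗ
        (Q.exchange ∘ₗ (TensorProduct.comm k (restrictedDual k H)
          (restrictedDual k H)).toLinearMap).rTensor (restrictedDual k H) ∘ₗ
        (TensorProduct.assoc k (restrictedDual k H) (restrictedDual k H)
          (restrictedDual k H)).symm.toLinearMap).lTensor (restrictedDual k H) ∘ₗ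
      (TensorProduct.assoc k (restrictedDual k H) (restrictedDual k H)
        (restrictedDual k H ⊗[k] restrictedDual k H)).toLinearMap

/-- The linear map `H° → H`, `φ ↦ (φ ⊗ id)(R R')` where `R'` is the flip of `R`. -/
def Phi : restrictedDual k H →ₗ[k] H :=
  LinearMap.mk₂ k
    (fun (φ : restrictedDual k H) (t : H ⊗[k] H) => TensorProduct.lid k H (φ.1.rTensor H t))
    (fun φ ψ t => by simp [LinearMap.rTensor_add])
    (fun c φ t => by simp [LinearMap.rTensor_smul])
    (fun φ s t => by simp)
    (fun c φ t => by simp)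
  |>.flip (Q.R * Q.flip)

/-- The `𝓛_{0,1}(H)`-module on a left `H`-module `X`: `φ · x = Φ(φ) • x` and
`x ◁ h = S(h) • x`. -/
def moduleL01 (X : ModuleCat.{u} H) : PreEquivariantModule Q.L01 where
  toHopfRightModule := HopfRightModule.ofLeft X
  lact := TensorProduct.lift ((Algebra.lsmul k k X).toLinearMap ∘ₗ Q.Phi)

/-- The linear map `α ⊗ ψ ↦ i_a(α) · ψ = Φ(α ◁ R₂) ▷ ψ ◁ R₁` on `H° ⊗ H°`, where `α ◁ R₂` is the
coadjoint action. -/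
def lactA : restrictedDual k H ⊗[k] restrictedDual k H →ₗ[k] restrictedDual k H :=
  TensorProduct.lift (coregLeft k H ∘ₗ Q.Phi) ∘ₗ
    TensorProduct.map₂ (coadjoint k H).act (coregRight k H) Q.flip

/-- The `𝓛_{1,0}(H)`-module on `H°`, with the right coadjoint action and
`(β ⊗ α) · ψ = i_b(β) · (i_a(α) · ψ)`, where `i_b(β) · ψ = β ψ` is the product of `𝓛_{0,1}(H)` and
`i_a(α) · ψ = Φ(α ◁ R₂) ▷ ψ ◁ R₁`. -/
def moduleL10 : PreEquivariantModule Q.L10 where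
  toHopfRightModule := coadjoint k H
  lact := Q.L01.mul ∘ₗ Q.lactA.lTensor (restrictedDual k H) ∘ₗ
    (TensorProduct.assoc k (restrictedDual k H) (restrictedDual k H)
      (restrictedDual k H)).toLinearMap

/-- `𝓛_{0,n}(H)`: the braided tensor product of `n` copies of `𝓛_{0,1}(H)` (and of the unit object
`k`, which closes the iteration). -/
def L0 : ℕ → PreModuleAlgebra k H
  | 0 => PreModuleAlgebra.trivial k H
  | n + 1 => Q.L01.braidedTensor Q (L0 n)

/-- `𝓛_{g,n}(H)`: the braided tensor product of `g` copies of `𝓛_{1,0}(H)` followed by `n` copies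
of `𝓛_{0,1}(H)`. -/
def L : (g n : ℕ) → PreModuleAlgebra k H
  | 0, n => Q.L0 n
  | g + 1, n => Q.L10.braidedTensor Q (L g n)

/-- The `𝓛_{0,n}(H)`-module `X₁ ⊗ … ⊗ Xₙ`. -/
def stateModule0 : (n : ℕ) → (Fin n → ModuleCat.{u} H) → PreEquivariantModule (Q.L0 n)
  | 0, _ => PreEquivariantModule.trivial k H
  | n + 1, X => (Q.moduleL01 (X 0)).braidedExternal Q (stateModule0 n (Fin.tail X))

/-- The `𝓛_{g,n}(H)`-module `(H°)^{⊗ g} ⊗ X₁ ⊗ … ⊗ Xₙ`, the braided external product of `g` copies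
of the `𝓛_{1,0}(H)`-module `H°` and of the `𝓛_{0,1}(H)`-modules `X₁, …, Xₙ`. -/
def stateModule : (g n : ℕ) → (Fin n → ModuleCat.{u} H) → PreEquivariantModule (Q.L g n)
  | 0, n, X => Q.stateModule0 n X
  | g + 1, n, X => Q.moduleL10.braidedExternal Q (stateModule g n X)

end QuasitriangularStructure

end

noncomputable section

/-! The whole construction reduces to the calculus of R-matrices. A right action of `H` is a strand,
that is, a unital anti-homomorphism from `H` to operators; for commuting strands `s`, `t` the
operator `br Q s t` is s(R₁) t(R₂). The axioms on R become relations between such operators: they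
exchange the two orders of a convolution (`cv_mul_br`), they are multiplicative in each strand
(`br_cv_left`, `br_cv_right`), they are 1 against the trivial strand, and they satisfy the
Yang–Baxter equation (`yangBaxter`).

The space H° carries two commuting strands: r, the right coregular action, and l, the left coregular
action composed with S. Their convolution is the coadjoint action. The product of 𝓛₀,₁ is ⋆ preceded
by the operator `fus`, the exchange rule of 𝓛₁,₀ is the operator `exch`, and the action through Φ is
the operator `chord` followed by evaluation at 1. The left actions in the definitions turn into
strands by (S ⊗ S)(R) = R and (id ⊗ S)(R⁻¹) = R. As ⋆ converts the strands of a product into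
convolutions, associativity, compatibility of the exchange with products, and the module axiom
become the word identities `fus_assoc`, `exch_fus_left`, `exch_fus_right` and `chord_fus`, each a
few Yang–Baxter moves. Equivariance amounts to moving strands past one another.

𝓛₁,₀ and the braided tensor products are instances of one construction, a tensor product in which
the second algebra moves past the first by a map ψ. If ψ respects units, products and actions, the
twisted product acts on the twisted external product (`IsTwist.isAction`); associativity is the case
of the regular module. For the braiding these conditions are the hexagon relations together with
equivariance (`isTwist_braiding`); for the exchange map they are the word identities
(`isTwist_exchMap`). The 𝓛₁,₀-module H° is induced from the character φ ↦ φ(1) of the second copy of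
𝓛₀,₁ (`twist_evL`), so it falls under the same statement.

An invariant a satisfies a · (v ◁ h) = (a · v) ◁ h, so it acts on M by an endomorphism in Mod-H, and
functoriality of Ext in its second argument gives the representation. On cocycles it is
postcomposition, and uniqueness holds because every class comes from a cocycle on a projective
resolution. -/

namespace HopfStrand

/-! ### Convolution of linear maps on `H` and commuting anti-homomorphisms. -/

section Sweedler

variable {k H E : Type*} [Field k] [Ring H] [HopfAlgebra k H] [Ring E] [Algebra k E]

/-- The linear map `a ⊗ b ↦ s(a) t(b)`. -/
def sw (s t : H →ₗ[k] E) : H ⊗[k] H →ₗ[k] E :=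
  TensorProduct.lift ((LinearMap.mul k E).compl₁₂ s t)

@[simp] lemma sw_tmul (s t : H →ₗ[k] E) (a b : H) : sw s t (a ⊗ₜ[k] b) = s a * t b := rfl

/-- The linear map `a ⊗ (b ⊗ c) ↦ s(a) t(b) u(c)`. -/
def sw₃ (s t u : H →ₗ[k] E) : H ⊗[k] (H ⊗[k] H) →ₗ[k] E :=
  TensorProduct.lift ((LinearMap.mul k E).compl₁₂ s (sw t u))

@[simp] lemma sw₃_tmul (s t u : H →ₗ[k] E) (a : H) (x : H ⊗[k] H) :
    sw₃ s t u (a ⊗ₜ[k] x) = s a * sw t u x := rfl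

/-- The convolution product `h ↦ s(h₁) t(h₂)`. -/
def cv (s t : H →ₗ[k] E) : H →ₗ[k] E := sw s t ∘ₗ Coalgebra.comul

lemma cv_apply (s t : H →ₗ[k] E) (h : H) : cv s t h = sw s t (Coalgebra.comul h) := rfl

/-- Convolving inside one leg amounts to applying Δ to that leg. Identities for Δ in `H ⊗ (H ⊗ H)`,
namely coassociativity and the two formulas for Δ on a leg of R, thereby become identities between
operators. -/
lemma sw_cv_left (s t u : H →ₗ[k] E) (x : H ⊗[k] H) : sw (cv s t) u x = sw₃ s t u
    (TensorProduct.assoc k H H H ((Coalgebra.comul (R := k)).rTensor H x)) := by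
  induction x using TensorProduct.induction_on with
  | zero => simp
  | add x y hx hy => simp only [map_add, hx, hy]
  | tmul a b =>
    simp only [sw_tmul, cv_apply, LinearMap.rTensor_tmul]
    generalize (Coalgebra.comul a : H ⊗[k] H) = y
    induction y using TensorProduct.induction_on with
    | zero => simp
    | add x y hx hy => simp only [map_add, hx, hy, add_mul, add_tmul]
    | tmul a b => simp [mul_assoc]

lemma sw_cv_right (s t u : H →ₗ[k] E) (x : H ⊗[k] H) : sw s (cv t u) x = sw₃ s t u
    ((Coalgebra.comul (R := k)).lTensor H x) := by
  induction x using TensorProduct.induction_on with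
  | zero => simp
  | add x y hx hy => simp only [map_add, hx, hy]
  | tmul a b => simp [cv_apply]

lemma cv_assoc (s t u : H →ₗ[k] E) : cv (cv s t) u = cv s (cv t u) := by
  ext h
  rw [cv_apply, cv_apply, sw_cv_left, sw_cv_right, Coalgebra.coassoc_apply]

/-- Elements of the images of `s` and `t` commute. -/
def Comm (s t : H →ₗ[k] E) : Prop := ∀ g h, Commute (s g) (t h)

lemma Comm.symm {s t : H →ₗ[k] E} (h : Comm s t) : Comm t s := fun a b => (h b a).symm

lemma _root_.Commute.sw_right {x : E} {s t : H →ₗ[k] E} (hs : ∀ h, Commute x (s h))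
    (ht : ∀ h, Commute x (t h)) (y : H ⊗[k] H) : Commute x (sw s t y) := by
  induction y using TensorProduct.induction_on with
  | zero => simp
  | add y z hy hz => rw [map_add]; exact hy.add_right hz
  | tmul a b => exact (hs a).mul_right (ht b)

lemma Comm.cv_right {s t u : H →ₗ[k] E} (h₁ : Comm s t) (h₂ : Comm s u) : Comm s (cv t u) :=
  fun g h => Commute.sw_right (h₁ g) (h₂ g) (Coalgebra.comul h)

lemma Comm.cv_left {s t u : H →ₗ[k] E} (h₁ : Comm s u) (h₂ : Comm t u) : Comm (cv s t) u :=
  (Comm.cv_right h₁.symm h₂.symm).symm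

lemma sw_comm {s t : H →ₗ[k] E} (h : Comm s t) (x : H ⊗[k] H) :
    sw s t (TensorProduct.comm k H H x) = sw t s x := by
  induction x using TensorProduct.induction_on with
  | zero => simp
  | add x y hx hy => simp only [map_add, hx, hy]
  | tmul a b => exact (h b a).eq

/-- A unital anti-homomorphism from `H` to `E`. -/
structure IsStrand (s : H →ₗ[k] E) : Prop where
  map_one : s 1 = 1
  map_mul : ∀ g h, s (g * h) = s h * s g

lemma sw_one {s t : H →ₗ[k] E} (hs : s 1 = 1) (ht : t 1 = 1) : sw s t 1 = 1 := by
  simp [Algebra.TensorProduct.one_def, hs, ht]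

/-- Strands reverse products, so evaluation on `H ⊗ H` does too; every formula for R below therefore
appears in the opposite order. -/
lemma sw_mul {s t : H →ₗ[k] E} (hs : IsStrand s) (ht : IsStrand t) (hst : Comm s t)
    (x y : H ⊗[k] H) : sw s t (x * y) = sw s t y * sw s t x := by
  induction x using TensorProduct.induction_on with
  | zero => simp
  | add x₁ x₂ h₁ h₂ => rw [add_mul, map_add, map_add, mul_add, h₁, h₂]
  | tmul a b =>
    induction y using TensorProduct.induction_on with
    | zero => simp
    | add y₁ y₂ h₁ h₂ => rw [mul_add, map_add, map_add, add_mul, h₁, h₂]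
    | tmul c d =>
      simp only [Algebra.TensorProduct.tmul_mul_tmul, sw_tmul, hs.map_mul, ht.map_mul]
      exact (hst a d).mul_mul_mul_comm _ _

lemma IsStrand.cv {s t : H →ₗ[k] E} (hs : IsStrand s) (ht : IsStrand t) (hst : Comm s t) :
    IsStrand (cv s t) where
  map_one := by rw [cv_apply, Bialgebra.comul_one, sw_one hs.map_one ht.map_one]
  map_mul g h := by rw [cv_apply, Bialgebra.comul_mul, sw_mul hs ht hst, cv_apply, cv_apply]

/-- The trivial strand `h ↦ ε(h)`. -/
def triv : H →ₗ[k] E := Algebra.linearMap k E ∘ₗ Coalgebra.counit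

lemma triv_apply (h : H) : (triv : H →ₗ[k] E) h = algebraMap k E (Coalgebra.counit (R := k) h) := rfl

lemma comm_triv (s : H →ₗ[k] E) : Comm s triv :=
  fun g h => (Algebra.commutes (Coalgebra.counit (R := k) h) (s g)).symm

lemma triv_isStrand : IsStrand (triv : H →ₗ[k] E) where
  map_one := by simp [triv_apply]
  map_mul g h := by
    rw [triv_apply, triv_apply, triv_apply, Bialgebra.counit_mul, mul_comm, _root_.map_mul]

lemma sw_triv_left (s : H →ₗ[k] E) (x : H ⊗[k] H) :
    sw triv s x = s (TensorProduct.lid k H ((Coalgebra.counit (R := k)).rTensor H x)) := by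
  induction x using TensorProduct.induction_on with
  | zero => simp
  | add x y hx hy => simp only [map_add, hx, hy]
  | tmul a b => simp [triv_apply, ← Algebra.smul_def]

lemma sw_triv_right (s : H →ₗ[k] E) (x : H ⊗[k] H) :
    sw s triv x = s (TensorProduct.rid k H ((Coalgebra.counit (R := k)).lTensor H x)) := by
  induction x using TensorProduct.induction_on with
  | zero => simp
  | add x y hx hy => simp only [map_add, hx, hy]
  | tmul a b => simp [triv_apply, ← Algebra.smul_def, ← Algebra.commutes]

lemma cv_triv_left (s : H →ₗ[k] E) : cv triv s = s := by
  ext h; simp [cv_apply, sw_triv_left, Coalgebra.rTensor_counit_comul]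

lemma cv_triv_right (s : H →ₗ[k] E) : cv s triv = s := by
  ext h; simp [cv_apply, sw_triv_right, Coalgebra.lTensor_counit_comul]

end Sweedler

/-! ### Families of commuting strands -/

section Family

variable {k H E : Type*} [Field k] [Ring H] [HopfAlgebra k H] [Ring E] [Algebra k E]

/-- Pairwise commuting unital anti-homomorphisms from `H` to `E`. -/
structure StrandFamily {ι : Type*} (σ : ι → H →ₗ[k] E) : Prop where
  strand : ∀ i, IsStrand (σ i)
  comm : ∀ i j, i ≠ j → Comm (σ i) (σ j)

variable {V W : Type*} [AddCommGroup V] [Module k V] [AddCommGroup W] [Module k W]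

/-- A strand on the left factor of `V ⊗ W`. -/
def onLeft (W : Type*) [AddCommGroup W] [Module k W] (f : H →ₗ[k] Module.End k V) :
    H →ₗ[k] Module.End k (V ⊗[k] W) :=
  LinearMap.rTensorHom W ∘ₗ f

/-- A strand on the right factor of `V ⊗ W`. -/
def onRight (V : Type*) [AddCommGroup V] [Module k V] (f : H →ₗ[k] Module.End k W) :
    H →ₗ[k] Module.End k (V ⊗[k] W) :=
  LinearMap.lTensorHom V ∘ₗ f

@[simp] lemma onLeft_apply_tmul (f : H →ₗ[k] Module.End k V) (h : H) (v : V) (w : W) :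
    onLeft W f h (v ⊗ₜ[k] w) = f h v ⊗ₜ[k] w := rfl

@[simp] lemma onRight_apply_tmul (f : H →ₗ[k] Module.End k W) (h : H) (v : V) (w : W) :
    onRight V f h (v ⊗ₜ[k] w) = v ⊗ₜ[k] f h w := rfl

lemma IsStrand.onLeft {f : H →ₗ[k] Module.End k V} (hf : IsStrand f) :
    IsStrand (onLeft W f) where
  map_one := by ext; simp [hf.map_one]
  map_mul g h := by ext; simp [hf.map_mul]

lemma IsStrand.onRight {f : H →ₗ[k] Module.End k W} (hf : IsStrand f) :
    IsStrand (onRight V f) where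
  map_one := by ext; simp [hf.map_one]
  map_mul g h := by ext; simp [hf.map_mul]

lemma comm_onLeft_onRight (f : H →ₗ[k] Module.End k V) (g : H →ₗ[k] Module.End k W) :
    Comm (onLeft W f) (onRight V g) := fun a b => by
  change _ * _ = _ * _
  ext; simp

lemma Comm.onLeft {f g : H →ₗ[k] Module.End k V} (h : Comm f g) :
    Comm (onLeft W f) (onLeft W g) := fun a b => by
  change _ * _ = _ * _
  ext v w
  simpa using congrArg (· ⊗ₜ[k] w) (LinearMap.congr_fun (h a b).eq v)

lemma Comm.onRight {f g : H →ₗ[k] Module.End k W} (h : Comm f g) :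
    Comm (onRight V f) (onRight V g) := fun a b => by
  change _ * _ = _ * _
  ext v w
  simpa using congrArg (v ⊗ₜ[k] ·) (LinearMap.congr_fun (h a b).eq w)

/-- The strands of a tensor product. -/
def sumFamily {ι κ : Type*} (σ : ι → H →ₗ[k] Module.End k V) (τ : κ → H →ₗ[k] Module.End k W) :
    ι ⊕ κ → H →ₗ[k] Module.End k (V ⊗[k] W) :=
  Sum.elim (fun i => onLeft W (σ i)) (fun j => onRight V (τ j))

lemma StrandFamily.sum {ι κ : Type*} {σ : ι → H →ₗ[k] Module.End k V}
    {τ : κ → H →ₗ[k] Module.End k W} (hσ : StrandFamily σ) (hτ : StrandFamily τ) :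
    StrandFamily (sumFamily σ τ) where
  strand
    | .inl i => (hσ.strand i).onLeft
    | .inr j => (hτ.strand j).onRight
  comm
    | .inl i, .inl j, h => (hσ.comm i j (fun e => h (congrArg _ e))).onLeft
    | .inl _, .inr _, _ => comm_onLeft_onRight _ _
    | .inr _, .inl _, _ => (comm_onLeft_onRight _ _).symm
    | .inr i, .inr j, h => (hτ.comm i j (fun e => h (congrArg _ e))).onRight

lemma map₂_eq_sw (f : H →ₗ[k] Module.End k V) (g : H →ₗ[k] Module.End k W) (x : H ⊗[k] H) :
    TensorProduct.map₂ f g x = sw (onLeft W f) (onRight V g) x := by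
  induction x using TensorProduct.induction_on with
  | zero => simp
  | add x y hx hy => simp only [map_add, hx, hy]
  | tmul a b => ext; simp

/-- A linear map intertwining two pairs of strands intertwines the operators made from them. -/
lemma sw_intertwine (p : V →ₗ[k] W) {s t : H →ₗ[k] Module.End k V}
    {s' t' : H →ₗ[k] Module.End k W} (hs : ∀ h, p ∘ₗ s h = s' h ∘ₗ p)
    (ht : ∀ h, p ∘ₗ t h = t' h ∘ₗ p) (x : H ⊗[k] H) :
    p ∘ₗ sw s t x = sw s' t' x ∘ₗ p := by
  induction x using TensorProduct.induction_on with
  | zero => simp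
  | add x y hx hy => simp only [map_add, LinearMap.comp_add, LinearMap.add_comp, hx, hy]
  | tmul a b =>
    simp only [sw_tmul, Module.End.mul_eq_comp]
    rw [← LinearMap.comp_assoc, hs, LinearMap.comp_assoc, ht, LinearMap.comp_assoc]

lemma cv_intertwine (p : V →ₗ[k] W) {s t : H →ₗ[k] Module.End k V}
    {s' t' : H →ₗ[k] Module.End k W} (hs : ∀ h, p ∘ₗ s h = s' h ∘ₗ p)
    (ht : ∀ h, p ∘ₗ t h = t' h ∘ₗ p) (h : H) :
    p ∘ₗ cv s t h = cv s' t' h ∘ₗ p :=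
  sw_intertwine p hs ht _

end Family

/-! ### The operators of the R-matrix -/

section RMatrix

variable {k H : Type u} [Field k] [Ring H] [HopfAlgebra k H] (Q : QuasitriangularStructure k H)
variable {E : Type*} [Ring E] [Algebra k E]

/-- The inverse of the R-matrix. -/
def Rinv : H ⊗[k] H := ↑(Q.isUnit.unit⁻¹)

lemma R_mul_Rinv : Q.R * Rinv Q = 1 := Q.isUnit.mul_val_inv

lemma Rinv_mul_R : Rinv Q * Q.R = 1 := Q.isUnit.val_inv_mul

/-- The operator `s(R₁) t(R₂)`. -/
def br (s t : H →ₗ[k] E) : E := sw s t Q.R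

/-- The inverse of the operator `s(R₁) t(R₂)`. -/
def brInv (s t : H →ₗ[k] E) : E := sw s t (Rinv Q)

section

variable {Q} {s t u : H →ₗ[k] E}

lemma brInv_mul_br (hs : IsStrand s) (ht : IsStrand t) (hst : Comm s t) :
    brInv Q s t * br Q s t = 1 := by
  rw [br, brInv, ← sw_mul hs ht hst, R_mul_Rinv, sw_one hs.map_one ht.map_one]

lemma br_mul_brInv (hs : IsStrand s) (ht : IsStrand t) (hst : Comm s t) :
    br Q s t * brInv Q s t = 1 := by
  rw [br, brInv, ← sw_mul hs ht hst, Rinv_mul_R, sw_one hs.map_one ht.map_one]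

lemma _root_.Commute.br_right {x : E} (hs : ∀ h, Commute x (s h)) (ht : ∀ h, Commute x (t h)) :
    Commute x (br Q s t) := Commute.sw_right hs ht _

lemma _root_.Commute.brInv_right {x : E} (hs : ∀ h, Commute x (s h))
    (ht : ∀ h, Commute x (t h)) : Commute x (brInv Q s t) := Commute.sw_right hs ht _

/-- This is R Δ(h) = Δᵒᵖ(h) R evaluated on two commuting strands. -/
lemma cv_mul_br (hs : IsStrand s) (ht : IsStrand t) (hst : Comm s t) (h : H) :
    cv s t h * br Q s t = br Q s t * cv t s h := by
  rw [cv_apply, br, ← sw_mul hs ht hst, Q.quasi_cocomm, sw_mul hs ht hst, sw_comm hst, cv_apply]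

lemma cv_mul_brInv (hs : IsStrand s) (ht : IsStrand t) (hst : Comm s t) (h : H) :
    cv t s h * brInv Q s t = brInv Q s t * cv s t h := by
  have e := cv_mul_br (Q := Q) hs ht hst h
  calc cv t s h * brInv Q s t
      = brInv Q s t * br Q s t * cv t s h * brInv Q s t := by
        rw [brInv_mul_br hs ht hst, one_mul]
    _ = brInv Q s t * (br Q s t * cv t s h) * brInv Q s t := by rw [mul_assoc (brInv Q s t)]
    _ = brInv Q s t * cv s t h * (br Q s t * brInv Q s t) := by rw [← e]; simp only [mul_assoc]
    _ = _ := by rw [br_mul_brInv hs ht hst, mul_one]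

lemma sw₃_leftComm_mul (hst : Comm s t) (hsu : Comm s u) (hu : IsStrand u)
    (x y : H ⊗[k] H) :
    sw₃ s t u (TensorProduct.leftComm k H H H ((1 : H) ⊗ₜ[k] x) * ((1 : H) ⊗ₜ[k] y)) =
      sw t u y * sw s u x := by
  induction x using TensorProduct.induction_on with
  | zero => simp
  | add x₁ x₂ h₁ h₂ => simp only [tmul_add, map_add, add_mul, mul_add, h₁, h₂]
  | tmul a b =>
    induction y using TensorProduct.induction_on with
    | zero => simp
    | add y₁ y₂ h₁ h₂ => simp only [tmul_add, map_add, add_mul, mul_add, h₁, h₂]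
    | tmul c d =>
      simp only [leftComm_tmul, Algebra.TensorProduct.tmul_mul_tmul, sw₃_tmul, sw_tmul, mul_one,
        one_mul, hu.map_mul]
      rw [← mul_assoc (s a), (hst a c).eq, mul_assoc, mul_assoc, ← mul_assoc (s a),
        (hsu a d).eq, mul_assoc]

/-- The formula (Δ ⊗ id)(R) = R₁₃ R₂₃, reversed by the anti-homomorphism `u`. Nothing is asked of
`s` and `t` beyond commutation, since no product is formed in the first two legs. -/
lemma br_cv_left (hst : Comm s t) (hsu : Comm s u) (hu : IsStrand u) :
    br Q (cv s t) u = br Q t u * br Q s u := by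
  rw [br, sw_cv_left, Q.comul_fst, sw₃_leftComm_mul hst hsu hu, br, br]

lemma sw₃_leftComm_mul_assoc (hs : IsStrand s) (hst : Comm s t)
    (x y : H ⊗[k] H) :
    sw₃ s t u (TensorProduct.leftComm k H H H ((1 : H) ⊗ₜ[k] x) *
      TensorProduct.assoc k H H H (y ⊗ₜ[k] (1 : H))) = sw s t y * sw s u x := by
  induction x using TensorProduct.induction_on with
  | zero => simp
  | add x₁ x₂ h₁ h₂ => simp only [tmul_add, map_add, add_mul, mul_add, h₁, h₂]
  | tmul a b =>
    induction y using TensorProduct.induction_on with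
    | zero => simp
    | add y₁ y₂ h₁ h₂ => simp only [add_tmul, map_add, add_mul, mul_add, h₁, h₂]
    | tmul c d =>
      simp only [leftComm_tmul, assoc_tmul, Algebra.TensorProduct.tmul_mul_tmul, sw₃_tmul,
        sw_tmul, mul_one, one_mul, hs.map_mul]
      rw [mul_assoc, ← mul_assoc (s a), (hst a d).eq]
      simp only [mul_assoc]

/-- Only `s` receives a product, so `t` and `u` may be arbitrary linear maps; `br_rep_right` relies
on this to take a left action for one of them. -/
lemma br_cv_right (hs : IsStrand s) (hst : Comm s t) :
    br Q s (cv t u) = br Q s t * br Q s u := by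
  rw [br, sw_cv_right, Q.comul_snd, sw₃_leftComm_mul_assoc hs hst, br, br]

/-- The trivial strand is its own convolution square, so by the hexagon this operator is idempotent;
being invertible, it is 1. -/
lemma br_triv_left (hs : IsStrand s) : br Q triv s = 1 := by
  have e : br Q triv s = br Q triv s * br Q triv s := by
    conv_lhs => rw [← cv_triv_left (triv : H →ₗ[k] E)]
    exact br_cv_left (comm_triv _) (comm_triv s).symm hs
  calc br Q triv s = brInv Q triv s * br Q triv s * br Q triv s := by
        rw [brInv_mul_br triv_isStrand hs (comm_triv s).symm, one_mul]
    _ = 1 := by rw [mul_assoc, ← e, brInv_mul_br triv_isStrand hs (comm_triv s).symm]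

lemma br_triv_right (hs : IsStrand s) : br Q s triv = 1 := by
  have e : br Q s triv = br Q s triv * br Q s triv := by
    conv_lhs => rw [← cv_triv_left (triv : H →ₗ[k] E)]
    exact br_cv_right hs (comm_triv s)
  calc br Q s triv = brInv Q s triv * br Q s triv * br Q s triv := by
        rw [brInv_mul_br hs triv_isStrand (comm_triv s), one_mul]
    _ = 1 := by rw [mul_assoc, ← e, brInv_mul_br hs triv_isStrand (comm_triv s)]

lemma brInv_triv_right (hs : IsStrand s) : brInv Q s triv = 1 := by
  rw [← brInv_mul_br (Q := Q) hs triv_isStrand (comm_triv s), br_triv_right hs, mul_one]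

lemma brInv_triv_left (hs : IsStrand s) : brInv Q triv s = 1 := by
  rw [← brInv_mul_br (Q := Q) triv_isStrand hs (comm_triv s).symm, br_triv_left hs, mul_one]

lemma brInv_cv_right (hs : IsStrand s) (ht : IsStrand t) (hu : IsStrand u) (hst : Comm s t)
    (hsu : Comm s u) (htu : Comm t u) :
    brInv Q s (cv t u) = brInv Q s u * brInv Q s t := by
  refine left_inv_eq_right_inv (a := br Q s (cv t u))
    (brInv_mul_br hs (ht.cv hu htu) (hst.cv_right hsu)) ?_
  rw [br_cv_right hs hst, mul_assoc, ← mul_assoc (br Q s u),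
    br_mul_brInv hs hu hsu, one_mul, br_mul_brInv hs ht hst]

lemma brInv_cv_left (hs : IsStrand s) (ht : IsStrand t) (hu : IsStrand u) (hst : Comm s t)
    (hsu : Comm s u) (htu : Comm t u) :
    brInv Q (cv s t) u = brInv Q s u * brInv Q t u := by
  refine left_inv_eq_right_inv (a := br Q (cv s t) u)
    (brInv_mul_br (hs.cv ht hst) hu (hsu.cv_left htu)) ?_
  rw [br_cv_left hst hsu hu, mul_assoc, ← mul_assoc (br Q s u),
    br_mul_brInv hs hu hsu, one_mul, br_mul_brInv ht hu htu]

/-- The Yang–Baxter equation. -/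
lemma yangBaxter (hs : IsStrand s) (ht : IsStrand t) (hu : IsStrand u) (hst : Comm s t)
    (hsu : Comm s u) (htu : Comm t u) :
    br Q t u * (br Q s u * br Q s t) = br Q s t * (br Q s u * br Q t u) := by
  -- Quasi-cocommutativity in `t` and `u`, with `s` a spectator. Evaluated at R, both sides then
  -- split by the hexagon into the two sides of the equation.
  have e : ∀ x : H ⊗[k] H, sw s (cv t u) x * br Q t u = br Q t u * sw s (cv u t) x := by
    intro x
    induction x using TensorProduct.induction_on with
    | zero => simp
    | add x y hx hy => simp only [map_add, add_mul, mul_add, hx, hy]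
    | tmul a b =>
      rw [sw_tmul, sw_tmul, mul_assoc, cv_mul_br ht hu htu, ← mul_assoc, ← mul_assoc,
        (Commute.br_right (hst a) (hsu a)).eq]
  have e' : br Q s (cv t u) * br Q t u = br Q t u * br Q s (cv u t) := e Q.R
  rw [br_cv_right hs hst, br_cv_right hs hsu] at e'
  rw [← e', mul_assoc]

end

/-! ### Left actions and the antipode -/

section Antipode

variable {Q} {r l m : H →ₗ[k] E}

/-- A unital homomorphism from `H` to `E`. -/
structure IsRep (l : H →ₗ[k] E) : Prop where
  map_one : l 1 = 1
  map_mul : ∀ g h, l (g * h) = l g * l h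

/-- The strand `h ↦ l(S(h))`. -/
def anti (l : H →ₗ[k] E) : H →ₗ[k] E := l ∘ₗ HopfAlgebra.antipode k

lemma anti_apply (l : H →ₗ[k] E) (h : H) : anti l h = l (HopfAlgebra.antipode k h) := rfl

lemma IsRep.anti (hl : IsRep l) : IsStrand (anti l) where
  map_one := by rw [anti_apply, HopfAlgebra.antipode_one, hl.map_one]
  map_mul g h := by
    rw [anti_apply, HopfAlgebra.antipode_mul_antidistrib, hl.map_mul, anti_apply, anti_apply]

lemma Comm.anti_right (h : Comm r l) : Comm r (anti l) := fun _ _ => h _ _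

lemma Comm.anti_left (h : Comm r l) : Comm (anti r) l := fun _ _ => h _ _

lemma cv_anti_right (hl : IsRep l) : cv l (anti l) = triv := by
  ext h
  have e : ∀ x : H ⊗[k] H, sw l (anti l) x =
      l (LinearMap.mul' k H ((HopfAlgebra.antipode k).lTensor H x)) := by
    intro x
    induction x using TensorProduct.induction_on with
    | zero => simp
    | add x y hx hy => simp only [map_add, hx, hy]
    | tmul a b => simp [hl.map_mul, anti_apply]
  rw [cv_apply, e, HopfAlgebra.mul_antipode_lTensor_comul_apply, Algebra.algebraMap_eq_smul_one,
    map_smul, hl.map_one, triv_apply, Algebra.algebraMap_eq_smul_one]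

lemma cv_anti_left (hl : IsRep l) : cv (anti l) l = triv := by
  ext h
  have e : ∀ x : H ⊗[k] H, sw (anti l) l x =
      l (LinearMap.mul' k H ((HopfAlgebra.antipode k).rTensor H x)) := by
    intro x
    induction x using TensorProduct.induction_on with
    | zero => simp
    | add x y hx hy => simp only [map_add, hx, hy]
    | tmul a b => simp [hl.map_mul, anti_apply]
  rw [cv_apply, e, HopfAlgebra.mul_antipode_rTensor_comul_apply, Algebra.algebraMap_eq_smul_one,
    map_smul, hl.map_one, triv_apply, Algebra.algebraMap_eq_smul_one]

/-- The convolution of `l` with `l ∘ S` is trivial, so the braidings of `r` with the two multiply to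
1. This is (id ⊗ S)(R⁻¹) = R. -/
lemma br_rep_right (hr : IsStrand r) (hl : IsRep l) (hrl : Comm r l) :
    br Q r l = brInv Q r (anti l) := by
  refine left_inv_eq_right_inv (a := br Q r (anti l)) ?_
    (br_mul_brInv hr hl.anti hrl.anti_right)
  rw [← br_cv_right hr hrl, cv_anti_right hl, br_triv_right hr]

/-- The identity, seen as a map from `H` to its opposite algebra, is a strand, and it is injective:
an operator identity for it is an identity in `H`. -/
lemma counit_rTensor_R :
    TensorProduct.lid k H ((Coalgebra.counit (R := k)).rTensor H Q.R) = 1 := by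
  have h : IsStrand ((MulOpposite.opLinearEquiv k).toLinearMap : H →ₗ[k] Hᵐᵒᵖ) :=
    ⟨rfl, fun _ _ => rfl⟩
  have e := br_triv_left (Q := Q) h
  rw [br, sw_triv_left] at e
  exact MulOpposite.op_injective e

/-- This is (S ⊗ S)(R) = R: both sides are inverse to (S ⊗ id)(R). -/
lemma br_rep_rep (hl : IsRep l) (hm : IsRep m) (hlm : Comm l m) :
    br Q l m = br Q (anti l) (anti m) := by
  -- Here `m` preserves products instead of reversing them, so the two factors come in the order
  -- opposite to that of `br_cv_left`.
  have e : ∀ x y : H ⊗[k] H, sw₃ (anti l) l m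
      (TensorProduct.leftComm k H H H ((1 : H) ⊗ₜ[k] x) * ((1 : H) ⊗ₜ[k] y)) =
      sw (anti l) m x * sw l m y := by
    intro x y
    induction x using TensorProduct.induction_on with
    | zero => simp
    | add x₁ x₂ h₁ h₂ => simp only [tmul_add, map_add, add_mul, h₁, h₂]
    | tmul a b =>
      induction y using TensorProduct.induction_on with
      | zero => simp
      | add y₁ y₂ h₁ h₂ => simp only [tmul_add, map_add, mul_add, h₁, h₂]
      | tmul c d =>
        simp only [leftComm_tmul, Algebra.TensorProduct.tmul_mul_tmul, sw₃_tmul, sw_tmul, mul_one,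
          one_mul, hm.map_mul]
        rw [mul_assoc, ← mul_assoc (m b), ← (hlm c b).eq, mul_assoc]
  have h₁ : br Q (anti l) m * br Q l m = 1 := by
    rw [br, br, ← e, ← Q.comul_fst, ← sw_cv_left, cv_anti_left hl, sw_triv_left,
      counit_rTensor_R, hm.map_one]
  rw [br_rep_right hl.anti hm hlm.anti_left] at h₁
  exact (left_inv_eq_right_inv
    (br_mul_brInv hl.anti hm.anti hlm.anti_left.anti_right) h₁).symm

end Antipode

end RMatrix

/-! ### Relations in a family of strands -/

/-- It allows a three-letter relation to be applied at the start of a longer right-associated word.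
-/
lemma _root_.mul_three_mul_eq {M : Type*} [Semigroup M] {a b c d e f : M}
    (h : a * (b * c) = d * (e * f)) (x : M) : a * (b * (c * x)) = d * (e * (f * x)) := by
  simpa only [mul_assoc] using congrArg (· * x) h

namespace StrandFamily

variable {k H : Type u} [Field k] [Ring H] [HopfAlgebra k H] {Q : QuasitriangularStructure k H}
variable {E : Type*} [Ring E] [Algebra k E] {ι : Type*} {σ : ι → H →ₗ[k] E}

lemma comp (hσ : StrandFamily σ) {κ : Type*} (f : κ → ι) (hf : Function.Injective f) :
    StrandFamily (σ ∘ f) where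
  strand i := hσ.strand (f i)
  comm _ _ h := hσ.comm _ _ (hf.ne h)

variable (Q) (hσ : StrandFamily σ) (i j m n : ι)

include hσ

lemma brInv_mul (h : i ≠ j) : brInv Q (σ i) (σ j) * br Q (σ i) (σ j) = 1 :=
  HopfStrand.brInv_mul_br (hσ.strand _) (hσ.strand _) (hσ.comm _ _ h)

lemma br_mul (h : i ≠ j) : br Q (σ i) (σ j) * brInv Q (σ i) (σ j) = 1 :=
  HopfStrand.br_mul_brInv (hσ.strand _) (hσ.strand _) (hσ.comm _ _ h)

lemma br_comm (h : i ≠ m ∧ i ≠ n ∧ j ≠ m ∧ j ≠ n) :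
    Commute (br Q (σ i) (σ j)) (br Q (σ m) (σ n)) :=
  (Commute.br_right
    (fun a => (Commute.br_right (fun b => hσ.comm _ _ h.1.symm a b)
      (fun b => hσ.comm _ _ h.2.2.1.symm a b)).symm)
    (fun a => (Commute.br_right (fun b => hσ.comm _ _ h.2.1.symm a b)
      (fun b => hσ.comm _ _ h.2.2.2.symm a b)).symm))

lemma brInv_comm (h : i ≠ m ∧ i ≠ n ∧ j ≠ m ∧ j ≠ n) :
    Commute (brInv Q (σ i) (σ j)) (br Q (σ m) (σ n)) :=
  (Commute.br_right
    (fun a => (Commute.brInv_right (fun b => hσ.comm _ _ h.1.symm a b)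
      (fun b => hσ.comm _ _ h.2.2.1.symm a b)).symm)
    (fun a => (Commute.brInv_right (fun b => hσ.comm _ _ h.2.1.symm a b)
      (fun b => hσ.comm _ _ h.2.2.2.symm a b)).symm))

lemma yb (h : i ≠ j ∧ i ≠ m ∧ j ≠ m) :
    br Q (σ j) (σ m) * (br Q (σ i) (σ m) * br Q (σ i) (σ j)) =
      br Q (σ i) (σ j) * (br Q (σ i) (σ m) * br Q (σ j) (σ m)) :=
  yangBaxter (hσ.strand _) (hσ.strand _) (hσ.strand _) (hσ.comm _ _ h.1) (hσ.comm _ _ h.2.1)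
    (hσ.comm _ _ h.2.2)

/-- The operators `exch` and `chord` contain an inverse braiding. This relation and the next two are
Yang–Baxter with one or two of its factors carried to the other side. -/
lemma yb_inv_right (h : i ≠ j ∧ i ≠ m ∧ j ≠ m) :
    br Q (σ i) (σ m) * (br Q (σ i) (σ j) * brInv Q (σ j) (σ m)) =
      brInv Q (σ j) (σ m) * (br Q (σ i) (σ j) * br Q (σ i) (σ m)) := by
  have e := hσ.yb Q i j m h
  have h₁ := hσ.brInv_mul Q j m h.2.2
  have h₂ := hσ.br_mul Q j m h.2.2
  generalize br Q (σ j) (σ m) = a at *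
  generalize brInv Q (σ j) (σ m) = a' at *
  generalize br Q (σ i) (σ m) = b at *
  generalize br Q (σ i) (σ j) = c at *
  calc b * (c * a') = a' * a * (b * (c * a')) := by rw [h₁, one_mul]
    _ = a' * ((a * (b * c)) * a') := by simp only [mul_assoc]
    _ = a' * (c * (b * (a * a'))) := by rw [e]; simp only [mul_assoc]
    _ = _ := by rw [h₂, mul_one]

lemma yb_inv_left (h : i ≠ j ∧ i ≠ m ∧ j ≠ m) :
    brInv Q (σ i) (σ j) * (br Q (σ j) (σ m) * br Q (σ i) (σ m)) =
      br Q (σ i) (σ m) * (br Q (σ j) (σ m) * brInv Q (σ i) (σ j)) := by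
  have e := hσ.yb Q i j m h
  have h₁ := hσ.brInv_mul Q i j h.1
  have h₂ := hσ.br_mul Q i j h.1
  generalize br Q (σ j) (σ m) = a at *
  generalize brInv Q (σ i) (σ j) = c' at *
  generalize br Q (σ i) (σ m) = b at *
  generalize br Q (σ i) (σ j) = c at *
  calc c' * (a * b) = c' * ((a * (b * c)) * c') := by simp only [mul_assoc, h₂, mul_one]
    _ = c' * c * (b * (a * c')) := by rw [e]; simp only [mul_assoc]
    _ = _ := by rw [h₁, one_mul]

lemma yb_inv_inv (h : i ≠ j ∧ i ≠ m ∧ j ≠ m) :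
    br Q (σ j) (σ m) * (brInv Q (σ i) (σ j) * brInv Q (σ i) (σ m)) =
      brInv Q (σ i) (σ m) * (brInv Q (σ i) (σ j) * br Q (σ j) (σ m)) := by
  have e := hσ.yb Q i j m h
  have h₁ := hσ.brInv_mul Q i j h.1
  have h₂ := hσ.br_mul Q i j h.1
  have h₃ := hσ.brInv_mul Q i m h.2.1
  have h₄ := hσ.br_mul Q i m h.2.1
  generalize br Q (σ j) (σ m) = a at *
  generalize brInv Q (σ i) (σ j) = c' at *
  generalize brInv Q (σ i) (σ m) = b' at *
  generalize br Q (σ i) (σ m) = b at *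
  generalize br Q (σ i) (σ j) = c at *
  calc a * (c' * b') = b' * (c' * c) * b * (a * (c' * b')) := by
        rw [h₁, mul_one, h₃, one_mul]
    _ = b' * (c' * ((c * (b * a)) * (c' * b'))) := by simp only [mul_assoc]
    _ = b' * (c' * (a * (b * ((c * c') * b')))) := by rw [← e]; simp only [mul_assoc]
    _ = _ := by rw [h₂, one_mul, h₄, mul_one]

end StrandFamily

/-! ### Word identities for products and for the exchange relation. -/

section Words

variable {k H : Type u} [Field k] [Ring H] [HopfAlgebra k H] (Q : QuasitriangularStructure k H)
variable {E : Type*} [Ring E] [Algebra k E]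

/-- The operator through which the product of `𝓛_{0,1}(H)` differs from `⋆`; `l` is the left
strand of the first factor and `r'`, `l'` are the strands of the second factor. -/
def fus (l r' l' : H →ₗ[k] E) : E := br Q l' l * br Q r' l

/-- The operator of the exchange relation of `𝓛_{1,0}(H)`, for factors with strands `r`, `l` and
`r'`, `l'`. -/
def exch (r l r' l' : H →ₗ[k] E) : E := brInv Q r' l * (br Q l l' * (br Q r r' * br Q r l'))

variable {σ : Fin 6 → H →ₗ[k] E} (hσ : StrandFamily σ)

include hσ

/-- Associativity of the product of `𝓛_{0,1}(H)`, with strands `r₁, l₁, r₂, l₂, r₃, l₃`. -/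
lemma fus_assoc :
    fus Q (cv (σ 3) (σ 1)) (σ 4) (σ 5) * fus Q (σ 1) (σ 2) (σ 3) =
      fus Q (σ 1) (cv (σ 2) (σ 4)) (cv (σ 5) (σ 3)) * fus Q (σ 3) (σ 4) (σ 5) := by
  have c : ∀ i j, i ≠ j → Comm (σ i) (σ j) := hσ.comm
  -- The convolutions are the strands of products: for ⋆ the right strands come in the order r₁, r₂
  -- and the left ones in the order l₂, l₁. The hexagons expand each side into six elementary
  -- braidings.
  rw [fus, fus, fus, fus, br_cv_right (hσ.strand 5) (c _ _ (by decide)),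
    br_cv_right (hσ.strand 4) (c _ _ (by decide)),
    br_cv_left (c 5 3 (by decide)) (c _ _ (by decide)) (hσ.strand 1),
    br_cv_left (c 2 4 (by decide)) (c _ _ (by decide)) (hσ.strand 1)]
  simp only [mul_assoc]
  -- Up to commutations, the two words differ by Yang–Baxter on l₃, l₂, l₁ and on r₃, l₂, l₁.
  rw [(hσ.br_comm Q 2 1 5 3 (by decide)).left_comm, (hσ.br_comm Q 2 1 4 3 (by decide)).eq,
    (hσ.br_comm Q 4 1 5 3 (by decide)).left_comm,
    mul_three_mul_eq (hσ.yb Q 5 3 1 (by decide)), mul_three_mul_eq (hσ.yb Q 4 3 1 (by decide))]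

/-- Compatibility of the exchange operator with the product of the left factor: strands
`r₁, l₁, r₂, l₂` of the two left factors and `r, l` of the right factor. -/
lemma exch_fus_left :
    exch Q (cv (σ 0) (σ 2)) (cv (σ 3) (σ 1)) (σ 4) (σ 5) * fus Q (σ 1) (σ 2) (σ 3) =
      fus Q (σ 1) (σ 2) (σ 3) * (exch Q (σ 2) (σ 3) (σ 4) (σ 5) *
        exch Q (σ 0) (σ 1) (σ 4) (σ 5)) := by
  have c : ∀ i j, i ≠ j → Comm (σ i) (σ j) := hσ.comm
  rw [fus, exch, exch, exch,
    brInv_cv_right (hσ.strand 4) (hσ.strand 3) (hσ.strand 1) (c _ _ (by decide))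
      (c _ _ (by decide)) (c _ _ (by decide)),
    br_cv_left (c 3 1 (by decide)) (c _ _ (by decide)) (hσ.strand 5),
    br_cv_left (c 0 2 (by decide)) (c _ _ (by decide)) (hσ.strand 4),
    br_cv_left (c 0 2 (by decide)) (c _ _ (by decide)) (hσ.strand 5)]
  simp only [mul_assoc]
  symm
  -- Starting from the other side, both letters of the fusion operator are carried to the right end:
  -- first the braiding of 2 with 1, crossing 4 and then 5 by Yang–Baxter, next the braiding of 3
  -- with 1, crossing the same two strands.
  rw [(hσ.brInv_comm Q 4 1 2 5 (by decide)).symm.left_comm,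
    (hσ.brInv_comm Q 4 3 2 1 (by decide)).symm.left_comm,
    (hσ.br_comm Q 2 1 3 5 (by decide)).left_comm,
    mul_three_mul_eq (hσ.yb_inv_right Q 2 4 1 (by decide)),
    ← mul_three_mul_eq (hσ.yb Q 2 1 5 (by decide)),
    (hσ.br_comm Q 2 1 0 4 (by decide)).left_comm,
    (hσ.br_comm Q 2 1 0 5 (by decide)).eq,
    (hσ.brInv_comm Q 4 1 3 5 (by decide)).symm.left_comm,
    (hσ.br_comm Q 2 4 1 5 (by decide)).left_comm,
    mul_three_mul_eq (hσ.yb_inv_inv Q 4 3 1 (by decide)),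
    ← mul_three_mul_eq (hσ.yb Q 3 1 5 (by decide)),
    (hσ.br_comm Q 3 1 2 4 (by decide)).left_comm,
    (hσ.br_comm Q 3 1 2 5 (by decide)).left_comm,
    (hσ.br_comm Q 3 1 0 4 (by decide)).left_comm,
    (hσ.br_comm Q 3 1 0 5 (by decide)).left_comm,
    (hσ.br_comm Q 2 5 0 4 (by decide)).left_comm]

/-- Compatibility of the exchange operator with the product of the right factor: strands
`r, l` of the left factor and `r₁, l₁, r₂, l₂` of the two right factors. -/
lemma exch_fus_right :
    exch Q (σ 0) (σ 1) (cv (σ 2) (σ 4)) (cv (σ 5) (σ 3)) * fus Q (σ 3) (σ 4) (σ 5) =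
      fus Q (σ 3) (σ 4) (σ 5) * (exch Q (σ 0) (σ 1) (σ 2) (σ 3) *
        exch Q (σ 0) (σ 1) (σ 4) (σ 5)) := by
  have c : ∀ i j, i ≠ j → Comm (σ i) (σ j) := hσ.comm
  rw [fus, exch, exch, exch,
    brInv_cv_left (hσ.strand 2) (hσ.strand 4) (hσ.strand 1) (c _ _ (by decide))
      (c _ _ (by decide)) (c _ _ (by decide)),
    br_cv_right (hσ.strand 1) (c 1 5 (by decide)),
    br_cv_right (hσ.strand 0) (c 0 2 (by decide)),
    br_cv_right (hσ.strand 0) (c 0 5 (by decide))]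
  simp only [mul_assoc]
  symm
  -- The braiding of 4 with 3 moves right, crossing strand 1 and then strand 0; the braiding of 5
  -- with 3 follows in the same way.
  rw [(hσ.brInv_comm Q 2 1 4 3 (by decide)).symm.left_comm,
    (hσ.brInv_comm Q 4 1 0 3 (by decide)).symm.left_comm,
    (hσ.brInv_comm Q 4 1 0 2 (by decide)).symm.left_comm,
    ← mul_three_mul_eq (hσ.yb_inv_left Q 4 1 3 (by decide)),
    (hσ.br_comm Q 0 3 1 5 (by decide)).left_comm,
    (hσ.br_comm Q 0 2 1 5 (by decide)).left_comm,
    (hσ.br_comm Q 4 3 1 5 (by decide)).left_comm,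
    (hσ.br_comm Q 4 3 0 2 (by decide)).left_comm,
    mul_three_mul_eq (hσ.yb Q 0 4 3 (by decide)),
    (hσ.br_comm Q 4 3 0 5 (by decide)).eq,
    (hσ.brInv_comm Q 2 1 5 3 (by decide)).symm.left_comm,
    (hσ.brInv_comm Q 4 1 5 3 (by decide)).symm.left_comm,
    mul_three_mul_eq (hσ.yb Q 1 5 3 (by decide)),
    (hσ.br_comm Q 5 3 0 2 (by decide)).left_comm,
    (hσ.br_comm Q 5 3 0 4 (by decide)).left_comm,
    mul_three_mul_eq (hσ.yb Q 0 5 3 (by decide))]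

end Words

/-! ### The word identity for modules over 𝓛₀,₁. -/

section ModuleWord

variable {k H : Type u} [Field k] [Ring H] [HopfAlgebra k H] (Q : QuasitriangularStructure k H)
variable {E : Type*} [Ring E] [Algebra k E]

/-- The operator of the action of `𝓛_{0,1}(H)` on a module with strand `x`. -/
def chord (r l x : H →ₗ[k] E) : E := brInv Q r x * br Q x l

variable {σ : Fin 5 → H →ₗ[k] E} (hσ : StrandFamily σ)

include hσ

/-- Compatibility of the action of `𝓛_{0,1}(H)` with its product: strands `r₁, l₁, r₂, l₂` of the
two factors and `x` of the module. -/
lemma chord_fus :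
    chord Q (cv (σ 0) (σ 2)) (cv (σ 3) (σ 1)) (σ 4) * fus Q (σ 1) (σ 2) (σ 3) =
      br Q (cv (σ 2) (σ 3)) (σ 1) * (chord Q (σ 0) (σ 1) (σ 4) * chord Q (σ 2) (σ 3) (σ 4)) := by
  have c : ∀ i j, i ≠ j → Comm (σ i) (σ j) := hσ.comm
  rw [fus, chord, chord, chord,
    brInv_cv_left (hσ.strand 0) (hσ.strand 2) (hσ.strand 4) (c _ _ (by decide))
      (c _ _ (by decide)) (c _ _ (by decide)),
    br_cv_right (hσ.strand 4) (c _ _ (by decide)),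
    br_cv_left (c 2 3 (by decide)) (c _ _ (by decide)) (hσ.strand 1)]
  simp only [mul_assoc]
  -- Two Yang–Baxter moves, on 4, 3, 1 and on 2, 4, 1, bring to the front the braiding of the whole
  -- second factor with l₁. That prefactor becomes trivial once the second factor is evaluated at 1.
  rw [← mul_three_mul_eq (hσ.yb Q 4 3 1 (by decide)),
    (hσ.br_comm Q 4 3 2 1 (by decide)).eq,
    (hσ.brInv_comm Q 2 4 3 1 (by decide)).left_comm,
    mul_three_mul_eq (hσ.yb_inv_left Q 2 4 1 (by decide)),
    (hσ.brInv_comm Q 0 4 3 1 (by decide)).left_comm,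
    (hσ.brInv_comm Q 0 4 2 1 (by decide)).left_comm]

end ModuleWord

/-! ### Twisted tensor products -/

section Twisted

variable {k A B M N : Type*} [CommRing k] [AddCommGroup A] [Module k A] [AddCommGroup B]
  [Module k B] [AddCommGroup M] [Module k M] [AddCommGroup N] [Module k N]

/-- `id ⊗ ψ ⊗ id : (A ⊗ B) ⊗ (M ⊗ N) → (A ⊗ M) ⊗ (B ⊗ N)`. -/
def middle (A N : Type*) [AddCommGroup A] [Module k A] [AddCommGroup N] [Module k N]
    (ψ : B ⊗[k] M →ₗ[k] M ⊗[k] B) :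
    (A ⊗[k] B) ⊗[k] (M ⊗[k] N) →ₗ[k] (A ⊗[k] M) ⊗[k] (B ⊗[k] N) :=
  (TensorProduct.assoc k A M (B ⊗[k] N)).symm.toLinearMap ∘ₗ
    ((TensorProduct.assoc k M B N).toLinearMap ∘ₗ ψ.rTensor N ∘ₗ
      (TensorProduct.assoc k B M N).symm.toLinearMap).lTensor A ∘ₗ
    (TensorProduct.assoc k A B (M ⊗[k] N)).toLinearMap

/-- The action of `A ⊗ B` on `M ⊗ N` in which `B` moves past `M` by `ψ`. -/
def twist (lM : A ⊗[k] M →ₗ[k] M) (lN : B ⊗[k] N →ₗ[k] N) (ψ : B ⊗[k] M →ₗ[k] M ⊗[k] B) :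
    (A ⊗[k] B) ⊗[k] (M ⊗[k] N) →ₗ[k] M ⊗[k] N :=
  TensorProduct.map lM lN ∘ₗ middle A N ψ

/-- The action of `B` on `M ⊗ N` in which `B` moves past `M` by `ψ`. -/
def twistRight (lN : B ⊗[k] N →ₗ[k] N) (ψ : B ⊗[k] M →ₗ[k] M ⊗[k] B) (b : B) :
    M ⊗[k] N →ₗ[k] M ⊗[k] N :=
  lN.lTensor M ∘ₗ (TensorProduct.assoc k M B N).toLinearMap ∘ₗ
    (ψ ∘ₗ TensorProduct.mk k B M b).rTensor N

lemma twistRight_tmul (lN : B ⊗[k] N →ₗ[k] N) (ψ : B ⊗[k] M →ₗ[k] M ⊗[k] B) (b : B) (v : M)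
    (w : N) : twistRight lN ψ b (v ⊗ₜ[k] w) =
      lN.lTensor M (TensorProduct.assoc k M B N (ψ (b ⊗ₜ[k] v) ⊗ₜ[k] w)) := rfl

lemma twist_tmul (lM : A ⊗[k] M →ₗ[k] M) (lN : B ⊗[k] N →ₗ[k] N)
    (ψ : B ⊗[k] M →ₗ[k] M ⊗[k] B) (a : A) (b : B) (z : M ⊗[k] N) :
    twist lM lN ψ ((a ⊗ₜ[k] b) ⊗ₜ[k] z) =
      (lM ∘ₗ TensorProduct.mk k A M a).rTensor N (twistRight lN ψ b z) := by
  induction z using TensorProduct.induction_on with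
  | zero => simp
  | add x y hx hy => simp only [tmul_add, map_add, hx, hy]
  | tmul v w =>
    rw [twistRight_tmul]
    have e : twist lM lN ψ ((a ⊗ₜ[k] b) ⊗ₜ[k] (v ⊗ₜ[k] w)) = TensorProduct.map lM lN
      ((TensorProduct.assoc k A M (B ⊗[k] N)).symm
        (a ⊗ₜ[k] TensorProduct.assoc k M B N (ψ (b ⊗ₜ[k] v) ⊗ₜ[k] w))) := rfl
    rw [e]
    generalize ψ (b ⊗ₜ[k] v) = t
    induction t using TensorProduct.induction_on with
    | zero => simp
    | add x y hx hy => simp only [add_tmul, tmul_add, map_add, hx, hy]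
    | tmul m b => simp

/-- `l : A ⊗ M → M` is an action of the algebra `A` with product `m` and unit `e`. -/
structure IsAction (e : A) (m : A ⊗[k] A →ₗ[k] A) (l : A ⊗[k] M →ₗ[k] M) : Prop where
  one_act : ∀ v, l (e ⊗ₜ[k] v) = v
  mul_act : ∀ a b v, l (m (a ⊗ₜ[k] b) ⊗ₜ[k] v) = l (a ⊗ₜ[k] l (b ⊗ₜ[k] v))

/-- The conditions under which moving `B` past `M` is compatible with moving `B` past `A`. -/
structure IsTwist (eB : B) (mB : B ⊗[k] B →ₗ[k] B) (lM : A ⊗[k] M →ₗ[k] M)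
    (ψA : B ⊗[k] A →ₗ[k] A ⊗[k] B) (ψM : B ⊗[k] M →ₗ[k] M ⊗[k] B) : Prop where
  one : ∀ v, ψM (eB ⊗ₜ[k] v) = v ⊗ₜ[k] eB
  act : ∀ b a v, ψM (b ⊗ₜ[k] lM (a ⊗ₜ[k] v)) =
    lM.rTensor B ((TensorProduct.assoc k A M B).symm
      ((ψM ∘ₗ (TensorProduct.mk k B M).flip v).lTensor A (ψA (b ⊗ₜ[k] a))))
  mul : ∀ b b' v, ψM (mB (b ⊗ₜ[k] b') ⊗ₜ[k] v) =
    mB.lTensor M (TensorProduct.assoc k M B B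
      ((ψM ∘ₗ TensorProduct.mk k B M b).rTensor B (ψM (b' ⊗ₜ[k] v))))

variable {eA : A} {mA : A ⊗[k] A →ₗ[k] A} {lM : A ⊗[k] M →ₗ[k] M}
  {eB : B} {mB : B ⊗[k] B →ₗ[k] B} {lN : B ⊗[k] N →ₗ[k] N}
  {ψA : B ⊗[k] A →ₗ[k] A ⊗[k] B} {ψM : B ⊗[k] M →ₗ[k] M ⊗[k] B}

/-- Moving a product of `B` past `M` is moving its factors successively; what comes out acts on `N`
as a product. -/
lemma IsTwist.twistRight_mul (h : IsTwist eB mB lM ψA ψM) (hN : IsAction eB mB lN) (b b' : B)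
    (z : M ⊗[k] N) : twistRight lN ψM (mB (b ⊗ₜ[k] b')) z =
      twistRight lN ψM b (twistRight lN ψM b' z) := by
  induction z using TensorProduct.induction_on with
  | zero => simp
  | add x y hx hy => simp only [map_add, hx, hy]
  | tmul v w =>
    rw [twistRight_tmul, twistRight_tmul, h.mul]
    generalize ψM (b' ⊗ₜ[k] v) = s
    induction s using TensorProduct.induction_on with
    | zero => simp
    | add x y hx hy => simp only [add_tmul, map_add, hx, hy]
    | tmul m c =>
      simp only [LinearMap.rTensor_tmul, assoc_tmul, LinearMap.lTensor_tmul, twistRight_tmul,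
        LinearMap.comp_apply, TensorProduct.mk_apply]
      generalize ψM (b ⊗ₜ[k] m) = s
      induction s using TensorProduct.induction_on with
      | zero => simp
      | add x y hx hy => simp only [add_tmul, map_add, hx, hy]
      | tmul m d => simp [hN.mul_act]

/-- This is the commutation rule inside the module: acting by `a` and then by `b` equals acting by
the exchanged pair ψ(b ⊗ a). -/
lemma IsTwist.twistRight_act (h : IsTwist eB mB lM ψA ψM) (b : B) (a : A) (z : M ⊗[k] N) :
    twistRight lN ψM b ((lM ∘ₗ TensorProduct.mk k A M a).rTensor N z) =
      twist lM lN ψM (ψA (b ⊗ₜ[k] a) ⊗ₜ[k] z) := by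
  induction z using TensorProduct.induction_on with
  | zero => simp
  | add x y hx hy => simp only [map_add, tmul_add, hx, hy]
  | tmul v w =>
    rw [LinearMap.rTensor_tmul, twistRight_tmul, LinearMap.comp_apply, TensorProduct.mk_apply,
      h.act]
    generalize ψA (b ⊗ₜ[k] a) = s
    induction s using TensorProduct.induction_on with
    | zero => simp
    | add x y hx hy => simp only [add_tmul, map_add, hx, hy]
    | tmul a c =>
      rw [twist_tmul, twistRight_tmul, LinearMap.lTensor_tmul, LinearMap.comp_apply,
        LinearMap.flip_apply, TensorProduct.mk_apply]
      generalize ψM (c ⊗ₜ[k] v) = s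
      induction s using TensorProduct.induction_on with
      | zero => simp
      | add x y hx hy => simp only [add_tmul, tmul_add, map_add, hx, hy]
      | tmul m d => simp

lemma twistRight_one (h : ∀ v, ψM (eB ⊗ₜ[k] v) = v ⊗ₜ[k] eB) (hN : IsAction eB mB lN)
    (z : M ⊗[k] N) : twistRight lN ψM eB z = z := by
  induction z using TensorProduct.induction_on with
  | zero => simp
  | add x y hx hy => simp only [map_add, hx, hy]
  | tmul v w => simp [twistRight_tmul, h, hN.one_act]

/-- The twisted tensor product acts on the twisted external product. -/
lemma IsTwist.isAction (h : IsTwist eB mB lM ψA ψM) (hM : IsAction eA mA lM)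
    (hN : IsAction eB mB lN) :
    IsAction (eA ⊗ₜ[k] eB) (twist mA mB ψA) (twist lM lN ψM) where
  one_act z := by
    rw [twist_tmul, twistRight_one h.one hN]
    have : lM ∘ₗ TensorProduct.mk k A M eA = LinearMap.id := by ext v; exact hM.one_act v
    rw [this, LinearMap.rTensor_id_apply]
  mul_act x y z := by
    have hr : ∀ a a', (lM ∘ₗ TensorProduct.mk k A M (mA (a ⊗ₜ[k] a'))) =
        (lM ∘ₗ TensorProduct.mk k A M a) ∘ₗ (lM ∘ₗ TensorProduct.mk k A M a') := by
      intro a a'; ext v; exact hM.mul_act a a' v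
    induction x using TensorProduct.induction_on with
    | zero => simp
    | add x₁ x₂ h₁ h₂ => simp only [map_add, add_tmul, h₁, h₂]
    | tmul a b =>
      induction y using TensorProduct.induction_on with
      | zero => simp
      | add y₁ y₂ h₁ h₂ => simp only [map_add, add_tmul, tmul_add, h₁, h₂]
      | tmul a' b' =>
        -- The only reordering is of b past the action of a', which produces exactly the tensor ψ(b
        -- ⊗ a') occurring in the twisted product; the outer a and b' then merge by the two module
        -- axioms.
        rw [twist_tmul lM lN ψM a b, twist_tmul lM lN ψM a' b', h.twistRight_act,
          twist_tmul mA mB ψA, twistRight_tmul]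
        generalize ψA (b ⊗ₜ[k] a') = s
        induction s using TensorProduct.induction_on with
        | zero => simp
        | add x y hx hy => simp only [add_tmul, map_add, hx, hy]
        | tmul c d =>
          simp only [assoc_tmul, LinearMap.lTensor_tmul, LinearMap.rTensor_tmul,
            LinearMap.comp_apply, TensorProduct.mk_apply, twist_tmul, hr,
            LinearMap.rTensor_comp, h.twistRight_mul hN]

lemma twist_mul_one (hA : ∀ a, mA (a ⊗ₜ[k] eA) = a) (hB : ∀ b, mB (b ⊗ₜ[k] eB) = b)
    (hψ : ∀ b, ψA (b ⊗ₜ[k] eA) = eA ⊗ₜ[k] b) (x : A ⊗[k] B) :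
    twist mA mB ψA (x ⊗ₜ[k] (eA ⊗ₜ[k] eB)) = x := by
  induction x using TensorProduct.induction_on with
  | zero => simp
  | add x y hx hy => simp only [map_add, add_tmul, hx, hy]
  | tmul a b => simp [twist_tmul, twistRight_tmul, hψ, hA, hB]

/-- The condition `IsTwist.act` follows from a relation between operators on `A ⊗ M ⊗ B`. -/
lemma twist_act_of_operators {X : Module.End k (M ⊗[k] B)} {Y : Module.End k (A ⊗[k] B)}
    {X' Y' : Module.End k ((A ⊗[k] M) ⊗[k] B)}
    (h : X ∘ₗ lM.rTensor B = lM.rTensor B ∘ₗ (X' * Y'))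
    (hX : ∀ a, X' ∘ₗ (TensorProduct.mk k A M a).rTensor B =
      (TensorProduct.mk k A M a).rTensor B ∘ₗ X)
    (hY : ∀ v, Y' ∘ₗ ((TensorProduct.mk k A M).flip v).rTensor B =
      ((TensorProduct.mk k A M).flip v).rTensor B ∘ₗ Y) (b : B) (a : A) (v : M) :
    X (lM (a ⊗ₜ[k] v) ⊗ₜ[k] b) = lM.rTensor B ((TensorProduct.assoc k A M B).symm
      (((X ∘ₗ (TensorProduct.comm k B M).toLinearMap) ∘ₗ
        (TensorProduct.mk k B M).flip v).lTensor A (Y (a ⊗ₜ[k] b)))) := by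
  have e₁ := LinearMap.congr_fun h ((a ⊗ₜ[k] v) ⊗ₜ[k] b)
  have e₂ := LinearMap.congr_fun (hY v) (a ⊗ₜ[k] b)
  simp only [LinearMap.comp_apply, LinearMap.rTensor_tmul, Module.End.mul_apply,
    LinearMap.flip_apply, TensorProduct.mk_apply] at e₁ e₂
  rw [e₁, e₂]
  congr 1
  generalize Y (a ⊗ₜ[k] b) = s
  induction s using TensorProduct.induction_on with
  | zero => simp
  | add x y hx hy => simp only [map_add, hx, hy]
  | tmul c d =>
    have e₃ := LinearMap.congr_fun (hX c) (v ⊗ₜ[k] d)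
    simp only [LinearMap.comp_apply, LinearMap.rTensor_tmul, TensorProduct.mk_apply,
      LinearMap.flip_apply, LinearMap.lTensor_tmul, LinearEquiv.coe_coe, comm_tmul] at e₃ ⊢
    rw [e₃]
    generalize X (v ⊗ₜ[k] d) = s
    induction s using TensorProduct.induction_on with
    | zero => simp
    | add x y hx hy => simp only [map_add, tmul_add, hx, hy]
    | tmul m d => simp

/-- The condition `IsTwist.mul` follows from a relation between operators on `M ⊗ B ⊗ B`. -/
lemma twist_mul_of_operators {X : Module.End k (M ⊗[k] B)}
    {X₁ X₂ : Module.End k (M ⊗[k] (B ⊗[k] B))}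
    (h : X ∘ₗ mB.lTensor M = mB.lTensor M ∘ₗ (X₁ * X₂))
    (h₁ : ∀ b, X₁ ∘ₗ ((TensorProduct.mk k B B).flip b).lTensor M =
      ((TensorProduct.mk k B B).flip b).lTensor M ∘ₗ X)
    (h₂ : ∀ b, X₂ ∘ₗ (TensorProduct.mk k B B b).lTensor M =
      (TensorProduct.mk k B B b).lTensor M ∘ₗ X) (b b' : B) (v : M) :
    X (v ⊗ₜ[k] mB (b ⊗ₜ[k] b')) = mB.lTensor M (TensorProduct.assoc k M B B
      (((X ∘ₗ (TensorProduct.comm k B M).toLinearMap) ∘ₗ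
        TensorProduct.mk k B M b).rTensor B (X (v ⊗ₜ[k] b')))) := by
  have e₁ := LinearMap.congr_fun h (v ⊗ₜ[k] (b ⊗ₜ[k] b'))
  have e₂ := LinearMap.congr_fun (h₂ b) (v ⊗ₜ[k] b')
  simp only [LinearMap.comp_apply, LinearMap.lTensor_tmul, Module.End.mul_apply,
    TensorProduct.mk_apply] at e₁ e₂
  rw [e₁, e₂]
  congr 1
  generalize X (v ⊗ₜ[k] b') = s
  induction s using TensorProduct.induction_on with
  | zero => simp
  | add x y hx hy => simp only [map_add, hx, hy]
  | tmul m d =>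
    have e₃ := LinearMap.congr_fun (h₁ d) (m ⊗ₜ[k] b)
    simp only [LinearMap.comp_apply, LinearMap.lTensor_tmul, TensorProduct.mk_apply,
      LinearMap.flip_apply, LinearMap.rTensor_tmul, LinearEquiv.coe_coe, comm_tmul] at e₃ ⊢
    rw [e₃]
    generalize X (m ⊗ₜ[k] b) = s
    induction s using TensorProduct.induction_on with
    | zero => simp
    | add x y hx hy => simp only [map_add, add_tmul, hx, hy]
    | tmul m d => simp

end Twisted

/-! ### Equivariance -/

section Equivariant

variable {k H V W Z V' W' : Type*} [Field k] [Ring H] [HopfAlgebra k H]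
  [AddCommGroup V] [Module k V] [AddCommGroup W] [Module k W] [AddCommGroup Z] [Module k Z]
  [AddCommGroup V'] [Module k V'] [AddCommGroup W'] [Module k W']

/-- The diagonal action on a tensor product. -/
def diag (α : H →ₗ[k] Module.End k V) (β : H →ₗ[k] Module.End k W) :
    H →ₗ[k] Module.End k (V ⊗[k] W) :=
  TensorProduct.map₂ α β ∘ₗ Coalgebra.comul

lemma diag_eq (α : H →ₗ[k] Module.End k V) (β : H →ₗ[k] Module.End k W) :
    diag α β = cv (onLeft W α) (onRight V β) :=
  LinearMap.ext fun _ => map₂_eq_sw _ _ _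

/-- `f` commutes with the actions `α` and `β`. -/
def Equivar (α : H →ₗ[k] Module.End k V) (β : H →ₗ[k] Module.End k W) (f : V →ₗ[k] W) : Prop :=
  ∀ h, f ∘ₗ α h = β h ∘ₗ f

variable {α : H →ₗ[k] Module.End k V} {β : H →ₗ[k] Module.End k W}
  {γ : H →ₗ[k] Module.End k Z} {α' : H →ₗ[k] Module.End k V'} {β' : H →ₗ[k] Module.End k W'}

lemma Equivar.comp {g : W →ₗ[k] Z} {f : V →ₗ[k] W} (hg : Equivar β γ g) (hf : Equivar α β f) :
    Equivar α γ (g ∘ₗ f) := fun h => by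
  rw [LinearMap.comp_assoc, hf h, ← LinearMap.comp_assoc, hg h, LinearMap.comp_assoc]

lemma Equivar.id : Equivar α α (LinearMap.id) := fun _ => rfl

lemma Equivar.map {f : V →ₗ[k] V'} {g : W →ₗ[k] W'} (hf : Equivar α α' f)
    (hg : Equivar β β' g) : Equivar (diag α β) (diag α' β') (TensorProduct.map f g) := by
  intro h
  rw [diag_eq, diag_eq]
  refine cv_intertwine _ (fun a => ?_) (fun a => ?_) h
  · ext v w; simpa using congrArg (· ⊗ₜ[k] g w) (LinearMap.congr_fun (hf a) v)
  · ext v w; simpa using congrArg (f v ⊗ₜ[k] ·) (LinearMap.congr_fun (hg a) w)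

lemma Equivar.symm {f : V ≃ₗ[k] W} (hf : Equivar α β f.toLinearMap) :
    Equivar β α f.symm.toLinearMap := fun h => by
  ext w
  have := LinearMap.congr_fun (hf h) (f.symm w)
  simp only [LinearMap.comp_apply, LinearEquiv.coe_coe, LinearEquiv.apply_symm_apply] at this
  simp [← this]

lemma onLeft_cv (s t : H →ₗ[k] Module.End k V) :
    onLeft W (cv s t) = cv (onLeft W s) (onLeft W t) := by
  ext1 h
  change LinearMap.rTensorHom W (sw _ _ _) = sw _ _ _
  generalize (Coalgebra.comul h : H ⊗[k] H) = x
  induction x using TensorProduct.induction_on with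
  | zero => simp
  | add x y hx hy => simp only [map_add, hx, hy]
  | tmul a b => ext; simp

lemma onRight_cv (s t : H →ₗ[k] Module.End k W) :
    onRight V (cv s t) = cv (onRight V s) (onRight V t) := by
  ext1 h
  change LinearMap.lTensorHom V (sw _ _ _) = sw _ _ _
  generalize (Coalgebra.comul h : H ⊗[k] H) = x
  induction x using TensorProduct.induction_on with
  | zero => simp
  | add x y hx hy => simp only [map_add, hx, hy]
  | tmul a b => ext; simp

/-- Both diagonal actions are triple convolutions of the same three strands, so coassociativity in
the form `cv_assoc` identifies them. -/
lemma equivar_assoc : Equivar (diag (diag α β) γ) (diag α (diag β γ))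
    (TensorProduct.assoc k V W Z).toLinearMap := by
  have e₁ : diag (diag α β) γ = cv (E := Module.End k ((V ⊗[k] W) ⊗[k] Z))
      (cv (onLeft Z (onLeft W α)) (onLeft Z (onRight V β))) (onRight (V ⊗[k] W) γ) := by
    rw [diag_eq, diag_eq, onLeft_cv]
  have e₂ : diag α (diag β γ) = cv (E := Module.End k (V ⊗[k] (W ⊗[k] Z)))
      (onLeft (W ⊗[k] Z) α) (cv (onRight V (onLeft Z β)) (onRight V (onRight W γ))) := by
    rw [diag_eq, diag_eq, onRight_cv]
  intro h
  rw [e₁, e₂, cv_assoc]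
  refine cv_intertwine _ (fun a => ?_) (fun a => cv_intertwine _ (fun b => ?_) (fun b => ?_) a) h
  all_goals ext; simp

lemma Equivar.middle {A B M N : Type*} [AddCommGroup A] [Module k A] [AddCommGroup B]
    [Module k B] [AddCommGroup M] [Module k M] [AddCommGroup N] [Module k N]
    {a : H →ₗ[k] Module.End k A} {b : H →ₗ[k] Module.End k B} {m : H →ₗ[k] Module.End k M}
    {n : H →ₗ[k] Module.End k N} {ψ : B ⊗[k] M →ₗ[k] M ⊗[k] B}
    (hψ : Equivar (diag b m) (diag m b) ψ) :
    Equivar (diag (diag a b) (diag m n)) (diag (diag a m) (diag b n)) (middle A N ψ) :=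
  equivar_assoc.symm.comp ((Equivar.map Equivar.id
    (equivar_assoc.comp ((Equivar.map hψ Equivar.id).comp equivar_assoc.symm))).comp equivar_assoc)

lemma Equivar.twist {A B M N : Type*} [AddCommGroup A] [Module k A] [AddCommGroup B]
    [Module k B] [AddCommGroup M] [Module k M] [AddCommGroup N] [Module k N]
    {a : H →ₗ[k] Module.End k A} {b : H →ₗ[k] Module.End k B} {m : H →ₗ[k] Module.End k M}
    {n : H →ₗ[k] Module.End k N} {ψ : B ⊗[k] M →ₗ[k] M ⊗[k] B}
    {lM : A ⊗[k] M →ₗ[k] M} {lN : B ⊗[k] N →ₗ[k] N}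
    (hM : Equivar (diag a m) m lM) (hN : Equivar (diag b n) n lN)
    (hψ : Equivar (diag b m) (diag m b) ψ) :
    Equivar (diag (diag a b) (diag m n)) (diag m n) (twist lM lN ψ) :=
  (Equivar.map hM hN).comp (Equivar.middle hψ)

/-- Moving a factor past another by an operator `X` is equivariant if `X` exchanges the two orders
of the actions. -/
lemma equivar_comp_comm {X : Module.End k (V ⊗[k] W)}
    (hX : ∀ h, cv (onLeft W α) (onRight V β) h * X = X * cv (onRight V β) (onLeft W α) h) :
    Equivar (diag β α) (diag α β) (X ∘ₗ (TensorProduct.comm k W V).toLinearMap) := by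
  intro h
  have e : (TensorProduct.comm k W V).toLinearMap ∘ₗ diag β α h =
      cv (onRight V β) (onLeft W α) h ∘ₗ (TensorProduct.comm k W V).toLinearMap := by
    rw [diag_eq]
    refine cv_intertwine _ (fun a => ?_) (fun a => ?_) h
    all_goals ext; simp
  rw [LinearMap.comp_assoc, e, ← LinearMap.comp_assoc, ← Module.End.mul_eq_comp X, ← hX, diag_eq]
  rfl

end Equivariant

/-! ### Braided tensor products -/

section Braided

lemma Equivar.rTensor {k H V W : Type*} (Z : Type*) [Field k] [Ring H] [HopfAlgebra k H]
    [AddCommGroup V] [Module k V] [AddCommGroup W] [Module k W] [AddCommGroup Z] [Module k Z]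
    {α : H →ₗ[k] Module.End k V} {β : H →ₗ[k] Module.End k W} {f : V →ₗ[k] W}
    (hf : Equivar α β f) : Equivar (onLeft Z α) (onLeft Z β) (f.rTensor Z) := fun h => by
  change _ ∘ₗ LinearMap.rTensor _ _ = LinearMap.rTensor _ _ ∘ₗ _
  rw [← LinearMap.rTensor_comp, ← LinearMap.rTensor_comp, hf h]

lemma Equivar.lTensor {k H V W : Type*} (Z : Type*) [Field k] [Ring H] [HopfAlgebra k H]
    [AddCommGroup V] [Module k V] [AddCommGroup W] [Module k W] [AddCommGroup Z] [Module k Z]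
    {α : H →ₗ[k] Module.End k V} {β : H →ₗ[k] Module.End k W} {f : V →ₗ[k] W}
    (hf : Equivar α β f) : Equivar (onRight Z α) (onRight Z β) (f.lTensor Z) := fun h => by
  change _ ∘ₗ LinearMap.lTensor _ _ = LinearMap.lTensor _ _ ∘ₗ _
  rw [← LinearMap.lTensor_comp, ← LinearMap.lTensor_comp, hf h]

variable {k H : Type u} [Field k] [Ring H] [HopfAlgebra k H] {Q : QuasitriangularStructure k H}

lemma isStrand_act (V : HopfRightModule k H) : IsStrand V.act := ⟨V.act_one, V.act_mul⟩

lemma braiding_eq (V W : HopfRightModule k H) : HopfRightModule.braiding Q V W =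
    br Q (onLeft V.carrier W.act) (onRight W.carrier V.act) ∘ₗ
      (TensorProduct.comm k V.carrier W.carrier).toLinearMap := by
  rw [HopfRightModule.braiding, map₂_eq_sw]; rfl

lemma equivar_braiding (V W : HopfRightModule k H) :
    Equivar (diag V.act W.act) (diag W.act V.act) (HopfRightModule.braiding Q V W) := by
  rw [braiding_eq]
  exact equivar_comp_comm (cv_mul_br (isStrand_act W).onLeft (isStrand_act V).onRight
    (comm_onLeft_onRight _ _))

/-- Inserting an invariant vector turns its strand into the trivial one, against which the braiding
is 1. -/
lemma braiding_tmul_of_invariant_left (V W : HopfRightModule k H) {e : V.carrier}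
    (he : ∀ h, V.act h e = Coalgebra.counit (R := k) h • e) (w : W.carrier) :
    HopfRightModule.braiding Q V W (e ⊗ₜ[k] w) = w ⊗ₜ[k] e := by
  have h := sw_intertwine ((TensorProduct.mk k W.carrier V.carrier).flip e) (s := W.act)
    (t := triv) (s' := onLeft V.carrier W.act) (t' := onRight W.carrier V.act)
    (fun _ => rfl) (fun h => by ext w; simp [triv_apply, he, Algebra.algebraMap_eq_smul_one])
    Q.R
  have h' := br_triv_right (Q := Q) (isStrand_act W)
  rw [br] at h'
  rw [h'] at h
  rw [braiding_eq]
  exact (LinearMap.congr_fun h w).symm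

lemma braiding_tmul_of_invariant_right (V W : HopfRightModule k H) {e : W.carrier}
    (he : ∀ h, W.act h e = Coalgebra.counit (R := k) h • e) (v : V.carrier) :
    HopfRightModule.braiding Q V W (v ⊗ₜ[k] e) = e ⊗ₜ[k] v := by
  have h := sw_intertwine (TensorProduct.mk k W.carrier V.carrier e) (s := triv)
    (t := V.act) (s' := onLeft V.carrier W.act) (t' := onRight W.carrier V.act)
    (fun h => by
      ext w; simp [triv_apply, he, Algebra.algebraMap_eq_smul_one, TensorProduct.smul_tmul'])
    (fun _ => rfl) Q.R
  have h' := br_triv_left (Q := Q) (isStrand_act V)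
  rw [br] at h'
  rw [h'] at h
  rw [braiding_eq]
  exact (LinearMap.congr_fun h v).symm

/-- An equivariant map pulls the strand of its target back to the convolution of the strands of its
source. The hexagon splits the braiding with that convolution into two braidings, which are the two
successive moves required. -/
lemma isTwist_braiding (A B M : HopfRightModule k H) {eB : B.carrier}
    {mB : B.carrier ⊗[k] B.carrier →ₗ[k] B.carrier}
    {lM : A.carrier ⊗[k] M.carrier →ₗ[k] M.carrier}
    (he : ∀ h, B.act h eB = Coalgebra.counit (R := k) h • eB)
    (hm : Equivar (diag B.act B.act) B.act mB) (hl : Equivar (diag A.act M.act) M.act lM) :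
    IsTwist eB mB lM (HopfRightModule.braiding Q B A) (HopfRightModule.braiding Q B M) where
  one := braiding_tmul_of_invariant_left B M he
  act b a v := by
    rw [braiding_eq, braiding_eq]
    refine twist_act_of_operators
      (X' := br Q (onLeft B.carrier (onRight A.carrier M.act)) (onRight _ B.act))
      (Y' := br Q (onLeft B.carrier (onLeft M.carrier A.act)) (onRight _ B.act))
      ?_ ?_ ?_ b a v
    · rw [← br_cv_left ((comm_onLeft_onRight _ _).onLeft) (comm_onLeft_onRight _ _)
        (isStrand_act B).onRight, ← onLeft_cv, ← diag_eq]
      refine (sw_intertwine _ (fun h => ?_) (fun h => ?_) Q.R).symm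
      · exact hl.rTensor B.carrier h
      · ext; simp
    · intro a
      refine (sw_intertwine _ (fun h => ?_) (fun h => ?_) Q.R).symm <;> ext <;> simp
    · intro v
      refine (sw_intertwine _ (fun h => ?_) (fun h => ?_) Q.R).symm <;> ext <;> simp
  mul b b' v := by
    rw [braiding_eq]
    refine twist_mul_of_operators
      (X₁ := br Q (onLeft _ M.act) (onRight M.carrier (onLeft B.carrier B.act)))
      (X₂ := br Q (onLeft _ M.act) (onRight M.carrier (onRight B.carrier B.act)))
      ?_ ?_ ?_ b b' v
    · rw [← br_cv_right (isStrand_act M).onLeft (comm_onLeft_onRight _ _), ← onRight_cv,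
        ← diag_eq]
      refine (sw_intertwine _ (fun h => ?_) (fun h => ?_) Q.R).symm
      · ext; simp
      · exact hm.lTensor M.carrier h
    · intro a
      refine (sw_intertwine _ (fun h => ?_) (fun h => ?_) Q.R).symm <;> ext <;> simp
    · intro v
      refine (sw_intertwine _ (fun h => ?_) (fun h => ?_) Q.R).symm <;> ext <;> simp

lemma _root_.PreModuleAlgebra.IsModuleAlgebra.isAction {A : PreModuleAlgebra k H}
    (hA : A.IsModuleAlgebra) : IsAction A.one A.mul A.mul :=
  ⟨hA.one_mul, hA.mul_assoc⟩

lemma _root_.PreModuleAlgebra.IsModuleAlgebra.equivar {A : PreModuleAlgebra k H}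
    (hA : A.IsModuleAlgebra) : Equivar (diag A.act A.act) A.act A.mul :=
  fun h => TensorProduct.ext' fun x y => (hA.mul_act h x y).symm

lemma _root_.PreEquivariantModule.IsEquivariantModule.isAction {A : PreModuleAlgebra k H}
    {M : PreEquivariantModule A} (hM : M.IsEquivariantModule) :
    IsAction A.one A.mul M.lact :=
  ⟨hM.one_lact, hM.mul_lact⟩

lemma _root_.PreEquivariantModule.IsEquivariantModule.equivar {A : PreModuleAlgebra k H}
    {M : PreEquivariantModule A} (hM : M.IsEquivariantModule) :
    Equivar (diag A.act M.act) M.act M.lact :=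
  fun h => TensorProduct.ext' fun x y => (hM.lact_act h x y).symm

lemma isModuleAlgebra_of {A : PreModuleAlgebra k H} (h : IsAction A.one A.mul A.mul)
    (h₁ : ∀ x, A.mul (x ⊗ₜ[k] A.one) = x) (h₂ : Equivar (diag A.act A.act) A.act A.mul)
    (h₃ : ∀ h, A.act h A.one = Coalgebra.counit (R := k) h • A.one) : A.IsModuleAlgebra :=
  ⟨h.mul_act, h.one_act, h₁, fun h x y => (LinearMap.congr_fun (h₂ h) (x ⊗ₜ[k] y)).symm, h₃⟩

lemma isEquivariantModule_of {A : PreModuleAlgebra k H} {M : PreEquivariantModule A}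
    (h : IsAction A.one A.mul M.lact) (h₂ : Equivar (diag A.act M.act) M.act M.lact) :
    M.IsEquivariantModule :=
  ⟨h.one_act, h.mul_act, fun h x y => (LinearMap.congr_fun (h₂ h) (x ⊗ₜ[k] y)).symm⟩

lemma diag_tmul_of_invariant {V W : Type*} [AddCommGroup V] [Module k V] [AddCommGroup W]
    [Module k W] (α : H →ₗ[k] Module.End k V) (β : H →ₗ[k] Module.End k W) {x : V} {y : W}
    (hx : ∀ h, α h x = Coalgebra.counit (R := k) h • x)
    (hy : ∀ h, β h y = Coalgebra.counit (R := k) h • y) (h : H) :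
    diag α β h (x ⊗ₜ[k] y) = Coalgebra.counit (R := k) h • (x ⊗ₜ[k] y) := by
  have e : ∀ t : H ⊗[k] H, TensorProduct.map₂ α β t (x ⊗ₜ[k] y) =
      Coalgebra.counit (R := k) (TensorProduct.lid k H ((Coalgebra.counit (R := k)).rTensor H t)) •
        (x ⊗ₜ[k] y) := by
    intro t
    induction t using TensorProduct.induction_on with
    | zero => simp
    | add s t hs ht => simp only [map_add, LinearMap.add_apply, hs, ht, add_smul]
    | tmul a b => simp [hx, hy, smul_tmul', smul_smul, mul_comm]
  change TensorProduct.map₂ α β (Coalgebra.comul h) _ = _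
  rw [e, Coalgebra.rTensor_counit_comul]
  simp

/-- The product unfolds to the twisted product for the braiding of `B` past `A`; invariance of the
units makes the braiding trivial on them. -/
theorem isModuleAlgebra_braidedTensor {A B : PreModuleAlgebra k H} (hA : A.IsModuleAlgebra)
    (hB : B.IsModuleAlgebra) : (A.braidedTensor Q B).IsModuleAlgebra :=
  isModuleAlgebra_of
    ((isTwist_braiding A.toHopfRightModule B.toHopfRightModule A.toHopfRightModule hB.one_act
      hB.equivar hA.equivar).isAction hA.isAction hB.isAction)
    (twist_mul_one hA.mul_one hB.mul_one
      (braiding_tmul_of_invariant_right B.toHopfRightModule A.toHopfRightModule hA.one_act))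
    (Equivar.twist hA.equivar hB.equivar
      (equivar_braiding B.toHopfRightModule A.toHopfRightModule))
    (diag_tmul_of_invariant A.act B.act hA.one_act hB.one_act)

theorem isEquivariantModule_braidedExternal {A B : PreModuleAlgebra k H}
    (hB : B.IsModuleAlgebra) {M : PreEquivariantModule A}
    {N : PreEquivariantModule B} (hM : M.IsEquivariantModule) (hN : N.IsEquivariantModule) :
    (M.braidedExternal Q N).IsEquivariantModule :=
  isEquivariantModule_of
    ((isTwist_braiding A.toHopfRightModule B.toHopfRightModule M.toHopfRightModule hB.one_act
      hB.equivar hM.equivar).isAction hM.isAction hN.isAction)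
    (Equivar.twist hM.equivar hN.equivar
      (equivar_braiding B.toHopfRightModule M.toHopfRightModule))

lemma equivar_mul'_of_counit (α : H →ₗ[k] Module.End k k)
    (hα : ∀ h x, α h x = Coalgebra.counit (R := k) h • x) :
    Equivar (diag α α) α (LinearMap.mul' k k) := fun h => TensorProduct.ext' fun x y => by
  rw [LinearMap.comp_apply, diag_tmul_of_invariant α α (fun a => hα a x) (fun a => hα a y),
    map_smul, LinearMap.comp_apply, hα]

lemma isAction_mul' : IsAction (1 : k) (LinearMap.mul' k k) (LinearMap.mul' k k) :=
  ⟨fun v => by simp, fun a b v => by simp [mul_assoc]⟩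

theorem isModuleAlgebra_trivial : (PreModuleAlgebra.trivial k H).IsModuleAlgebra :=
  isModuleAlgebra_of isAction_mul' (mul_one (M := k))
    (equivar_mul'_of_counit _ fun _ _ => rfl) (fun _ => rfl)

theorem isEquivariantModule_trivial : (PreEquivariantModule.trivial k H).IsEquivariantModule :=
  isEquivariantModule_of isAction_mul' (equivar_mul'_of_counit _ fun _ _ => rfl)

end Braided

/-! ### Naturality of the composite operators -/

section Operators

variable {k H : Type u} [Field k] [Ring H] [HopfAlgebra k H] {Q : QuasitriangularStructure k H}

section Intertwine

variable {V W : Type*} [AddCommGroup V] [Module k V] [AddCommGroup W] [Module k W]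
  (p : V →ₗ[k] W) {r l r' l' x : H →ₗ[k] Module.End k V} {s m s' m' y : H →ₗ[k] Module.End k W}

lemma fus_intertwine (hl : ∀ h, p ∘ₗ l h = m h ∘ₗ p) (hr' : ∀ h, p ∘ₗ r' h = s' h ∘ₗ p)
    (hl' : ∀ h, p ∘ₗ l' h = m' h ∘ₗ p) : p ∘ₗ fus Q l r' l' = fus Q m s' m' ∘ₗ p := by
  rw [fus, fus, Module.End.mul_eq_comp, Module.End.mul_eq_comp, ← LinearMap.comp_assoc,
    br, sw_intertwine p hl' hl, LinearMap.comp_assoc, br, sw_intertwine p hr' hl,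
    LinearMap.comp_assoc]
  rfl

lemma chord_intertwine (hr : ∀ h, p ∘ₗ r h = s h ∘ₗ p) (hl : ∀ h, p ∘ₗ l h = m h ∘ₗ p)
    (hx : ∀ h, p ∘ₗ x h = y h ∘ₗ p) : p ∘ₗ chord Q r l x = chord Q s m y ∘ₗ p := by
  rw [chord, chord, Module.End.mul_eq_comp, Module.End.mul_eq_comp, ← LinearMap.comp_assoc,
    brInv, sw_intertwine p hr hx, LinearMap.comp_assoc, br, sw_intertwine p hx hl,
    LinearMap.comp_assoc]
  rfl

lemma exch_intertwine (hr : ∀ h, p ∘ₗ r h = s h ∘ₗ p) (hl : ∀ h, p ∘ₗ l h = m h ∘ₗ p)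
    (hr' : ∀ h, p ∘ₗ r' h = s' h ∘ₗ p) (hl' : ∀ h, p ∘ₗ l' h = m' h ∘ₗ p) :
    p ∘ₗ exch Q r l r' l' = exch Q s m s' m' ∘ₗ p := by
  rw [exch, exch]
  simp only [Module.End.mul_eq_comp]
  rw [← LinearMap.comp_assoc, brInv, sw_intertwine p hr' hl, LinearMap.comp_assoc,
    ← LinearMap.comp_assoc _ _ p, br, sw_intertwine p hl hl', LinearMap.comp_assoc,
    ← LinearMap.comp_assoc _ _ p, br, sw_intertwine p hr hr', LinearMap.comp_assoc,
    br, sw_intertwine p hr hl']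
  rfl

end Intertwine

variable {E : Type*} [Ring E] [Algebra k E]

/-- Used to slide an operator through a long convolution by treating its factors separately. -/
lemma mul_cv {x : E} {s t s' t' : H →ₗ[k] E} (hs : ∀ h, x * s h = s' h * x)
    (ht : ∀ h, x * t h = t' h * x) (h : H) : x * cv s t h = cv s' t' h * x := by
  change x * sw s t _ = sw s' t' _ * x
  generalize (Coalgebra.comul h : H ⊗[k] H) = y
  induction y using TensorProduct.induction_on with
  | zero => simp
  | add y z hy hz => simp only [map_add, mul_add, add_mul, hy, hz]
  | tmul a b => rw [sw_tmul, sw_tmul, ← mul_assoc, hs, mul_assoc, ht, mul_assoc]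

lemma br_mul_comm {s t u : H →ₗ[k] E} (hs : Comm u s) (ht : Comm u t) (h : H) :
    br Q s t * u h = u h * br Q s t := (Commute.br_right (hs h) (ht h)).symm.eq

lemma brInv_mul_comm {s t u : H →ₗ[k] E} (hs : Comm u s) (ht : Comm u t) (h : H) :
    brInv Q s t * u h = u h * brInv Q s t := (Commute.brInv_right (hs h) (ht h)).symm.eq

variable {σ : Fin 4 → H →ₗ[k] E} (hσ : StrandFamily σ)

include hσ

/-- The diagonal action reads r₁ l₁ r₂ l₂. The two letters of the fusion operator carry l₁ past r₂
and then past l₂, giving r₁ r₂ l₂ l₁, the order that ⋆ absorbs. -/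
lemma fus_mul_cv (h : H) :
    fus Q (σ 1) (σ 2) (σ 3) * cv (cv (σ 0) (σ 1)) (cv (σ 2) (σ 3)) h =
      cv (cv (σ 0) (σ 2)) (cv (σ 3) (σ 1)) h * fus Q (σ 1) (σ 2) (σ 3) := by
  have c : ∀ i j, i ≠ j → Comm (σ i) (σ j) := hσ.comm
  have b : ∀ i j, i ≠ j → ∀ h, br Q (σ i) (σ j) * cv (σ j) (σ i) h =
      cv (σ i) (σ j) h * br Q (σ i) (σ j) :=
    fun i j e h => (cv_mul_br (hσ.strand i) (hσ.strand j) (c i j e) h).symm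
  rw [fus, cv_assoc (σ 0) (σ 1), ← cv_assoc (σ 1) (σ 2), mul_assoc,
    mul_cv (br_mul_comm (c 0 2 (by decide)) (c 0 1 (by decide)))
      (mul_cv (b 2 1 (by decide)) (br_mul_comm (c 3 2 (by decide)) (c 3 1 (by decide)))),
    cv_assoc (σ 2), ← mul_assoc,
    mul_cv (br_mul_comm (c 0 3 (by decide)) (c 0 1 (by decide)))
      (mul_cv (br_mul_comm (c 2 3 (by decide)) (c 2 1 (by decide))) (b 3 1 (by decide))),
    cv_assoc (σ 0), mul_assoc]

/-- Each of the four letters moves one strand of one factor past one strand of the other, so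
together they exchange the two coadjoint actions. -/
lemma exch_mul_cv (h : H) :
    cv (cv (σ 0) (σ 1)) (cv (σ 2) (σ 3)) h * exch Q (σ 0) (σ 1) (σ 2) (σ 3) =
      exch Q (σ 0) (σ 1) (σ 2) (σ 3) * cv (cv (σ 2) (σ 3)) (cv (σ 0) (σ 1)) h := by
  have c : ∀ i j, i ≠ j → Comm (σ i) (σ j) := hσ.comm
  have b : ∀ i j, i ≠ j → ∀ h, br Q (σ i) (σ j) * cv (σ j) (σ i) h =
      cv (σ i) (σ j) h * br Q (σ i) (σ j) :=
    fun i j e h => (cv_mul_br (hσ.strand i) (hσ.strand j) (c i j e) h).symm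
  have b' : ∀ i j, i ≠ j → ∀ h, brInv Q (σ i) (σ j) * cv (σ i) (σ j) h =
      cv (σ j) (σ i) h * brInv Q (σ i) (σ j) :=
    fun i j e h => (cv_mul_brInv (hσ.strand i) (hσ.strand j) (c i j e) h).symm
  symm
  rw [exch, cv_assoc (σ 2) (σ 3), ← cv_assoc (σ 3) (σ 0)]
  simp only [mul_assoc]
  rw [mul_cv (br_mul_comm (c 2 0 (by decide)) (c 2 3 (by decide)))
      (mul_cv (b 0 3 (by decide)) (br_mul_comm (c 1 0 (by decide)) (c 1 3 (by decide)))),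
    cv_assoc (σ 0) (σ 3), ← cv_assoc (σ 2) (σ 0), ← mul_assoc (br Q (σ 0) (σ 2)),
    mul_cv (b 0 2 (by decide)) (mul_cv (br_mul_comm (c 3 0 (by decide)) (c 3 2 (by decide)))
      (br_mul_comm (c 1 0 (by decide)) (c 1 2 (by decide)))), mul_assoc (cv _ _ h),
    ← mul_assoc (br Q (σ 1) (σ 3)),
    mul_cv (mul_cv (br_mul_comm (c 0 1 (by decide)) (c 0 3 (by decide)))
      (br_mul_comm (c 2 1 (by decide)) (c 2 3 (by decide)))) (b 1 3 (by decide)),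
    mul_assoc (cv _ _ h), cv_assoc (σ 0) (σ 2), ← cv_assoc (σ 2) (σ 1),
    ← mul_assoc (brInv Q (σ 2) (σ 1)),
    mul_cv (brInv_mul_comm (c 0 2 (by decide)) (c 0 1 (by decide)))
      (mul_cv (b' 2 1 (by decide)) (brInv_mul_comm (c 3 2 (by decide)) (c 3 1 (by decide)))),
    mul_assoc (cv _ _ h), cv_assoc (σ 1), ← cv_assoc (σ 0)]

end Operators

/-! ### The strands of the restricted dual -/

section Dual

open restrictedDual

variable {k H : Type u} [Field k] [Ring H] [HopfAlgebra k H] {Q : QuasitriangularStructure k H}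

lemma IsRep.cv {E : Type*} [Ring E] [Algebra k E] {l m : H →ₗ[k] E} (hl : IsRep l)
    (hm : IsRep m) (hlm : Comm l m) : IsRep (cv l m) where
  map_one := by rw [cv_apply, Bialgebra.comul_one, sw_one hl.map_one hm.map_one]
  map_mul g h := by
    rw [cv_apply, Bialgebra.comul_mul, cv_apply, cv_apply]
    generalize (Coalgebra.comul g : H ⊗[k] H) = x
    generalize (Coalgebra.comul h : H ⊗[k] H) = y
    induction x using TensorProduct.induction_on with
    | zero => simp
    | add x₁ x₂ h₁ h₂ => simp only [add_mul, map_add, h₁, h₂]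
    | tmul a b =>
      induction y using TensorProduct.induction_on with
      | zero => simp
      | add y₁ y₂ h₁ h₂ => simp only [mul_add, map_add, h₁, h₂]
      | tmul c d =>
        simp only [Algebra.TensorProduct.tmul_mul_tmul, sw_tmul, hl.map_mul, hm.map_mul]
        exact (hlm c b).mul_mul_mul_comm _ _

/-- Both sides are convolution inverses of `cv l m`; this is the fact that S reverses the coproduct.
-/
lemma anti_cv {E : Type*} [Ring E] [Algebra k E] {l m : H →ₗ[k] E} (hl : IsRep l)
    (hm : IsRep m) (hlm : Comm l m) : anti (cv l m) = cv (anti m) (anti l) := by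
  have e : cv (cv (anti m) (anti l)) (cv l m) = triv := by
    rw [cv_assoc, ← cv_assoc (anti l), cv_anti_left hl, cv_triv_left, cv_anti_left hm]
  rw [← cv_triv_right (cv (anti m) (anti l)), ← cv_anti_right (hl.cv hm hlm), ← cv_assoc, e,
    cv_triv_left]

lemma IsRep.onLeft {V W : Type*} [AddCommGroup V] [Module k V] [AddCommGroup W] [Module k W]
    {f : H →ₗ[k] Module.End k V} (hf : IsRep f) : IsRep (onLeft W f) where
  map_one := by ext; simp [hf.map_one]
  map_mul g h := by ext; simp [hf.map_mul]

lemma IsRep.onRight {V W : Type*} [AddCommGroup V] [Module k V] [AddCommGroup W] [Module k W]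
    {f : H →ₗ[k] Module.End k W} (hf : IsRep f) : IsRep (onRight V f) where
  map_one := by ext; simp [hf.map_one]
  map_mul g h := by ext; simp [hf.map_mul]

variable (k H) in
/-- The restricted dual, as a type with its own module structure. -/
def ResDual : Type u := restrictedDual k H

instance : AddCommGroup (ResDual k H) := inferInstanceAs (AddCommGroup (restrictedDual k H))

instance : Module k (ResDual k H) := inferInstanceAs (Module k (restrictedDual k H))

namespace ResDual

/-- The underlying linear form. -/
def val : ResDual k H →ₗ[k] Module.Dual k H := (restrictedDual k H).subtype

lemma ext {φ ψ : ResDual k H} (h : ∀ x, val φ x = val ψ x) : φ = ψ :=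
  Subtype.ext (LinearMap.ext h)

variable (k H)

/-- The right coregular action as a strand. -/
def right : H →ₗ[k] Module.End k (ResDual k H) := coregRight k H

/-- The left coregular action. -/
def left : H →ₗ[k] Module.End k (ResDual k H) := coregLeft k H

/-- The strand of the left coregular action. -/
def leftAnti : H →ₗ[k] Module.End k (ResDual k H) := anti (left k H)

/-- The product `⋆`. -/
def conv : ResDual k H ⊗[k] ResDual k H →ₗ[k] ResDual k H := star k H

/-- The unit. -/
def eps : ResDual k H := (⟨Coalgebra.counit, counit_mem⟩ : restrictedDual k H)

variable {k H}

@[simp] lemma val_right (h x : H) (φ : ResDual k H) : val (right k H h φ) x = val φ (h * x) := rfl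

@[simp] lemma val_left (h x : H) (φ : ResDual k H) : val (left k H h φ) x = val φ (x * h) := rfl

@[simp] lemma val_eps (x : H) : val (eps k H) x = Coalgebra.counit (R := k) x := rfl

lemma val_conv (φ ψ : ResDual k H) (x : H) :
    val (conv k H (φ ⊗ₜ[k] ψ)) x = LinearMap.mul' k k
      (TensorProduct.map (val φ) (val ψ) (Coalgebra.comul x)) := rfl

lemma isStrand_right : IsStrand (right k H) where
  map_one := LinearMap.ext fun φ => ext fun x => by simp
  map_mul g h := LinearMap.ext fun φ => ext fun x => by simp [mul_assoc]

lemma isRep_left : IsRep (left k H) where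
  map_one := LinearMap.ext fun φ => ext fun x => by simp
  map_mul g h := LinearMap.ext fun φ => ext fun x => by simp [mul_assoc]

lemma comm_right_left : Comm (right k H) (left k H) :=
  fun g h => LinearMap.ext fun φ => ext fun x => by simp [mul_assoc]

lemma isStrand_leftAnti : IsStrand (leftAnti k H) := isRep_left.anti

lemma comm_right_leftAnti : Comm (right k H) (leftAnti k H) := comm_right_left.anti_right

variable (k H) in
/-- The two strands of the restricted dual. -/
def strands : Fin 2 → H →ₗ[k] Module.End k (ResDual k H) := ![right k H, leftAnti k H]

lemma strandFamily : StrandFamily (strands k H) where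
  strand i := by
    fin_cases i
    · exact isStrand_right
    · exact isStrand_leftAnti
  comm i j h := by
    fin_cases i <;> fin_cases j
    · exact (h rfl).elim
    · exact comm_right_leftAnti
    · exact comm_right_leftAnti.symm
    · exact (h rfl).elim

variable (k H) in
/-- The right coadjoint action. -/
def coad : H →ₗ[k] Module.End k (ResDual k H) := cv (right k H) (leftAnti k H)

lemma coadjoint_act_apply (h : H) (φ : ResDual k H) :
    (coadjoint k H).act h φ = coad k H h φ := by
  refine ext fun z => ?_
  change val (coadAux k H _ _ : ResDual k H) z =
    val (sw (E := Module.End k (ResDual k H)) (right k H) (leftAnti k H) _ φ) z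
  generalize (Coalgebra.comul h : H ⊗[k] H) = x
  induction x using TensorProduct.induction_on with
  | zero => simp; rfl
  | add x y hx hy => simp only [map_add, LinearMap.add_apply, ← hx, ← hy]; rfl
  | tmul a b => exact congrArg φ.1 (mul_assoc a z _).symm

/-- Since ⋆ is dual to Δ, this is multiplicativity of Δ on a product with h on the left. -/
lemma conv_right (h : H) :
    conv k H ∘ₗ cv (onLeft _ (right k H)) (onRight _ (right k H)) h =
      right k H h ∘ₗ conv k H := by
  refine TensorProduct.ext' fun φ ψ => ext fun x => ?_
  have e : ∀ t : H ⊗[k] H, val (conv k H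
      (sw (E := Module.End k (ResDual k H ⊗[k] ResDual k H)) (onLeft (ResDual k H) (right k H))
        (onRight (ResDual k H) (right k H)) t (φ ⊗ₜ[k] ψ))) x =
      LinearMap.mul' k k (TensorProduct.map (val φ) (val ψ) (t * Coalgebra.comul x)) := by
    intro t
    induction t using TensorProduct.induction_on with
    | zero => simp
    | add s t hs ht => simp only [map_add, LinearMap.add_apply, add_mul, hs, ht]
    | tmul a b =>
      rw [sw_tmul, Module.End.mul_apply, onRight_apply_tmul, onLeft_apply_tmul, val_conv]
      generalize (Coalgebra.comul x : H ⊗[k] H) = y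
      induction y using TensorProduct.induction_on with
      | zero => simp
      | add s t hs ht => simp only [map_add, mul_add, hs, ht]
      | tmul c d => simp
  refine (e _).trans ?_
  rw [← Bialgebra.comul_mul]
  rfl

lemma conv_left (h : H) :
    conv k H ∘ₗ cv (onLeft _ (left k H)) (onRight _ (left k H)) h =
      left k H h ∘ₗ conv k H := by
  refine TensorProduct.ext' fun φ ψ => ext fun x => ?_
  have e : ∀ t : H ⊗[k] H, val (conv k H
      (sw (E := Module.End k (ResDual k H ⊗[k] ResDual k H)) (onLeft (ResDual k H) (left k H))
        (onRight (ResDual k H) (left k H)) t (φ ⊗ₜ[k] ψ))) x =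
      LinearMap.mul' k k (TensorProduct.map (val φ) (val ψ) (Coalgebra.comul x * t)) := by
    intro t
    induction t using TensorProduct.induction_on with
    | zero => simp
    | add s t hs ht => simp only [map_add, LinearMap.add_apply, mul_add, hs, ht]
    | tmul a b =>
      rw [sw_tmul, Module.End.mul_apply, onRight_apply_tmul, onLeft_apply_tmul, val_conv]
      generalize (Coalgebra.comul x : H ⊗[k] H) = y
      induction y using TensorProduct.induction_on with
      | zero => simp
      | add s t hs ht => simp only [map_add, add_mul, hs, ht]
      | tmul c d => simp
  refine (e _).trans ?_
  rw [← Bialgebra.comul_mul]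
  rfl

/-- The antipode interchanges the legs, which is why left strands of a product are convolved in the
order l₂, l₁. -/
lemma conv_leftAnti (h : H) :
    conv k H ∘ₗ cv (onRight _ (leftAnti k H)) (onLeft _ (leftAnti k H)) h =
      leftAnti k H h ∘ₗ conv k H := by
  have e := anti_cv (isRep_left (k := k) (H := H)).onLeft (isRep_left (k := k) (H := H)).onRight
    (comm_onLeft_onRight _ _)
  exact (congrArg (fun f => conv k H ∘ₗ f h) e.symm).trans
    (conv_left (HopfAlgebra.antipode k h))

lemma conv_assoc : conv k H ∘ₗ (conv k H).rTensor _ =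
    conv k H ∘ₗ (conv k H).lTensor _ ∘ₗ (TensorProduct.assoc k _ _ _).toLinearMap := by
  refine TensorProduct.ext_threefold fun φ ψ χ => ext fun x => ?_
  have e₁ : ∀ y : H ⊗[k] H, LinearMap.mul' k k
      (TensorProduct.map (val (conv k H (φ ⊗ₜ[k] ψ))) (val χ) y) =
      LinearMap.mul' k k (TensorProduct.map (val φ)
        (LinearMap.mul' k k ∘ₗ TensorProduct.map (val ψ) (val χ))
        (TensorProduct.assoc k H H H ((Coalgebra.comul (R := k)).rTensor H y))) := by
    intro y
    induction y using TensorProduct.induction_on with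
    | zero => simp
    | add s t hs ht => simp only [map_add, hs, ht]
    | tmul a b =>
      rw [TensorProduct.map_tmul, val_conv, LinearMap.rTensor_tmul]
      generalize (Coalgebra.comul a : H ⊗[k] H) = y
      induction y using TensorProduct.induction_on with
      | zero => simp
      | add s t hs ht => simp only [map_add, add_tmul, ← hs, ← ht]
      | tmul c d => simp [mul_assoc]
  have e₂ : ∀ y : H ⊗[k] H, LinearMap.mul' k k
      (TensorProduct.map (val φ) (val (conv k H (ψ ⊗ₜ[k] χ))) y) =
      LinearMap.mul' k k (TensorProduct.map (val φ)
        (LinearMap.mul' k k ∘ₗ TensorProduct.map (val ψ) (val χ))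
        ((Coalgebra.comul (R := k)).lTensor H y)) := by
    intro y
    induction y using TensorProduct.induction_on with
    | zero => simp
    | add s t hs ht => simp only [map_add, hs, ht]
    | tmul a b => rw [TensorProduct.map_tmul, val_conv]; rfl
  refine (e₁ _).trans (Eq.trans ?_ (e₂ _).symm)
  rw [Coalgebra.coassoc_apply]

lemma right_eps (h : H) : right k H h (eps k H) = Coalgebra.counit (R := k) h • eps k H :=
  ext fun x => by simp

lemma left_eps (h : H) : left k H h (eps k H) = Coalgebra.counit (R := k) h • eps k H :=
  ext fun x => by simp [mul_comm]

lemma leftAnti_eps (h : H) :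
    leftAnti k H h (eps k H) = Coalgebra.counit (R := k) h • eps k H := by
  rw [leftAnti, anti_apply, left_eps, HopfAlgebra.counit_antipode]

lemma eps_conv (φ : ResDual k H) : conv k H (eps k H ⊗ₜ[k] φ) = φ := by
  refine ext fun x => ?_
  rw [val_conv]
  have e : ∀ y : H ⊗[k] H, LinearMap.mul' k k (TensorProduct.map (val (eps k H)) (val φ) y) =
      val φ (TensorProduct.lid k H ((Coalgebra.counit (R := k)).rTensor H y)) := by
    intro y
    induction y using TensorProduct.induction_on with
    | zero => simp
    | add s t hs ht => simp only [map_add, hs, ht]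
    | tmul a b => simp
  rw [e, Coalgebra.rTensor_counit_comul]
  simp

lemma conv_eps (φ : ResDual k H) : conv k H (φ ⊗ₜ[k] eps k H) = φ := by
  refine ext fun x => ?_
  rw [val_conv]
  have e : ∀ y : H ⊗[k] H, LinearMap.mul' k k (TensorProduct.map (val φ) (val (eps k H)) y) =
      val φ (TensorProduct.rid k H ((Coalgebra.counit (R := k)).lTensor H y)) := by
    intro y
    induction y using TensorProduct.induction_on with
    | zero => simp
    | add s t hs ht => simp only [map_add, hs, ht]
    | tmul a b => simp [mul_comm]
  rw [e, Coalgebra.lTensor_counit_comul]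
  simp

end ResDual

end Dual

section TensorOperators

variable {k H : Type u} [Field k] [Ring H] [HopfAlgebra k H] {Q : QuasitriangularStructure k H}
variable {V W : Type*} [AddCommGroup V] [Module k V] [AddCommGroup W] [Module k W]

lemma rTensor_sw (s t : H →ₗ[k] Module.End k V) (x : H ⊗[k] H) :
    (sw s t x).rTensor W = sw (onLeft W s) (onLeft W t) x := by
  change LinearMap.rTensorHom W (sw _ _ _) = sw _ _ _
  induction x using TensorProduct.induction_on with
  | zero => simp
  | add x y hx hy => simp only [map_add, hx, hy]
  | tmul a b => ext; simp

lemma lTensor_sw (s t : H →ₗ[k] Module.End k W) (x : H ⊗[k] H) :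
    (sw s t x).lTensor V = sw (onRight V s) (onRight V t) x := by
  change LinearMap.lTensorHom V (sw _ _ _) = sw _ _ _
  induction x using TensorProduct.induction_on with
  | zero => simp
  | add x y hx hy => simp only [map_add, hx, hy]
  | tmul a b => ext; simp

lemma rTensor_fus (l r' l' : H →ₗ[k] Module.End k V) : (fus Q l r' l').rTensor W =
    fus Q (onLeft W l) (onLeft W r') (onLeft W l') := by
  rw [fus, LinearMap.rTensor_mul, br, br, rTensor_sw, rTensor_sw]; rfl

lemma lTensor_fus (l r' l' : H →ₗ[k] Module.End k W) : (fus Q l r' l').lTensor V =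
    fus Q (onRight V l) (onRight V r') (onRight V l') := by
  rw [fus, LinearMap.lTensor_mul, br, br, lTensor_sw, lTensor_sw]; rfl

lemma lTensor_chord (r l x : H →ₗ[k] Module.End k W) : (chord Q r l x).lTensor V =
    chord Q (onRight V r) (onRight V l) (onRight V x) := by
  rw [chord, LinearMap.lTensor_mul, brInv, br, lTensor_sw, lTensor_sw]; rfl

end TensorOperators

namespace ResDual

variable {k H : Type u} [Field k] [Ring H] [HopfAlgebra k H] (Q : QuasitriangularStructure k H)

/-! ### The product of `𝓛_{0,1}(H)` -/

variable (k H) in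
/-- The strands of `H° ⊗ H°`. -/
def strands₂ : Fin 4 → H →ₗ[k] Module.End k (ResDual k H ⊗[k] ResDual k H) :=
  sumFamily (strands k H) (strands k H) ∘ ![.inl 0, .inl 1, .inr 0, .inr 1]

lemma strandFamily₂ : StrandFamily (strands₂ k H) :=
  (strandFamily.sum strandFamily).comp _ (by decide)

variable (k H) in
/-- The strands of `(H° ⊗ H°) ⊗ H°`. -/
def strands₃ : Fin 6 → H →ₗ[k] Module.End k ((ResDual k H ⊗[k] ResDual k H) ⊗[k] ResDual k H) :=
  sumFamily (sumFamily (strands k H) (strands k H)) (strands k H) ∘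
    ![.inl (.inl 0), .inl (.inl 1), .inl (.inr 0), .inl (.inr 1), .inr 0, .inr 1]

lemma strandFamily₃ : StrandFamily (k := k) (H := H)
    (E := Module.End k ((ResDual k H ⊗[k] ResDual k H) ⊗[k] ResDual k H)) (strands₃ k H) :=
  ((strandFamily.sum strandFamily).sum strandFamily).comp _ (by decide)

variable (k H) in
/-- The strands of `H° ⊗ (H° ⊗ H°)`. -/
def strands₃' : Fin 6 → H →ₗ[k] Module.End k (ResDual k H ⊗[k] (ResDual k H ⊗[k] ResDual k H)) :=
  sumFamily (strands k H) (sumFamily (strands k H) (strands k H)) ∘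
    ![.inl 0, .inl 1, .inr (.inl 0), .inr (.inl 1), .inr (.inr 0), .inr (.inr 1)]

lemma strandFamily₃' : StrandFamily (k := k) (H := H)
    (E := Module.End k (ResDual k H ⊗[k] (ResDual k H ⊗[k] ResDual k H))) (strands₃' k H) :=
  (strandFamily.sum (strandFamily.sum strandFamily)).comp _ (by decide)

/-- The operator `fus` on `H° ⊗ H°`. -/
def fusOp : Module.End k (ResDual k H ⊗[k] ResDual k H) :=
  fus Q (strands₂ k H 1) (strands₂ k H 2) (strands₂ k H 3)

/-- The product of `𝓛_{0,1}(H)`. -/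
def mulL : ResDual k H ⊗[k] ResDual k H →ₗ[k] ResDual k H := conv k H ∘ₗ fusOp Q

lemma rTensor_conv_right (W : Type*) [AddCommGroup W] [Module k W] (h : H) :
    (conv k H).rTensor W ∘ₗ cv (onLeft W (onLeft _ (right k H)))
      (onLeft W (onRight _ (right k H))) h =
      onLeft W (right k H) h ∘ₗ (conv k H).rTensor W := by
  rw [← onLeft_cv]
  exact Equivar.rTensor W (fun h => conv_right h) h

lemma rTensor_conv_leftAnti (W : Type*) [AddCommGroup W] [Module k W] (h : H) :
    (conv k H).rTensor W ∘ₗ cv (onLeft W (onRight _ (leftAnti k H)))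
      (onLeft W (onLeft _ (leftAnti k H))) h =
      onLeft W (leftAnti k H) h ∘ₗ (conv k H).rTensor W := by
  rw [← onLeft_cv]
  exact Equivar.rTensor W (fun h => conv_leftAnti h) h

lemma lTensor_conv_right (W : Type*) [AddCommGroup W] [Module k W] (h : H) :
    (conv k H).lTensor W ∘ₗ cv (onRight W (onLeft _ (right k H)))
      (onRight W (onRight _ (right k H))) h =
      onRight W (right k H) h ∘ₗ (conv k H).lTensor W := by
  rw [← onRight_cv]
  exact Equivar.lTensor W (fun h => conv_right h) h

lemma lTensor_conv_leftAnti (W : Type*) [AddCommGroup W] [Module k W] (h : H) :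
    (conv k H).lTensor W ∘ₗ cv (onRight W (onRight _ (leftAnti k H)))
      (onRight W (onLeft _ (leftAnti k H))) h =
      onRight W (leftAnti k H) h ∘ₗ (conv k H).lTensor W := by
  rw [← onRight_cv]
  exact Equivar.lTensor W (fun h => conv_leftAnti h) h

lemma onLeft_rTensor {V W Z : Type*} [AddCommGroup V] [Module k V] [AddCommGroup W]
    [Module k W] [AddCommGroup Z] [Module k Z] (p : V →ₗ[k] W) (f : H →ₗ[k] Module.End k Z)
    (h : H) : p.rTensor Z ∘ₗ onRight V f h = onRight W f h ∘ₗ p.rTensor Z := by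
  ext; simp

lemma onRight_lTensor {V W Z : Type*} [AddCommGroup V] [Module k V] [AddCommGroup W]
    [Module k W] [AddCommGroup Z] [Module k Z] (p : V →ₗ[k] W) (f : H →ₗ[k] Module.End k Z)
    (h : H) : p.lTensor Z ∘ₗ onLeft V f h = onLeft W f h ∘ₗ p.lTensor Z := by
  ext; simp

variable {Q}

lemma rTensor_fusOp : (fusOp Q).rTensor (ResDual k H) =
    fus Q (strands₃ k H 1) (strands₃ k H 2) (strands₃ k H 3) :=
  rTensor_fus _ _ _

lemma lTensor_fusOp : (fusOp Q).lTensor (ResDual k H) =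
    fus Q (strands₃' k H 3) (strands₃' k H 4) (strands₃' k H 5) :=
  lTensor_fus _ _ _

lemma fusOp_rTensor_conv : fusOp Q ∘ₗ (conv k H).rTensor (ResDual k H) =
    (conv k H).rTensor (ResDual k H) ∘ₗ
      fus Q (cv (strands₃ k H 3) (strands₃ k H 1)) (strands₃ k H 4) (strands₃ k H 5) :=
  (fus_intertwine _ (rTensor_conv_leftAnti _) (onLeft_rTensor _ _) (onLeft_rTensor _ _)).symm

lemma fusOp_lTensor_conv : fusOp Q ∘ₗ (conv k H).lTensor (ResDual k H) =
    (conv k H).lTensor (ResDual k H) ∘ₗ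
      fus Q (strands₃' k H 1) (cv (strands₃' k H 2) (strands₃' k H 4))
        (cv (strands₃' k H 5) (strands₃' k H 3)) :=
  (fus_intertwine _ (onRight_lTensor _ _) (lTensor_conv_right _)
    (lTensor_conv_leftAnti _)).symm

lemma assoc_strands₃ (i : Fin 6) (h : H) :
    (TensorProduct.assoc k (ResDual k H) (ResDual k H) (ResDual k H)).toLinearMap ∘ₗ
      strands₃ k H i h = strands₃' k H i h ∘ₗ
        (TensorProduct.assoc k (ResDual k H) (ResDual k H) (ResDual k H)).toLinearMap := by
  refine TensorProduct.ext_threefold fun φ ψ χ => ?_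
  fin_cases i <;> rfl

/-- Each side is the iterated ⋆ applied to a word on three copies of H°; `fus_assoc` identifies the
words and `conv_assoc` the iterated products. -/
lemma mulL_assoc (x y z : ResDual k H) :
    mulL Q (mulL Q (x ⊗ₜ[k] y) ⊗ₜ[k] z) = mulL Q (x ⊗ₜ[k] mulL Q (y ⊗ₜ[k] z)) := by
  have a₁ := LinearMap.congr_fun (fusOp_rTensor_conv (Q := Q))
    ((fusOp Q).rTensor (ResDual k H) ((x ⊗ₜ[k] y) ⊗ₜ[k] z))
  have a₂ := LinearMap.congr_fun (fusOp_lTensor_conv (Q := Q))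
    ((fusOp Q).lTensor (ResDual k H) (x ⊗ₜ[k] (y ⊗ₜ[k] z)))
  rw [rTensor_fusOp, LinearMap.comp_apply, LinearMap.comp_apply, ← Module.End.mul_apply,
    fus_assoc Q strandFamily₃, ← rTensor_fusOp] at a₁
  rw [lTensor_fusOp, LinearMap.comp_apply, LinearMap.comp_apply, ← lTensor_fusOp] at a₂
  refine (congrArg (conv k H) a₁).trans (Eq.trans ?_ (congrArg (conv k H) a₂).symm)
  refine (LinearMap.congr_fun conv_assoc _).trans ?_
  refine congrArg (fun t => conv k H ((conv k H).lTensor _ t)) ?_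
  -- The word must also be carried from one bracketing of the triple tensor product to the other,
  -- one fusion operator at a time.
  have i₁ := fus_intertwine (Q := Q)
    (TensorProduct.assoc k (ResDual k H) (ResDual k H) (ResDual k H)).toLinearMap
    (assoc_strands₃ 1) (cv_intertwine _ (assoc_strands₃ 2) (assoc_strands₃ 4))
    (cv_intertwine _ (assoc_strands₃ 5) (assoc_strands₃ 3))
  have i₂ := fus_intertwine (Q := Q)
    (TensorProduct.assoc k (ResDual k H) (ResDual k H) (ResDual k H)).toLinearMap
    (assoc_strands₃ 3) (assoc_strands₃ 4) (assoc_strands₃ 5)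
  refine (LinearMap.congr_fun i₁ _).trans ?_
  rw [LinearMap.comp_apply, lTensor_fusOp]
  exact congrArg _ (LinearMap.congr_fun i₂ ((x ⊗ₜ[k] y) ⊗ₜ[k] z))

/-- Next to ε every strand becomes trivial and its braidings become 1; this gives the unit laws. -/
lemma onLeft_mk_eps {X : Type*} [AddCommGroup X] [Module k X]
    {f : H →ₗ[k] Module.End k (ResDual k H)}
    (hf : ∀ h, f h (eps k H) = Coalgebra.counit (R := k) h • eps k H) (h : H) :
    TensorProduct.mk k (ResDual k H) X (eps k H) ∘ₗ (triv : H →ₗ[k] Module.End k X) h =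
      onLeft X f h ∘ₗ TensorProduct.mk k (ResDual k H) X (eps k H) := by
  ext v
  simp [triv_apply, hf, Algebra.algebraMap_eq_smul_one, smul_tmul']

lemma onRight_mk_eps {X : Type*} [AddCommGroup X] [Module k X]
    {f : H →ₗ[k] Module.End k (ResDual k H)}
    (hf : ∀ h, f h (eps k H) = Coalgebra.counit (R := k) h • eps k H) (h : H) :
    (TensorProduct.mk k X (ResDual k H)).flip (eps k H) ∘ₗ (triv : H →ₗ[k] Module.End k X) h =
      onRight X f h ∘ₗ (TensorProduct.mk k X (ResDual k H)).flip (eps k H) := by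
  ext v
  simp [triv_apply, hf, Algebra.algebraMap_eq_smul_one]

lemma onRight_mk {V X : Type*} [AddCommGroup X] [Module k X] [AddCommGroup V] [Module k V]
    (f : H →ₗ[k] Module.End k X) (v : V) (h : H) :
    TensorProduct.mk k V X v ∘ₗ f h = onRight V f h ∘ₗ TensorProduct.mk k V X v := rfl

lemma onLeft_mk {V X : Type*} [AddCommGroup X] [Module k X] [AddCommGroup V] [Module k V]
    (f : H →ₗ[k] Module.End k X) (v : V) (h : H) :
    (TensorProduct.mk k X V).flip v ∘ₗ f h = onLeft V f h ∘ₗ (TensorProduct.mk k X V).flip v := rfl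

lemma eps_mulL (φ : ResDual k H) : mulL Q (eps k H ⊗ₜ[k] φ) = φ := by
  have e := fus_intertwine (Q := Q) (TensorProduct.mk k (ResDual k H) (ResDual k H) (eps k H))
    (onLeft_mk_eps leftAnti_eps) (onRight_mk (right k H) _) (onRight_mk (leftAnti k H) _)
  rw [fus, br_triv_right isStrand_right, br_triv_right isStrand_leftAnti, mul_one] at e
  exact (congrArg (conv k H) (LinearMap.congr_fun e φ).symm).trans (eps_conv φ)

lemma mulL_eps (φ : ResDual k H) : mulL Q (φ ⊗ₜ[k] eps k H) = φ := by
  have e := fus_intertwine (Q := Q)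
    ((TensorProduct.mk k (ResDual k H) (ResDual k H)).flip (eps k H))
    (onLeft_mk (leftAnti k H) _) (onRight_mk_eps right_eps) (onRight_mk_eps leftAnti_eps)
  rw [fus, br_triv_left isStrand_leftAnti, mul_one] at e
  exact (congrArg (conv k H) (LinearMap.congr_fun e φ).symm).trans (conv_eps φ)

lemma isAction_mulL : IsAction (eps k H) (mulL Q) (mulL Q) := ⟨eps_mulL, mulL_assoc⟩

lemma diag_coad : diag (coad k H) (coad k H) =
    cv (cv (strands₂ k H 0) (strands₂ k H 1)) (cv (strands₂ k H 2) (strands₂ k H 3)) := by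
  rw [diag_eq, coad, onLeft_cv, onRight_cv]; rfl

lemma equivar_mulL : Equivar (diag (coad k H) (coad k H)) (coad k H) (mulL Q) := fun h => by
  rw [diag_coad, mulL, LinearMap.comp_assoc, ← Module.End.mul_eq_comp, fusOp,
    fus_mul_cv strandFamily₂, Module.End.mul_eq_comp, ← LinearMap.comp_assoc,
    ← LinearMap.comp_assoc]
  congr 1
  exact cv_intertwine _ conv_right conv_leftAnti h

lemma coad_eps (h : H) : coad k H h (eps k H) = Coalgebra.counit (R := k) h • eps k H := by
  have e := cv_intertwine ((LinearMap.toSpanSingleton k _ (eps k H))) (s := triv) (t := triv)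
    (s' := right k H) (t' := leftAnti k H)
    (fun h => by ext; simp [triv_apply, right_eps, Algebra.algebraMap_eq_smul_one])
    (fun h => by ext; simp [triv_apply, leftAnti_eps, Algebra.algebraMap_eq_smul_one]) h
  rw [cv_triv_left] at e
  simpa [coad, triv_apply, Algebra.algebraMap_eq_smul_one] using (LinearMap.congr_fun e 1).symm

/-- The second copy of R acts by two left actions, which (S ⊗ S)(R) = R converts into strands; the
first copy acts by strands already. -/
lemma L01_mul_apply (x : ResDual k H ⊗[k] ResDual k H) : Q.L01.mul x = mulL Q x := by
  have e₁ : TensorProduct.map₂ (left k H) (left k H) Q.flip =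
      br Q (strands₂ k H 3) (strands₂ k H 1) := by
    rw [map₂_eq_sw, QuasitriangularStructure.flip, sw_comm (comm_onLeft_onRight _ _)]
    exact br_rep_rep isRep_left.onRight isRep_left.onLeft (comm_onLeft_onRight _ _).symm
  have e₂ : TensorProduct.map₂ (leftAnti k H) (right k H) Q.flip =
      br Q (strands₂ k H 2) (strands₂ k H 1) := by
    rw [map₂_eq_sw, QuasitriangularStructure.flip, sw_comm (comm_onLeft_onRight _ _)]
    rfl
  change conv k H (TensorProduct.map₂ (left k H) (left k H) Q.flip
    (TensorProduct.map₂ (leftAnti k H) (right k H) Q.flip x)) = _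
  rw [e₁, e₂]
  rfl

lemma coadjoint_act_eq : (restrictedDual.coadjoint k H).act = coad k H :=
  LinearMap.ext fun h => LinearMap.ext fun φ => coadjoint_act_apply h φ

lemma L01_mul_eq : Q.L01.mul = mulL Q := LinearMap.ext L01_mul_apply

lemma L01_act_eq : Q.L01.act = coad k H := coadjoint_act_eq

theorem isModuleAlgebra_L01 : Q.L01.IsModuleAlgebra := by
  refine isModuleAlgebra_of ?_ ?_ ?_ ?_
  · rw [L01_mul_eq]; exact isAction_mulL
  · rw [L01_mul_eq]; exact mulL_eps
  · rw [L01_mul_eq, L01_act_eq]; exact equivar_mulL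
  · rw [L01_act_eq]; exact coad_eps

end ResDual

namespace ResDual

variable {k H : Type u} [Field k] [Ring H] [HopfAlgebra k H] (Q : QuasitriangularStructure k H)

/-! ### The algebra `𝓛_{1,0}(H)` -/

/-- The exchange operator on `H° ⊗ H°`. -/
def exchOp : Module.End k (ResDual k H ⊗[k] ResDual k H) :=
  exch Q (strands₂ k H 0) (strands₂ k H 1) (strands₂ k H 2) (strands₂ k H 3)

/-- The exchange map `H° ⊗ H° → H° ⊗ H°`, moving the first factor past the second. -/
def exchMap : ResDual k H ⊗[k] ResDual k H →ₗ[k] ResDual k H ⊗[k] ResDual k H :=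
  exchOp Q ∘ₗ (TensorProduct.comm k (ResDual k H) (ResDual k H)).toLinearMap

variable {Q}

lemma exchOp_tmul_eps (φ : ResDual k H) : exchOp Q (φ ⊗ₜ[k] eps k H) = φ ⊗ₜ[k] eps k H := by
  have e := exch_intertwine (Q := Q)
    ((TensorProduct.mk k (ResDual k H) (ResDual k H)).flip (eps k H))
    (onLeft_mk (right k H) _) (onLeft_mk (leftAnti k H) _) (onRight_mk_eps right_eps)
    (onRight_mk_eps leftAnti_eps)
  rw [exch, brInv_triv_left isStrand_leftAnti, br_triv_right isStrand_leftAnti,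
    br_triv_right isStrand_right, mul_one, mul_one, mul_one] at e
  exact (LinearMap.congr_fun e φ).symm

lemma exchOp_eps_tmul (φ : ResDual k H) : exchOp Q (eps k H ⊗ₜ[k] φ) = eps k H ⊗ₜ[k] φ := by
  have e := exch_intertwine (Q := Q) (TensorProduct.mk k (ResDual k H) (ResDual k H) (eps k H))
    (onLeft_mk_eps right_eps) (onLeft_mk_eps leftAnti_eps) (onRight_mk (right k H) _)
    (onRight_mk (leftAnti k H) _)
  rw [exch, brInv_triv_right isStrand_right, br_triv_left isStrand_leftAnti,
    br_triv_left isStrand_right, mul_one, mul_one, mul_one] at e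
  exact (LinearMap.congr_fun e φ).symm

lemma exchOp_rTensor_mulL : exchOp Q ∘ₗ (mulL Q).rTensor (ResDual k H) =
    (mulL Q).rTensor (ResDual k H) ∘ₗ
      (exch Q (strands₃ k H 2) (strands₃ k H 3) (strands₃ k H 4) (strands₃ k H 5) *
        exch Q (strands₃ k H 0) (strands₃ k H 1) (strands₃ k H 4) (strands₃ k H 5)) := by
  have e : exchOp Q ∘ₗ (conv k H).rTensor (ResDual k H) = (conv k H).rTensor (ResDual k H) ∘ₗ
      exch Q (cv (strands₃ k H 0) (strands₃ k H 2)) (cv (strands₃ k H 3) (strands₃ k H 1))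
        (strands₃ k H 4) (strands₃ k H 5) :=
    (exch_intertwine _ (rTensor_conv_right _) (rTensor_conv_leftAnti _) (onLeft_rTensor _ _)
      (onLeft_rTensor _ _)).symm
  rw [mulL, LinearMap.rTensor_comp, ← LinearMap.comp_assoc, e, LinearMap.comp_assoc,
    LinearMap.comp_assoc, rTensor_fusOp, ← Module.End.mul_eq_comp (exch _ _ _ _ _),
    exch_fus_left Q strandFamily₃]
  rfl

lemma exchOp_lTensor_mulL : exchOp Q ∘ₗ (mulL Q).lTensor (ResDual k H) =
    (mulL Q).lTensor (ResDual k H) ∘ₗ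
      (exch Q (strands₃' k H 0) (strands₃' k H 1) (strands₃' k H 2) (strands₃' k H 3) *
        exch Q (strands₃' k H 0) (strands₃' k H 1) (strands₃' k H 4) (strands₃' k H 5)) := by
  have e : exchOp Q ∘ₗ (conv k H).lTensor (ResDual k H) = (conv k H).lTensor (ResDual k H) ∘ₗ
      exch Q (strands₃' k H 0) (strands₃' k H 1) (cv (strands₃' k H 2) (strands₃' k H 4))
        (cv (strands₃' k H 5) (strands₃' k H 3)) :=
    (exch_intertwine _ (onRight_lTensor _ _) (onRight_lTensor _ _) (lTensor_conv_right _)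
      (lTensor_conv_leftAnti _)).symm
  rw [mulL, LinearMap.lTensor_comp, ← LinearMap.comp_assoc, e, LinearMap.comp_assoc,
    LinearMap.comp_assoc, lTensor_fusOp, ← Module.End.mul_eq_comp (exch _ _ _ _ _),
    exch_fus_right Q strandFamily₃']
  rfl

/-- The moving algebra is the copy `i_a` and the one moved past is `i_b`. This makes 𝓛₁,₀ a twisted
tensor product of two copies of 𝓛₀,₁. -/
lemma isTwist_exchMap : IsTwist (eps k H) (mulL Q) (mulL Q) (exchMap Q) (exchMap Q) where
  one := exchOp_tmul_eps
  act b a v := by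
    refine twist_act_of_operators (Y := exchOp Q) exchOp_rTensor_mulL (fun φ => ?_) (fun φ => ?_) b a v
    · refine (exch_intertwine _ ?_ ?_ ?_ ?_).symm <;> intro h <;> refine TensorProduct.ext' ?_ <;>
        intro _ _ <;> rfl
    · refine (exch_intertwine _ ?_ ?_ ?_ ?_).symm <;> intro h <;> refine TensorProduct.ext' ?_ <;>
        intro _ _ <;> rfl
  mul b b' v := by
    refine twist_mul_of_operators exchOp_lTensor_mulL (fun φ => ?_) (fun φ => ?_) b b' v
    · refine (exch_intertwine _ ?_ ?_ ?_ ?_).symm <;> intro h <;> refine TensorProduct.ext' ?_ <;>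
        intro _ _ <;> rfl
    · refine (exch_intertwine _ ?_ ?_ ?_ ?_).symm <;> intro h <;> refine TensorProduct.ext' ?_ <;>
        intro _ _ <;> rfl

lemma equivar_exchMap :
    Equivar (diag (coad k H) (coad k H)) (diag (coad k H) (coad k H)) (exchMap Q) := by
  refine equivar_comp_comm fun h => ?_
  rw [coad, onLeft_cv, onRight_cv]
  exact exch_mul_cv strandFamily₂ h

/-- The fourth copy of R pairs a right strand with a left action, hence is an inverse braiding; the
third pairs two left actions, hence is a braiding by (S ⊗ S)(R) = R. -/
lemma exchange_apply (x : ResDual k H ⊗[k] ResDual k H) : Q.exchange x = exchOp Q x := by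
  have e₁ : TensorProduct.map₂ (left k H) (right k H) Q.flip =
      brInv Q (strands₂ k H 2) (strands₂ k H 1) := by
    rw [map₂_eq_sw, QuasitriangularStructure.flip, sw_comm (comm_onLeft_onRight _ _)]
    exact br_rep_right isStrand_right.onRight isRep_left.onLeft (comm_onLeft_onRight _ _).symm
  have e₂ : TensorProduct.map₂ (left k H) (left k H) Q.R =
      br Q (strands₂ k H 1) (strands₂ k H 3) := by
    rw [map₂_eq_sw]
    exact br_rep_rep isRep_left.onLeft isRep_left.onRight (comm_onLeft_onRight _ _)
  have e₃ : TensorProduct.map₂ (right k H) (right k H) Q.R =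
      br Q (strands₂ k H 0) (strands₂ k H 2) := map₂_eq_sw _ _ _
  have e₄ : TensorProduct.map₂ (right k H) (leftAnti k H) Q.R =
      br Q (strands₂ k H 0) (strands₂ k H 3) := map₂_eq_sw _ _ _
  change TensorProduct.map₂ (left k H) (right k H) Q.flip
    (TensorProduct.map₂ (left k H) (left k H) Q.R
      (TensorProduct.map₂ (right k H) (right k H) Q.R
        (TensorProduct.map₂ (right k H) (leftAnti k H) Q.R x))) = _
  rw [e₁, e₂, e₃, e₄]
  rfl

lemma L10_mul_eq : Q.L10.mul = twist (mulL Q) (mulL Q) (exchMap Q) := by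
  have e : (Q.exchange : ResDual k H ⊗[k] ResDual k H →ₗ[k] ResDual k H ⊗[k] ResDual k H) =
    exchOp Q := LinearMap.ext exchange_apply
  have key : ∀ (m m' : ResDual k H ⊗[k] ResDual k H →ₗ[k] ResDual k H)
      (f f' : Module.End k (ResDual k H ⊗[k] ResDual k H)), m = m' → f = f' →
      twist m m (f ∘ₗ (TensorProduct.comm k (ResDual k H) (ResDual k H)).toLinearMap) =
      twist m' m' (f' ∘ₗ (TensorProduct.comm k (ResDual k H) (ResDual k H)).toLinearMap) := by
    rintro _ _ _ _ rfl rfl; rfl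
  exact key Q.L01.mul (mulL Q) Q.exchange (exchOp Q) L01_mul_eq e

lemma L10_act_eq : Q.L10.act = diag (coad k H) (coad k H) := by
  have e : Q.L10.act = diag (V := ResDual k H) (W := ResDual k H) Q.L01.act Q.L01.act := rfl
  rw [e, L01_act_eq]
  rfl

lemma isAction_L10 : IsAction (k := k) (A := ResDual k H ⊗[k] ResDual k H)
    (M := ResDual k H ⊗[k] ResDual k H) (eps k H ⊗ₜ[k] eps k H)
    (twist (mulL Q) (mulL Q) (exchMap Q)) (twist (mulL Q) (mulL Q) (exchMap Q)) :=
  isTwist_exchMap.isAction isAction_mulL isAction_mulL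

lemma equivar_L10 : Equivar (k := k) (diag (diag (coad k H) (coad k H))
    (diag (coad k H) (coad k H))) (diag (coad k H) (coad k H))
    (twist (mulL Q) (mulL Q) (exchMap Q)) :=
  Equivar.twist equivar_mulL equivar_mulL equivar_exchMap

lemma diag_coad_eps (h : H) : diag (coad k H) (coad k H) h (eps k H ⊗ₜ[k] eps k H) =
    Coalgebra.counit (R := k) h • (eps k H ⊗ₜ[k] eps k H) :=
  diag_tmul_of_invariant _ _ coad_eps coad_eps h

lemma twist_mul_eps (x : ResDual k H ⊗[k] ResDual k H) :
    twist (mulL Q) (mulL Q) (exchMap Q) (x ⊗ₜ[k] (eps k H ⊗ₜ[k] eps k H)) = x :=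
  twist_mul_one mulL_eps mulL_eps exchOp_eps_tmul x

theorem isModuleAlgebra_L10 : Q.L10.IsModuleAlgebra := by
  refine isModuleAlgebra_of ?_ ?_ ?_ ?_
  · rw [L10_mul_eq]; exact isAction_L10
  · rw [L10_mul_eq]; exact twist_mul_eps
  · rw [L10_mul_eq, L10_act_eq]; exact equivar_L10
  · rw [L10_act_eq]; exact diag_coad_eps

/-! ### Modules over `𝓛_{0,1}(H)` -/

variable (k H) in
/-- Evaluation at `1`. -/
def ev : ResDual k H →ₗ[k] k := LinearMap.applyₗ (1 : H) ∘ₗ val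

lemma ev_apply (φ : ResDual k H) : ev k H φ = val φ 1 := rfl

/-- At 1 the coadjoint action gives φ(h₁ S(h₂)) = ε(h) φ(1). -/
lemma equivar_ev : Equivar (coad k H) (triv : H →ₗ[k] Module.End k k) (ev k H) := by
  intro h
  refine LinearMap.ext fun φ => ?_
  -- Under evaluation at 1 the outermost right coregular action may be replaced by the left one; the
  -- convolution of the latter with its antipode is trivial.
  have e : ∀ x : H ⊗[k] H,
      ev k H (sw (E := Module.End k (ResDual k H)) (right k H) (leftAnti k H) x φ) =
      ev k H (sw (E := Module.End k (ResDual k H)) (left k H) (leftAnti k H) x φ) := by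
    intro x
    induction x using TensorProduct.induction_on with
    | zero => simp
    | add x y hx hy => simp only [map_add, LinearMap.add_apply, hx, hy]
    | tmul a b => simp [ev_apply]
  refine (e _).trans ?_
  have e' : cv (left k H) (leftAnti k H) = triv := cv_anti_right isRep_left
  refine (congrArg (fun f => ev k H (f h φ)) e').trans ?_
  simp [triv_apply, Algebra.algebraMap_eq_smul_one]

lemma ev_coad (h : H) (φ : ResDual k H) :
    ev k H (coad k H h φ) = Coalgebra.counit (R := k) h • ev k H φ := by
  simpa [triv_apply, Algebra.algebraMap_eq_smul_one] using LinearMap.congr_fun (equivar_ev h) φ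

section Chord

variable {X : Type*} [AddCommGroup X] [Module k X] {χ : H →ₗ[k] Module.End k X}

variable (k H X) in
/-- The map `φ ⊗ x ↦ φ(1) x`. -/
def evL : ResDual k H ⊗[k] X →ₗ[k] X :=
  (TensorProduct.lid k X).toLinearMap ∘ₗ (ev k H).rTensor X

@[simp] lemma evL_tmul (φ : ResDual k H) (x : X) : evL k H X (φ ⊗ₜ[k] x) = ev k H φ • x := by
  simp [evL]

variable (Q χ) in
/-- The operator `chord` on `H° ⊗ X`. -/
def chordOp : Module.End k (ResDual k H ⊗[k] X) :=
  chord Q (onLeft X (right k H)) (onLeft X (leftAnti k H)) (onRight (ResDual k H) χ)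

variable (Q χ) in
/-- The action of `𝓛_{0,1}(H)` on a right `H`-module with strand `χ`. -/
def actL : ResDual k H ⊗[k] X →ₗ[k] X := evL k H X ∘ₗ chordOp Q χ

lemma eps_actL (hχ : IsStrand χ) (v : X) : actL Q χ (eps k H ⊗ₜ[k] v) = v := by
  have e := chord_intertwine (Q := Q) (TensorProduct.mk k (ResDual k H) X (eps k H))
    (onLeft_mk_eps right_eps) (onLeft_mk_eps leftAnti_eps) (onRight_mk χ _)
  rw [chord, brInv_triv_left hχ, br_triv_right hχ, mul_one] at e
  refine (congrArg (evL k H X) (LinearMap.congr_fun e v).symm).trans ?_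
  simp [ev_apply]

variable (k H χ) in
/-- The strands of `(H° ⊗ H°) ⊗ X`. -/
def strandsX : Fin 5 → H →ₗ[k] Module.End k ((ResDual k H ⊗[k] ResDual k H) ⊗[k] X) :=
  sumFamily (sumFamily (strands k H) (strands k H)) (fun _ : Unit => χ) ∘
    ![.inl (.inl 0), .inl (.inl 1), .inl (.inr 0), .inl (.inr 1), .inr ()]

lemma strandFamilyX (hχ : IsStrand χ) : StrandFamily (k := k) (H := H)
    (E := Module.End k ((ResDual k H ⊗[k] ResDual k H) ⊗[k] X)) (strandsX k H χ) :=
  ((strandFamily.sum strandFamily).sum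
    (⟨fun _ => hχ, fun _ _ h => (h rfl).elim⟩ : StrandFamily (fun _ : Unit => χ))).comp _
    (by decide)

variable (k H X) in
/-- The map `(φ ⊗ ψ) ⊗ x ↦ φ ⊗ ψ(1) x`. -/
def evMid : (ResDual k H ⊗[k] ResDual k H) ⊗[k] X →ₗ[k] ResDual k H ⊗[k] X :=
  (evL k H X).lTensor (ResDual k H) ∘ₗ
    (TensorProduct.assoc k (ResDual k H) (ResDual k H) X).toLinearMap

/-- Evaluation at 1 is multiplicative for ⋆ because Δ(1) = 1 ⊗ 1. -/
lemma evL_rTensor_conv (x : (ResDual k H ⊗[k] ResDual k H) ⊗[k] X) :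
    evL k H X ((conv k H).rTensor X x) = evL k H X (evMid k H X x) := by
  refine LinearMap.congr_fun (f := evL k H X ∘ₗ (conv k H).rTensor X)
    (g := evL k H X ∘ₗ evMid k H X) (TensorProduct.ext_threefold fun φ ψ v => ?_) x
  simp [evMid, ev_apply, val_conv, Algebra.TensorProduct.one_def, mul_smul]
  rw [smul_comm]

lemma evMid_cv (h : H) :
    evMid k H X ∘ₗ cv (strandsX k H χ 2) (strandsX k H χ 3) h =
      (triv : H →ₗ[k] Module.End k (ResDual k H ⊗[k] X)) h ∘ₗ evMid k H X := by
  have e : cv (E := Module.End k ((ResDual k H ⊗[k] ResDual k H) ⊗[k] X))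
      (strandsX k H χ 2) (strandsX k H χ 3) =
      onLeft X (onRight (ResDual k H) (coad k H)) := by
    rw [coad, onRight_cv, onLeft_cv]; rfl
  rw [e]
  refine TensorProduct.ext_threefold fun φ ψ v => ?_
  simp [evMid, ev_coad, triv_apply, Algebra.algebraMap_eq_smul_one, mul_smul]

lemma chordOp_rTensor_mulL (hχ : IsStrand χ) :
    chordOp Q χ ∘ₗ (mulL Q).rTensor X = (conv k H).rTensor X ∘ₗ
      (br Q (cv (strandsX k H χ 2) (strandsX k H χ 3)) (strandsX k H χ 1) *
        (chord Q (strandsX k H χ 0) (strandsX k H χ 1) (strandsX k H χ 4) *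
          chord Q (strandsX k H χ 2) (strandsX k H χ 3) (strandsX k H χ 4))) := by
  have e : chordOp Q χ ∘ₗ (conv k H).rTensor X = (conv k H).rTensor X ∘ₗ
      chord Q (cv (strandsX k H χ 0) (strandsX k H χ 2))
        (cv (strandsX k H χ 3) (strandsX k H χ 1)) (strandsX k H χ 4) :=
    (chord_intertwine _ (rTensor_conv_right _) (rTensor_conv_leftAnti _)
      (onLeft_rTensor _ _)).symm
  have f : (fusOp Q).rTensor X =
      fus Q (strandsX k H χ 1) (strandsX k H χ 2) (strandsX k H χ 3) := rTensor_fus _ _ _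
  rw [mulL, LinearMap.rTensor_comp, ← LinearMap.comp_assoc, e, LinearMap.comp_assoc, f,
    ← chord_fus Q (strandFamilyX hχ)]
  rfl

/-- By `chord_fus` the chord of a product is a composite of two chords preceded by a prefactor.
Evaluating the second factor at 1 removes the prefactor and turns the inner chord into the inner
action. -/
lemma mulL_actL (hχ : IsStrand χ) (φ ψ : ResDual k H) (v : X) :
    actL Q χ (mulL Q (φ ⊗ₜ[k] ψ) ⊗ₜ[k] v) = actL Q χ (φ ⊗ₜ[k] actL Q χ (ψ ⊗ₜ[k] v)) := by
  have e := LinearMap.congr_fun (chordOp_rTensor_mulL (Q := Q) hχ) ((φ ⊗ₜ[k] ψ) ⊗ₜ[k] v)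
  refine (congrArg (evL k H X) e).trans ((evL_rTensor_conv _).trans ?_)
  -- The prefactor involves the second factor only through its coadjoint action, which is trivial
  -- after evaluation at 1.
  have e₁ : evMid k H X ∘ₗ br Q (cv (strandsX k H χ 2) (strandsX k H χ 3)) (strandsX k H χ 1) =
      evMid k H X := by
    have i : evMid k H X ∘ₗ br Q (cv (strandsX k H χ 2) (strandsX k H χ 3)) (strandsX k H χ 1) =
        br Q triv (onLeft X (leftAnti k H)) ∘ₗ evMid k H X := by
      refine sw_intertwine _ evMid_cv (fun h => ?_) _
      refine TensorProduct.ext_threefold fun φ ψ v => ?_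
      change evMid k H X ((leftAnti k H h φ ⊗ₜ[k] ψ) ⊗ₜ[k] v) =
        onLeft X (leftAnti k H) h (evMid k H X ((φ ⊗ₜ[k] ψ) ⊗ₜ[k] v))
      simp [evMid]
    rw [i, br_triv_left isStrand_leftAnti.onLeft]
    rfl
  have e₂ : evMid k H X ∘ₗ chord Q (strandsX k H χ 0) (strandsX k H χ 1) (strandsX k H χ 4) =
      chordOp Q χ ∘ₗ evMid k H X := by
    refine chord_intertwine _ (fun h => ?_) (fun h => ?_) (fun h => ?_)
    · refine TensorProduct.ext_threefold fun φ ψ v => ?_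
      change evMid k H X ((right k H h φ ⊗ₜ[k] ψ) ⊗ₜ[k] v) =
        onLeft X (right k H) h (evMid k H X ((φ ⊗ₜ[k] ψ) ⊗ₜ[k] v))
      simp [evMid]
    · refine TensorProduct.ext_threefold fun φ ψ v => ?_
      change evMid k H X ((leftAnti k H h φ ⊗ₜ[k] ψ) ⊗ₜ[k] v) =
        onLeft X (leftAnti k H) h (evMid k H X ((φ ⊗ₜ[k] ψ) ⊗ₜ[k] v))
      simp [evMid]
    · refine TensorProduct.ext_threefold fun φ ψ v => ?_
      change evMid k H X ((φ ⊗ₜ[k] ψ) ⊗ₜ[k] χ h v) =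
        onRight (ResDual k H) χ h (evMid k H X ((φ ⊗ₜ[k] ψ) ⊗ₜ[k] v))
      simp [evMid]
  have e₃ : (TensorProduct.assoc k (ResDual k H) (ResDual k H) X).toLinearMap ∘ₗ
      chord Q (strandsX k H χ 2) (strandsX k H χ 3) (strandsX k H χ 4) =
      (chordOp Q χ).lTensor (ResDual k H) ∘ₗ
        (TensorProduct.assoc k (ResDual k H) (ResDual k H) X).toLinearMap := by
    rw [chordOp, lTensor_chord]
    refine chord_intertwine _ ?_ ?_ ?_ <;> intro h <;>
      refine TensorProduct.ext_threefold ?_ <;> intro _ _ _ <;> rfl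
  refine congrArg (evL k H X) ((LinearMap.congr_fun e₁ _).trans
    ((LinearMap.congr_fun e₂ _).trans (congrArg (chordOp Q χ) ?_)))
  exact congrArg ((evL k H X).lTensor _) (LinearMap.congr_fun e₃ ((φ ⊗ₜ[k] ψ) ⊗ₜ[k] v))

lemma isAction_actL (hχ : IsStrand χ) : IsAction (eps k H) (mulL Q) (actL Q χ) :=
  ⟨eps_actL hχ, mulL_actL hχ⟩

/-- The braiding carries l past χ, and the inverse braiding carries r past χ. The coadjoint action
is then outermost on H° and evaluation at 1 reduces it to ε. -/
lemma equivar_actL (hχ : IsStrand χ) : Equivar (diag (coad k H) χ) χ (actL Q χ) := by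
  intro h
  have hr := (isStrand_right (k := k) (H := H)).onLeft (W := X)
  have hl := (isStrand_leftAnti (k := k) (H := H)).onLeft (W := X)
  have hx := hχ.onRight (V := ResDual k H)
  have c₁ : Comm (onLeft X (right k H)) (onLeft X (leftAnti k H)) := comm_right_leftAnti.onLeft
  have c₂ : Comm (onLeft X (right k H)) (onRight (ResDual k H) χ) := comm_onLeft_onRight _ _
  have c₃ : Comm (onLeft X (leftAnti k H)) (onRight (ResDual k H) χ) := comm_onLeft_onRight _ _
  have e : chordOp Q χ * diag (coad k H) χ h =
      cv (onRight (ResDual k H) χ) (onLeft X (coad k H)) h * chordOp Q χ := by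
    rw [diag_eq, coad, onLeft_cv, chordOp, chord, cv_assoc, mul_assoc,
      mul_cv (br_mul_comm c₂ c₁) (fun h => (cv_mul_br hx hl c₃.symm h).symm), ← cv_assoc,
      ← mul_assoc, mul_cv (fun h => (cv_mul_brInv hr hx c₂ h).symm)
        (brInv_mul_comm c₁.symm c₃), cv_assoc, mul_assoc]
  have e' : evL k H X ∘ₗ cv (onRight (ResDual k H) χ) (onLeft X (coad k H)) h =
      cv χ triv h ∘ₗ evL k H X := by
    refine cv_intertwine _ (fun a => ?_) (fun a => ?_) h
    · refine TensorProduct.ext' fun φ v => ?_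
      simp
    · refine TensorProduct.ext' fun φ v => ?_
      simp [ev_coad, triv_apply, Algebra.algebraMap_eq_smul_one, mul_smul]
  rw [cv_triv_right] at e'
  rw [actL, LinearMap.comp_assoc, ← Module.End.mul_eq_comp, e, Module.End.mul_eq_comp,
    ← LinearMap.comp_assoc, e', LinearMap.comp_assoc]

/-- The action through `Phi` is the action through the chord operator. -/
lemma actL_anti_tmul {x : H →ₗ[k] Module.End k X} (hx : IsRep x) (φ : ResDual k H) (v : X) :
    actL Q (anti x) (φ ⊗ₜ[k] v) = x (Q.Phi φ) v := by
  have e₁ : brInv Q (onLeft X (right k H)) (onRight (ResDual k H) (anti x)) =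
      br Q (onLeft X (right k H)) (onRight (ResDual k H) x) :=
    (br_rep_right isStrand_right.onLeft hx.onRight (comm_onLeft_onRight _ _)).symm
  have e₂ : br Q (onRight (ResDual k H) (anti x)) (onLeft X (leftAnti k H)) =
      br Q (onRight (ResDual k H) x) (onLeft X (left k H)) :=
    (br_rep_rep hx.onRight isRep_left.onLeft (comm_onLeft_onRight _ _).symm).symm
  -- For s = a ⊗ b and t = c ⊗ d both sides are φ(ad) x(bc) v. With s and t both equal to R, the
  -- element on the right is R R', whence Φ.
  have e₃ : ∀ s t : H ⊗[k] H,
      evL k H X (sw (E := Module.End k (ResDual k H ⊗[k] X)) (onLeft X (right k H))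
        (onRight (ResDual k H) x) s (sw (E := Module.End k (ResDual k H ⊗[k] X))
          (onRight (ResDual k H) x) (onLeft X (left k H)) t (φ ⊗ₜ[k] v))) =
      x (TensorProduct.lid k H ((val φ).rTensor H (s * TensorProduct.comm k H H t))) v := by
    intro s t
    induction s using TensorProduct.induction_on with
    | zero => simp
    | add x y hx hy => simp only [map_add, add_mul, LinearMap.add_apply, hx, hy]
    | tmul a b =>
      induction t using TensorProduct.induction_on with
      | zero => simp
      | add x y hx hy => simp only [map_add, mul_add, LinearMap.add_apply, hx, hy]
      | tmul c d =>
        simp only [sw_tmul, Module.End.mul_apply, onRight_apply_tmul, onLeft_apply_tmul,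
          evL_tmul, ev_apply, val_right, val_left, comm_tmul,
          Algebra.TensorProduct.tmul_mul_tmul, LinearMap.rTensor_tmul, lid_tmul, map_smul,
          hx.map_mul, LinearMap.smul_apply, mul_one]
  rw [actL, chordOp, chord, e₁, e₂]
  exact e₃ _ _

end Chord

theorem isEquivariantModule_moduleL01 (X : ModuleCat.{u} H) :
    (Q.moduleL01 X).IsEquivariantModule := by
  let : Module k X := ModuleCat.moduleOfAlgebraModule X
  let x : H →ₗ[k] Module.End k X := (Algebra.lsmul k k X).toLinearMap
  have hx : IsRep x := ⟨map_one (Algebra.lsmul k k X), map_mul (Algebra.lsmul k k X)⟩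
  have e : (Q.moduleL01 X).lact = actL Q (anti x) :=
    TensorProduct.ext' fun φ v => (actL_anti_tmul hx φ v).symm
  refine isEquivariantModule_of ?_ ?_
  · rw [e, L01_mul_eq]; exact isAction_actL hx.anti
  · rw [e, L01_act_eq]; exact equivar_actL hx.anti

end ResDual

namespace ResDual

variable {k H : Type u} [Field k] [Ring H] [HopfAlgebra k H] {Q : QuasitriangularStructure k H}

/-! ### The module `H°` over `𝓛_{1,0}(H)` -/

lemma onRight_triv {V W : Type*} [AddCommGroup V] [Module k V] [AddCommGroup W] [Module k W] :
    onRight V (triv : H →ₗ[k] Module.End k W) = triv := by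
  ext h v w
  simp [triv_apply, Algebra.algebraMap_eq_smul_one]

lemma actL_triv {X : Type*} [AddCommGroup X] [Module k X] :
    actL Q (triv : H →ₗ[k] Module.End k X) = evL k H X := by
  rw [actL, chordOp, chord, onRight_triv, brInv_triv_right isStrand_right.onLeft,
    br_triv_left isStrand_leftAnti.onLeft]
  rfl

/-- The map φ ↦ φ(1) is a character of 𝓛₀,₁: it is the chord action for the trivial strand. -/
lemma isAction_evL : IsAction (eps k H) (mulL Q) (evL k H k) := by
  rw [← actL_triv (Q := Q)]
  exact isAction_actL triv_isStrand

variable (k H) in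
/-- The map `φ ⊗ ψ ↦ ψ(1) φ`. -/
def evR : ResDual k H ⊗[k] ResDual k H →ₗ[k] ResDual k H :=
  (TensorProduct.rid k (ResDual k H)).toLinearMap ∘ₗ (ev k H).lTensor (ResDual k H)

@[simp] lemma evR_tmul (φ ψ : ResDual k H) : evR k H (φ ⊗ₜ[k] ψ) = ev k H ψ • φ := by
  simp [evR]

lemma equivar_evR : Equivar (diag (coad k H) (coad k H)) (coad k H) (evR k H) := by
  intro h
  have e := cv_intertwine (evR k H) (s := onLeft (ResDual k H) (coad k H))
    (t := onRight (ResDual k H) (coad k H)) (s' := coad k H) (t' := triv)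
    (fun a => TensorProduct.ext' fun φ v => by simp)
    (fun a => TensorProduct.ext' fun φ v => by
      simp [ev_coad, triv_apply, Algebra.algebraMap_eq_smul_one, mul_smul]) h
  rw [cv_triv_right] at e
  rw [diag_eq]
  exact e

variable (Q) in
/-- The action of `𝓛_{1,0}(H)` on `H°`. -/
def lactL : (ResDual k H ⊗[k] ResDual k H) ⊗[k] ResDual k H →ₗ[k] ResDual k H :=
  mulL Q ∘ₗ (evR k H ∘ₗ exchMap Q).lTensor (ResDual k H) ∘ₗ
    (TensorProduct.assoc k (ResDual k H) (ResDual k H) (ResDual k H)).toLinearMap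

/-- Identifying H° with H° ⊗ k, the action on H° is the twisted external product of the regular
module of `i_b` and the character of `i_a`. The module axioms follow from `IsTwist.isAction`. -/
lemma twist_evL (x : ResDual k H ⊗[k] ResDual k H) (φ : ResDual k H) :
    twist (mulL Q) (evL k H k) (exchMap Q) (x ⊗ₜ[k] (φ ⊗ₜ[k] (1 : k))) =
      lactL Q (x ⊗ₜ[k] φ) ⊗ₜ[k] (1 : k) := by
  induction x using TensorProduct.induction_on with
  | zero => simp
  | add x y hx hy => simp only [map_add, add_tmul, hx, hy]
  | tmul β α =>
    have e : lactL Q ((β ⊗ₜ[k] α) ⊗ₜ[k] φ) =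
      mulL Q (β ⊗ₜ[k] evR k H (exchMap Q (α ⊗ₜ[k] φ))) := rfl
    rw [twist_tmul, twistRight_tmul, e]
    generalize exchMap Q (α ⊗ₜ[k] φ) = s
    induction s using TensorProduct.induction_on with
    | zero => simp
    | add x y hx hy => simp only [map_add, add_tmul, tmul_add, hx, hy]
    | tmul φ ψ =>
      simp only [LinearMap.lTensor_tmul, assoc_tmul, evL_tmul, LinearMap.rTensor_tmul,
        LinearMap.comp_apply, TensorProduct.mk_apply, evR_tmul, tmul_smul, map_smul]
      exact smul_tmul' _ _ _

lemma tmul_one_injective {X : Type*} [AddCommGroup X] [Module k X] {v w : X}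
    (h : v ⊗ₜ[k] (1 : k) = w ⊗ₜ[k] (1 : k)) : v = w := by
  simpa using congrArg (TensorProduct.rid k X) h

lemma isAction_lactL : IsAction (k := k) (A := ResDual k H ⊗[k] ResDual k H)
    (M := ResDual k H) (eps k H ⊗ₜ[k] eps k H)
    (twist (mulL Q) (mulL Q) (exchMap Q)) (lactL Q) where
  one_act v := by
    have h := ((isTwist_exchMap (Q := Q)).isAction isAction_mulL isAction_evL).one_act
      (v ⊗ₜ[k] (1 : k))
    exact tmul_one_injective ((twist_evL _ _).symm.trans h)
  mul_act a b v := by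
    have h := ((isTwist_exchMap (Q := Q)).isAction isAction_mulL isAction_evL).mul_act a b
      (v ⊗ₜ[k] (1 : k))
    rw [twist_evL, twist_evL, twist_evL] at h
    exact tmul_one_injective h

lemma equivar_lactL : Equivar (k := k) (diag (diag (coad k H) (coad k H)) (coad k H)) (coad k H)
    (lactL Q) :=
  equivar_mulL.comp ((Equivar.map Equivar.id (equivar_evR.comp equivar_exchMap)).comp
    equivar_assoc)

lemma comm_strands₂ (i j : Fin 4) (hij : j = ![2, 3, 0, 1] i) (h : H) :
    (TensorProduct.comm k (ResDual k H) (ResDual k H)).toLinearMap ∘ₗ strands₂ k H i h =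
      strands₂ k H j h ∘ₗ (TensorProduct.comm k (ResDual k H) (ResDual k H)).toLinearMap := by
  refine TensorProduct.ext' fun φ ψ => ?_
  subst hij
  fin_cases i <;> rfl

lemma evR_comm : evR k H ∘ₗ (TensorProduct.comm k (ResDual k H) (ResDual k H)).toLinearMap =
    evL k H (ResDual k H) := TensorProduct.ext' fun φ ψ => by simp

/-- With the flip carried outwards, the last two letters of the exchange operator form the chord of
α with the left strand of ψ, which matches the Φ-action. -/
lemma evR_exchMap : evR k H ∘ₗ exchMap Q = evL k H (ResDual k H) ∘ₗ
    exch Q (strands₂ k H 2) (strands₂ k H 3) (strands₂ k H 0) (strands₂ k H 1) := by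
  have e := exch_intertwine (Q := Q)
    (TensorProduct.comm k (ResDual k H) (ResDual k H)).toLinearMap
    (comm_strands₂ 2 0 rfl) (comm_strands₂ 3 1 rfl) (comm_strands₂ 0 2 rfl)
    (comm_strands₂ 1 3 rfl)
  rw [exchMap, exchOp, ← e, ← LinearMap.comp_assoc, evR_comm]

variable (Q) in
/-- The map `Phi`. -/
def phi : ResDual k H →ₗ[k] H := Q.Phi

lemma lift_left_phi (x : ResDual k H ⊗[k] ResDual k H) :
    TensorProduct.lift (left k H ∘ₗ phi Q) x = actL Q (leftAnti k H) x := by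
  induction x using TensorProduct.induction_on with
  | zero => simp
  | add x y hx hy => simp only [map_add, hx, hy]
  | tmul φ ψ => exact (actL_anti_tmul isRep_left φ ψ).symm

/-- The factor Φ(·) ▷ is the chord part; the braiding of the right strand of ψ with the coadjoint
action of α splits by the hexagon into the remaining two letters of the exchange operator. -/
lemma lactA_apply (x : ResDual k H ⊗[k] ResDual k H) :
    Q.lactA x = evR k H (exchMap Q x) := by
  have e₁ : TensorProduct.map₂ (coad k H) (right k H) Q.flip =
      br Q (strands₂ k H 2) (strands₂ k H 0) * br Q (strands₂ k H 2) (strands₂ k H 1) := by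
    rw [map₂_eq_sw, QuasitriangularStructure.flip, sw_comm (comm_onLeft_onRight _ _),
      coad, onLeft_cv]
    exact br_cv_right (strandFamily₂.strand 2) (strandFamily₂.comm 2 0 (by decide))
  refine Eq.trans ?_ (LinearMap.congr_fun evR_exchMap x).symm
  have e₃ : Q.lactA x = TensorProduct.lift (left k H ∘ₗ phi Q)
      (TensorProduct.map₂ (coad k H) (right k H) Q.flip x) := by
    rw [← coadjoint_act_eq]; rfl
  rw [e₃, lift_left_phi, e₁]
  rfl

lemma moduleL10_lact_eq : Q.moduleL10.lact = lactL Q := by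
  have e : (Q.lactA : ResDual k H ⊗[k] ResDual k H →ₗ[k] ResDual k H) =
    evR k H ∘ₗ exchMap Q := LinearMap.ext lactA_apply
  have key : ∀ (m m' f f' : ResDual k H ⊗[k] ResDual k H →ₗ[k] ResDual k H), m = m' → f = f' →
      m ∘ₗ f.lTensor (ResDual k H) ∘ₗ
        (TensorProduct.assoc k (ResDual k H) (ResDual k H) (ResDual k H)).toLinearMap =
      m' ∘ₗ f'.lTensor (ResDual k H) ∘ₗ
        (TensorProduct.assoc k (ResDual k H) (ResDual k H) (ResDual k H)).toLinearMap := by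
    rintro _ _ _ _ rfl rfl; rfl
  exact key Q.L01.mul (mulL Q) Q.lactA (evR k H ∘ₗ exchMap Q) L01_mul_eq e

lemma moduleL10_act_eq : Q.moduleL10.act = coad k H := coadjoint_act_eq

theorem isEquivariantModule_moduleL10 : Q.moduleL10.IsEquivariantModule := by
  refine isEquivariantModule_of ?_ ?_
  · rw [L10_mul_eq, moduleL10_lact_eq]; exact isAction_lactL
  · rw [L10_act_eq, moduleL10_act_eq, moduleL10_lact_eq]; exact equivar_lactL

end ResDual

/-! ### The algebras `𝓛_{g,n}(H)` and their modules -/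

section Surface

variable {k H : Type u} [Field k] [Ring H] [HopfAlgebra k H] (Q : QuasitriangularStructure k H)

theorem isModuleAlgebra_L0 : ∀ n, (Q.L0 n).IsModuleAlgebra
  | 0 => isModuleAlgebra_trivial
  | n + 1 => isModuleAlgebra_braidedTensor ResDual.isModuleAlgebra_L01 (isModuleAlgebra_L0 n)

theorem isModuleAlgebra_L : ∀ g n, (Q.L g n).IsModuleAlgebra
  | 0, n => isModuleAlgebra_L0 Q n
  | g + 1, n => isModuleAlgebra_braidedTensor ResDual.isModuleAlgebra_L10 (isModuleAlgebra_L g n)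

theorem isEquivariantModule_stateModule0 : ∀ (n : ℕ) (X : Fin n → ModuleCat.{u} H),
    (Q.stateModule0 n X).IsEquivariantModule
  | 0, _ => isEquivariantModule_trivial
  | n + 1, X => isEquivariantModule_braidedExternal (isModuleAlgebra_L0 Q n)
      (ResDual.isEquivariantModule_moduleL01 (X 0))
      (isEquivariantModule_stateModule0 n (Fin.tail X))

theorem isEquivariantModule_stateModule : ∀ (g n : ℕ) (X : Fin n → ModuleCat.{u} H),
    (Q.stateModule g n X).IsEquivariantModule
  | 0, n, X => isEquivariantModule_stateModule0 Q n X
  | g + 1, n, X => isEquivariantModule_braidedExternal (isModuleAlgebra_L Q g n)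
      ResDual.isEquivariantModule_moduleL10 (isEquivariantModule_stateModule g n X)

end Surface

/-! ### Representations on extension groups -/

section Representation

variable {k H : Type u} [Field k] [Ring H] [HopfAlgebra k H] {A : PreModuleAlgebra k H}
  {M : PreEquivariantModule A} {hA : A.IsModuleAlgebra} (hM : M.IsEquivariantModule)

lemma lactHom_mul (a b : hA.invariants) :
    hM.lactHom (a * b) = hM.lactHom b ≫ hM.lactHom a :=
  ModuleCat.hom_ext (LinearMap.ext fun v => hM.mul_lact a.1 b.1 v)

lemma lactHom_one : hM.lactHom (1 : hA.invariants) = 𝟙 M.toModuleCat :=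
  ModuleCat.hom_ext (LinearMap.ext fun v => hM.one_lact v)

lemma lactHom_add (a b : hA.invariants) :
    hM.lactHom (a + b) = hM.lactHom a + hM.lactHom b :=
  ModuleCat.hom_ext (LinearMap.ext fun v =>
    LinearMap.congr_fun (map_add (TensorProduct.curry M.lact) a.1 b.1) v)

/-- The linear structure on morphisms and on Ext comes through k → Hᵐᵒᵖ, so it has to agree with the
given scalars. -/
lemma algebraMap_op_smul (V : HopfRightModule k H) (c : k) (v : V.carrier) :
    algebraMap k Hᵐᵒᵖ c • v = c • v := by
  change V.act (algebraMap k H c) v = c • v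
  rw [Algebra.algebraMap_eq_smul_one, map_smul, V.act_one]
  rfl

lemma lactHom_smul (c : k) (a : hA.invariants) :
    hM.lactHom (c • a) = c • hM.lactHom a := by
  refine ModuleCat.hom_ext (LinearMap.ext fun v => ?_)
  refine (LinearMap.congr_fun (map_smul (TensorProduct.curry M.lact) c a.1) v).trans ?_
  exact (algebraMap_op_smul M.toHopfRightModule c _).symm

/-- The representation of the invariants of `A` on `Ext^m(X, M)` by postcomposition. -/
def extRep (X : ModuleCat.{u} Hᵐᵒᵖ) (m : ℕ) :
    hA.invariants →ₐ[k] Module.End k (Ext X M.toModuleCat m) :=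
  AlgHom.ofLinearMap
    (LinearMap.mk₂ k
      (fun a α => α.comp (Ext.mk₀ (hM.lactHom a)) (add_zero m))
      (fun a b α => by rw [lactHom_add, Ext.mk₀_add, Ext.comp_add])
      (fun c a α => by rw [lactHom_smul, Ext.mk₀_smul, Ext.comp_smul])
      (fun a α β => Ext.add_comp _ _ _ _)
      (fun c a α => Ext.smul_comp _ _ _ _))
    (LinearMap.ext fun α => by
      change α.comp (Ext.mk₀ (hM.lactHom 1)) (add_zero m) = α
      rw [lactHom_one, Ext.comp_mk₀_id])
    (fun a b => LinearMap.ext fun α => by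
      change α.comp (Ext.mk₀ (hM.lactHom (a * b))) (add_zero m) =
        (α.comp (Ext.mk₀ (hM.lactHom b)) (add_zero m)).comp (Ext.mk₀ (hM.lactHom a)) (add_zero m)
      rw [lactHom_mul, ← Ext.mk₀_comp_mk₀, Ext.comp_assoc_of_third_deg_zero])

lemma extRep_extMk {X : ModuleCat.{u} Hᵐᵒᵖ} (P : ProjectiveResolution X) {m : ℕ}
    (a : hA.invariants) (f : P.complex.X m ⟶ M.toModuleCat)
    (hf : P.complex.d (m + 1) m ≫ f = 0) :
    extRep hM X m a (P.extMk f (m + 1) rfl hf) =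
      P.extMk (f ≫ hM.lactHom a) (m + 1) rfl
        (by rw [← Category.assoc, hf, Limits.zero_comp]) :=
  P.extMk_comp_mk₀ f (m + 1) rfl hf (hM.lactHom a)

/-- One projective resolution is enough: each class in Ext is represented by a cocycle on it, where
the required formula fixes the value of ρ. -/
lemma eq_extRep {X : ModuleCat.{u} Hᵐᵒᵖ} {m : ℕ}
    (ρ : hA.invariants →ₐ[k] Module.End k (Ext X M.toModuleCat m))
    (hρ : ∀ (P : ProjectiveResolution X) (a : hA.invariants)
      (f : P.complex.X m ⟶ M.toModuleCat) (hf : P.complex.d (m + 1) m ≫ f = 0),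
      ρ a (P.extMk f (m + 1) rfl hf) = P.extMk (f ≫ hM.lactHom a) (m + 1) rfl
        (by rw [← Category.assoc, hf, Limits.zero_comp])) :
    ρ = extRep hM X m := by
  refine AlgHom.ext fun a => LinearMap.ext fun α => ?_
  obtain ⟨f, hf, rfl⟩ := (projectiveResolution X).extMk_surjective α (m + 1) rfl
  rw [hρ, extRep_extMk]

end Representation

end HopfStrand

end

/-! ### The representation of the invariants on Ext. -/

theorem theorem4 {k H : Type u} [Field k] [Ring H] [HopfAlgebra k H]
    (Q : QuasitriangularStructure k H) (g n : ℕ) (Xs : Fin n → ModuleCat.{u} H) :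
    ∃ (hL : (Q.L g n).IsModuleAlgebra) (hM : (Q.stateModule g n Xs).IsEquivariantModule),
      ∀ (X : ModuleCat.{u} Hᵐᵒᵖ) (m : ℕ),
        ∃! ρ : hL.invariants →ₐ[k] Module.End k (Ext X (Q.stateModule g n Xs).toModuleCat m),
          ∀ (P : ProjectiveResolution X) (a : hL.invariants)
            (f : P.complex.X m ⟶ (Q.stateModule g n Xs).toModuleCat)
            (hf : P.complex.d (m + 1) m ≫ f = 0),
            ρ a (P.extMk f (m + 1) rfl hf) =
              P.extMk (f ≫ hM.lactHom a) (m + 1) rfl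
                (by rw [← Category.assoc, hf, Limits.zero_comp]) := by
  have hL := HopfStrand.isModuleAlgebra_L Q g n
  have hM := HopfStrand.isEquivariantModule_stateModule Q g n Xs
  exact ⟨hL, hM, fun X m => ⟨HopfStrand.extRep hM X m, fun P a f hf => HopfStrand.extRep_extMk hM P a f hf,
    fun ρ hρ => HopfStrand.eq_extRep hM ρ hρ⟩⟩
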